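/- Let $\mathcal{P}$ be a family of probability measures on a measurable space $\mathcal{X}$. For probability measures $P,Q$ on a common space let $\chi^2(P\|Q)=\int \frac{(dP-dQ)^2}{dQ}$ ($=\infty$ if $P\not\ll Q$) and $H^2(P,Q)=\int(\sqrt{dP}-\sqrt{dQ})^2$. Define, with values in $[0,\infty]$, $$C=\sup_{\rho}\ \mathbb{E}_{P\sim\rho}\big[\chi^2\big(P\,\big\|\,\mathbb{E}_{P'\sim\rho}[P']\big)\big],\qquad D_{\chi^2}=\sup_{P_1,P_2\in\mathcal{P}}\chi^2(P_1\|P_2),$$ $$D_{H^2}=\sup_{P_1,P_2\in\mathcal{P}}H^2(P_1,P_2),\qquad \Delta_{H^2}=\Big(1-\frac{D_{H^2}}{2}\Big)^{-2},$$ where the first supremum is over all prior distributions $\rho$ on $\mathcal{P}$ and $\Delta_{H^2}=\infty$ if $D_{H^2}=2$. Let $n\ge 1$ and $P_1,\dots,P_n\in\mathcal{P}$, and consider on $\mathcal{X}^n$ the permutation mixture and its i.i.d. counterpart $$\mathbb{P}_n=\frac1{n!}\sum_{\pi\in S_n}\bigotimes_{i=1}^n P_{\pi(i)},\qquad \mathbb{Q}_n=\Big(\frac1n\sum_{i=1}^n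 P_i\Big)^{\otimes n}.$$ Then: 1. If $C<\infty$, then $\chi^2(\mathbb{P}_n\|\mathbb{Q}_n)\le 10\sum_{\ell=2}^n C^\ell$. 2. If $\Delta_{H^2}<\infty$ and $C<\infty$, then $\chi^2(\mathbb{P}_n\|\mathbb{Q}_n)\le (e\,\Delta_{H^2})^{C}-1$. 3. If $D_{\chi^2}<\infty$, then $C<\infty$ and $\chi^2(\mathbb{P}_n\|\mathbb{Q}_n)\le (1+D_{\chi^2})^{1+C}-1$. -/

import Mathlib

open MeasureTheory
open scoped ENNReal Nat

/-- The `χ²` divergence `∫ (dP - dQ)² / dQ`, equal to `∞` when `P` is not absolutely continuous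
with respect to `Q`. -/
noncomputable def chiSqDiv {X : Type*} [MeasurableSpace X] (P Q : Measure X) : ℝ≥0∞ :=
  open Classical in
  if P ≪ Q then ∫⁻ x, ENNReal.ofReal (((P.rnDeriv Q x).toReal - 1) ^ 2) ∂Q else ∞

/-- The squared Hellinger distance `∫ (√dP - √dQ)²`, with densities taken with respect to the
dominating measure `P + Q`. -/
noncomputable def hellingerSq {X : Type*} [MeasurableSpace X] (P Q : Measure X) : ℝ≥0∞ :=
  ∫⁻ x, ENNReal.ofReal
    ((√(P.rnDeriv (P + Q) x).toReal - √(Q.rnDeriv (P + Q) x).toReal) ^ 2) ∂(P + Q)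

/-- A prior distribution over a family `𝓕` of probability measures on `X`: a probability measure
on `𝓕`, on any σ-algebra for which `P ↦ P A` is measurable for every measurable `A ⊆ X` (so that
mixtures are defined). This covers discrete priors (with the σ-algebra of all subsets) as well as
priors on the σ-algebra generated by the evaluation maps. -/
structure FamilyPrior {X : Type*} [MeasurableSpace X] (𝓕 : Set (ProbabilityMeasure X)) where
  sigmaAlg : MeasurableSpace 𝓕
  measurable_coe : @Measurable 𝓕 (Measure X) sigmaAlg _ (fun P => (P.1 : Measure X))
  law : @Measure 𝓕 sigmaAlg
  isProbabilityMeasure_law : IsProbabilityMeasure law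

/-- The mixture `E_{P ∼ ρ}[P]`, that is `A ↦ ∫ P A dρ(P)`. -/
noncomputable def FamilyPrior.mixture {X : Type*} [MeasurableSpace X]
    {𝓕 : Set (ProbabilityMeasure X)} (ρ : FamilyPrior 𝓕) : Measure X :=
  ρ.law.bind (fun P => (P.1 : Measure X))

/-- The `χ²` mutual information `I_{χ²}(P; X) = E_{P ∼ ρ}[χ²(P ‖ E_{P' ∼ ρ}[P'])]`. -/
noncomputable def FamilyPrior.chiSqInfo {X : Type*} [MeasurableSpace X]
    {𝓕 : Set (ProbabilityMeasure X)} (ρ : FamilyPrior 𝓕) : ℝ≥0∞ :=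
  ∫⁻ P, chiSqDiv (P.1 : Measure X) ρ.mixture ∂ρ.law

/-- The `χ²` channel capacity of a family. -/
noncomputable def chiSqCapacity {X : Type*} [MeasurableSpace X]
    (𝓕 : Set (ProbabilityMeasure X)) : ℝ≥0∞ :=
  ⨆ ρ : FamilyPrior 𝓕, ρ.chiSqInfo

/-- The `χ²` diameter of a family. -/
noncomputable def chiSqDiam {X : Type*} [MeasurableSpace X]
    (𝓕 : Set (ProbabilityMeasure X)) : ℝ≥0∞ :=
  ⨆ P₁ ∈ 𝓕, ⨆ P₂ ∈ 𝓕, chiSqDiv (P₁ : Measure X) (P₂ : Measure X)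

/-- The `H²` diameter of a family; it is at most `2`. -/
noncomputable def hellingerDiam {X : Type*} [MeasurableSpace X]
    (𝓕 : Set (ProbabilityMeasure X)) : ℝ≥0∞ :=
  ⨆ P₁ ∈ 𝓕, ⨆ P₂ ∈ 𝓕, hellingerSq (P₁ : Measure X) (P₂ : Measure X)

/-- The maximum `H²` singularity `(1 - D / 2)⁻²`, where `D ≤ 2` is the `H²` diameter; it is `∞`
exactly when `D = 2`. -/
noncomputable def hellingerSingularity {X : Type*} [MeasurableSpace X]
    (𝓕 : Set (ProbabilityMeasure X)) : ℝ≥0∞ :=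
  ((1 - hellingerDiam 𝓕 / 2) ^ 2)⁻¹

/-- The permutation mixture `E_π [⊗ᵢ P_{π(i)}]`, with `π` uniform on the permutations of the
`n` indices. -/
noncomputable def permMixture {X : Type*} [MeasurableSpace X] {n : ℕ}
    (P : Fin n → ProbabilityMeasure X) : Measure (Fin n → X) :=
  ((n ! : ℕ) : ℝ≥0∞)⁻¹ •
    ∑ π : Equiv.Perm (Fin n), Measure.pi (fun i => (P (π i) : Measure X))

/-- The i.i.d. counterpart `((1/n) ∑ᵢ Pᵢ)^{⊗ n}`. -/
noncomputable def iidMixture {X : Type*} [MeasurableSpace X] {n : ℕ}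
    (P : Fin n → ProbabilityMeasure X) : Measure (Fin n → X) :=
  Measure.pi (fun _ => (n : ℝ≥0∞)⁻¹ • ∑ i, (P i : Measure X))

/-! Let `Q` be the average of the `P i`, let `f i` be the density of `P i` with respect to `Q`, and
let `G i j = ∫ f i * f j ∂Q`. Expanding the square of the density of the permutation mixture, where
only the relative permutation matters, gives `χ² + 1 = (1 / n!) * per G`. The matrix `G / n` is
symmetric, positive semidefinite and doubly stochastic, so `G / n = J / n + ∑ k, b k (b k)ᵀ` with
`J` the all-ones matrix and the `b k` orthogonal, centred and of squared norms `lam k`, the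
remaining eigenvalues. The uniform prior on the `P i` shows `∑ lam k ≤ C`. What remains is to bound
a permanent by its spectrum.

First bound: expand the permanent in powers of the centred part. Order zero gives 1, and order one
is at most 0. The order-`l` term is a sum of squares of polarised elementary symmetric polynomials
evaluated at the `b k`. Banach's theorem (`MultilinearMap.abs_le_of_abs_diag_le`) reduces these to
the diagonal, where the saddle-point estimate `sq_esymm_le_of_sum_sq_eq_card` gives `e_l(x)² ≤ 10 *
choose n l` for centred `x` with `∑ x i ^ 2 = n`. After normalisation the term is at most `10 * (∑
lam k) ^ l`.

Second and third bounds: by Wick's formula the permanent of a Gram matrix is the mean of a product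
of squared moduli of complex Gaussians. AM-GM and orthogonality then bound `n^n / n! * per (G / n)`
by the complete homogeneous polynomial of degree `n` in the spectrum, hence by `∏ (1 - lam k)⁻¹`
(`permanent_le_prod_inv_one_sub`). A spectral gap turns each factor into a power of a fixed base
with exponent proportional to `lam k`, and the trace bound finishes. The gap comes from a Poincaré
inequality in the Hellinger case (`le_one_sub_of_le_entries`), and from testing the `χ²` inequality
on eigenfunctions in the other (`mul_one_add_le_of_chiSqDiv_le`). -/

/-! ### Averages over the unit circle. -/

theorem circleAverage_pow_mul_inv_pow (k l : ℕ) :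
    Real.circleAverage (fun z : ℂ => z ^ k * z⁻¹ ^ l) 0 1 = if k = l then 1 else 0 := by
  have key : ∀ j : ℕ, j ≠ 0 → Real.circleAverage (fun z : ℂ => z ^ j) 0 1 = 0 := by
    intro j hj
    rw [DiffContOnCl.circleAverage (f := fun z : ℂ => z ^ j) (by
      exact (Differentiable.diffContOnCl (by fun_prop)))]
    simp [hj]
  have hne : ∀ z ∈ Metric.sphere (0 : ℂ) |1|, z ≠ 0 := by
    intro z hz h; simp [h] at hz
  rcases lt_trichotomy k l with h | h | h
  · rw [if_neg h.ne]
    refine Eq.trans ?_ (Real.circleAverage_zero_one_congr_inv.trans (key (l - k) (by omega)))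
    refine Real.circleAverage_congr_sphere fun z hz => ?_
    have := hne z hz
    obtain ⟨d, rfl⟩ := Nat.exists_eq_add_of_lt h
    simp only [add_assoc k d 1, pow_add z⁻¹ k, Nat.add_sub_cancel_left]
    rw [← mul_assoc, ← mul_pow, mul_inv_cancel₀ this, one_pow, one_mul]
  · subst h
    rw [if_pos rfl, ← Real.circleAverage_const (1 : ℂ) 0 1]
    refine Real.circleAverage_congr_sphere fun z hz => ?_
    have := hne z hz
    simp [this]
  · rw [if_neg h.ne']
    refine Eq.trans ?_ (key (k - l) (by omega))
    refine Real.circleAverage_congr_sphere fun z hz => ?_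
    have := hne z hz
    obtain ⟨d, rfl⟩ := Nat.exists_eq_add_of_lt h
    simp only [add_assoc l d 1, pow_add z l, Nat.add_sub_cancel_left]
    rw [mul_right_comm, ← mul_pow, mul_inv_cancel₀ this, one_pow, one_mul]

/-- A Poisson kernel computation. Multiplied by `1 - w ^ 2`, the integrand splits as `1 / (1 - w z)
+ (w / z) / (1 - w / z)`. The first summand is analytic in the disc with value 1 at the centre; the
second becomes analytic with value 0 there after `z ↦ z⁻¹`. -/
theorem circleAverage_inv_one_sub_mul {w : ℂ} (hw : ‖w‖ < 1) :
    Real.circleAverage (fun z : ℂ => ((1 - w * z) * (1 - w * z⁻¹))⁻¹) 0 1 = (1 - w ^ 2)⁻¹ := by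
  have hn : ∀ z : ℂ, ‖z‖ ≤ 1 → 1 - w * z ≠ 0 := by
    intro z hz h
    have h1 : w * z = 1 := by linear_combination -h
    have h2 : ‖w * z‖ = 1 := by rw [h1]; simp
    rw [norm_mul] at h2
    nlinarith [norm_nonneg w, norm_nonneg z]
  have hw2 : 1 - w ^ 2 ≠ 0 := by rw [pow_two]; exact hn w hw.le
  have hmem : ∀ z ∈ closure (Metric.ball (0 : ℂ) |1|), ‖z‖ ≤ 1 := by
    intro z hz
    have := Metric.closure_ball_subset_closedBall hz
    simpa using this
  have hsm : ∀ z ∈ Metric.sphere (0 : ℂ) |1|, ‖z‖ = 1 := by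
    intro z hz; simpa using hz
  have d1 : DiffContOnCl ℂ (fun z : ℂ => (1 - w * z)⁻¹) (Metric.ball 0 |1|) := by
    refine DifferentiableOn.diffContOnCl fun z hz => ?_
    refine DifferentiableAt.differentiableWithinAt ?_
    refine DifferentiableAt.inv (by fun_prop) (hn z (hmem z hz))
  have d2 : DiffContOnCl ℂ (fun z : ℂ => w * z * (1 - w * z)⁻¹) (Metric.ball 0 |1|) := by
    refine DifferentiableOn.diffContOnCl fun z hz => ?_
    refine DifferentiableAt.differentiableWithinAt ?_
    refine DifferentiableAt.mul (by fun_prop) (DifferentiableAt.inv (by fun_prop) (hn z (hmem z hz)))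
  have a1 := d1.circleAverage
  have a2 := d2.circleAverage
  rw [← Real.circleAverage_zero_one_congr_inv] at a2
  simp only [mul_zero, sub_zero, inv_one, zero_mul] at a1 a2
  have c1 : CircleIntegrable (fun z : ℂ => (1 - w * z)⁻¹) 0 1 := by
    refine ContinuousOn.circleIntegrable zero_le_one fun z hz => ?_
    have hz1 : ‖z‖ = 1 := by simpa using hz
    exact ContinuousAt.continuousWithinAt
      (ContinuousAt.inv₀ (by fun_prop) (hn z hz1.le))
  have c2 : CircleIntegrable (fun z : ℂ => w * z⁻¹ * (1 - w * z⁻¹)⁻¹) 0 1 := by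
    refine ContinuousOn.circleIntegrable zero_le_one fun z hz => ?_
    have hz1 : ‖z‖ = 1 := by simpa using hz
    have hz0 : z ≠ 0 := by rintro rfl; simp at hz1
    refine ContinuousAt.continuousWithinAt ?_
    have hc : ContinuousAt (fun z : ℂ => z⁻¹) z := continuousAt_inv₀ hz0
    exact ((continuousAt_const.mul hc)).mul
      (ContinuousAt.inv₀ (continuousAt_const.sub (continuousAt_const.mul hc))
        (hn z⁻¹ (by simp [hz1])))
  have a3 := Real.circleAverage_fun_add c1 c2
  rw [a1, a2, add_zero] at a3
  have a4 := Real.circleAverage_fun_smul (a := (1 - w ^ 2)⁻¹) (c := 0) (R := 1)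
    (f := fun z : ℂ => (1 - w * z)⁻¹ + w * z⁻¹ * (1 - w * z⁻¹)⁻¹)
  rw [a3, smul_eq_mul, mul_one] at a4
  rw [← a4]
  refine Real.circleAverage_congr_sphere fun z hz => ?_
  have hz1 := hsm z hz
  have hz0 : z ≠ 0 := by rintro rfl; simp at hz1
  have h1 := hn z hz1.le
  have h2 := hn z⁻¹ (by simp [hz1])
  simp only [smul_eq_mul]
  rw [← mul_right_inj' hw2, mul_inv_cancel_left₀ hw2]
  field_simp
  have h3 : z - w ≠ 0 := by
    intro h; apply h2; field_simp; linear_combination h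
  field_simp
  ring

/-- The numbers `ζ - q` and `ζ + q` have product 1, so one of them lies inside the disc unless both
are unimodular. In that case they are conjugate and `ζ` is real. -/
theorem exists_joukowski_preimage {ζ : ℂ} (hζ : ζ.im ≠ 0) :
    ∃ w q : ℂ, ‖w‖ < 1 ∧ w ≠ 0 ∧ q ^ 2 = ζ ^ 2 - 1 ∧ w⁻¹ - w = 2 * q ∧ w⁻¹ + w = 2 * ζ := by
  obtain ⟨q, hq⟩ := IsAlgClosed.exists_pow_nat_eq (ζ ^ 2 - 1) (n := 2) (by norm_num)
  have hp : (ζ - q) * (ζ + q) = 1 := by linear_combination -hq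
  have h1 : ζ - q ≠ 0 := left_ne_zero_of_mul_eq_one hp
  have h2 : ζ + q ≠ 0 := right_ne_zero_of_mul_eq_one hp
  have hi : (ζ - q)⁻¹ = ζ + q := inv_eq_of_mul_eq_one_right hp
  have hi' : (ζ + q)⁻¹ = ζ - q := inv_eq_of_mul_eq_one_left hp
  rcases lt_trichotomy ‖ζ - q‖ 1 with h | h | h
  · exact ⟨ζ - q, q, h, h1, hq, by rw [hi]; ring, by rw [hi]; ring⟩
  · exfalso
    have : (starRingEnd ℂ) (ζ - q) = ζ + q := by
      rw [← hi]; exact (Complex.inv_eq_conj h).symm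
    apply hζ
    have e := congrArg Complex.im this
    simp at e
    linarith
  · refine ⟨ζ + q, -q, ?_, h2, by rw [neg_sq, hq], by rw [hi']; ring, by rw [hi']; ring⟩
    rw [← hi, norm_inv]
    exact inv_lt_one_of_one_lt₀ h

/-- The integrand is the real part of `1 / (1 + I s (Re z - c))`, whose pole in `Re z` is `ζ = c + I
/ s`. Its average has modulus `1 / (s |ζ² - 1|^(1/2))`, and `|ζ² - 1| ≥ 2 / s` whatever `c` is.
Uniformity in `c` is essential, because the centre of the peak is not controlled later. -/
theorem circleAverage_inv_one_add_sq_mul_le {s : ℝ} (hs : 0 < s) (c : ℝ) :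
    (Real.circleAverage (fun z : ℂ => (1 + s ^ 2 * (z.re - c) ^ 2)⁻¹) 0 1) ^ 2 ≤ 1 / (2 * s) := by
  set ζ : ℂ := c + Complex.I / s with hζ
  have hs' : (s : ℂ) ≠ 0 := by exact_mod_cast hs.ne'
  have him : ζ.im = 1 / s := by
    simp [hζ, Complex.div_im]
  have hre : ζ.re = c := by simp [hζ, Complex.div_re]
  obtain ⟨w, q, hw, hw0, hq, hd, ha⟩ := exists_joukowski_preimage (ζ := ζ) (by
    rw [him]; positivity)
  have hq0 : ‖q‖ ^ 2 ≥ 2 / s := by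
    rw [← norm_pow, hq]
    have e1 : ‖ζ ^ 2 - 1‖ ^ 2 = (c ^ 2 + (1 / s) ^ 2 - 1) ^ 2 + 4 * (1 / s) ^ 2 := by
      rw [Complex.sq_norm, Complex.normSq_apply]
      simp only [pow_two, Complex.sub_re, Complex.mul_re, Complex.sub_im, Complex.mul_im,
        him, hre, Complex.one_re, Complex.one_im]
      ring
    have : (2 / s) ^ 2 ≤ ‖ζ ^ 2 - 1‖ ^ 2 := by
      rw [e1]
      have : (2 / s) ^ 2 = 4 * (1 / s) ^ 2 := by ring
      rw [this]
      nlinarith [sq_nonneg (c ^ 2 + (1 / s) ^ 2 - 1)]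
    exact (pow_le_pow_iff_left₀ (by positivity) (norm_nonneg _) (by norm_num)).1 this
  -- With this factor, `1 + I s (Re z - c) = κ (1 - w z) (1 - w z⁻¹)` on the unit circle, where `Re
  -- z = (z + z⁻¹) / 2`.
  set κ : ℂ := -Complex.I * s * w⁻¹ / 2 with hκ
  have hI := Complex.I_ne_zero
  have hκ0 : κ ≠ 0 := by
    rw [hκ]; simp [hw0, hs.ne']
  have hint : Real.circleAverage (fun z : ℂ => (1 + Complex.I * s * (z.re - c))⁻¹) 0 1 =
      κ⁻¹ * (1 - w ^ 2)⁻¹ := by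
    rw [← circleAverage_inv_one_sub_mul hw, ← smul_eq_mul (a := κ⁻¹),
      ← Real.circleAverage_fun_smul]
    refine Real.circleAverage_congr_sphere fun z hz => ?_
    have hz1 : ‖z‖ = 1 := by simpa using hz
    have hzi : z⁻¹ = (starRingEnd ℂ) z := Complex.inv_eq_conj hz1
    have hz0 : z ≠ 0 := by rintro rfl; simp at hz1
    have hre2 : (z.re : ℂ) = (z + z⁻¹) / 2 := by
      rw [hzi, Complex.add_conj]; simp
    simp only [smul_eq_mul]
    rw [← mul_inv]
    congr 1
    rw [hre2, hκ]
    have hsζ : Complex.I * s * c = Complex.I * s * ζ + 1 := by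
      rw [hζ]; field_simp; rw [mul_add, Complex.I_mul_I]; ring
    have : w⁻¹ * ((1 - w * z) * (1 - w * z⁻¹)) = (w⁻¹ + w) - (z + z⁻¹) := by
      field_simp; ring
    rw [mul_sub, hsζ]
    calc _ = -(Complex.I * s / 2) * (2 * ζ - (z + z⁻¹)) := by ring
      _ = -(Complex.I * s / 2) * (w⁻¹ * ((1 - w * z) * (1 - w * z⁻¹))) := by rw [this, ha]
      _ = _ := by ring
  have hcl : Real.circleAverage (fun z : ℂ => (1 + s ^ 2 * (z.re - c) ^ 2)⁻¹) 0 1 =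
      (Real.circleAverage (fun z : ℂ => (1 + Complex.I * s * (z.re - c))⁻¹) 0 1).re := by
    have hne : ∀ z : ℂ, (1 + Complex.I * s * ((z.re : ℂ) - c)) ≠ 0 := by
      intro z h
      have := congrArg Complex.re h
      simp at this
    have hci : CircleIntegrable (fun z : ℂ => (1 + Complex.I * s * (z.re - c))⁻¹) 0 1 := by
      refine ContinuousOn.circleIntegrable zero_le_one (Continuous.continuousOn ?_)
      exact Continuous.inv₀ (by fun_prop) hne
    have := ContinuousLinearMap.circleAverage_comp_comm Complex.reCLM hci
    rw [Complex.reCLM_apply] at this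
    rw [← this]
    refine congrArg (fun f => Real.circleAverage f 0 1) (funext fun z => ?_)
    simp only [Function.comp, Complex.reCLM_apply]
    rw [Complex.inv_re, Complex.normSq_apply]
    simp
    ring
  rw [hcl, hint]
  have hnorm : ‖κ⁻¹ * (1 - w ^ 2)⁻¹‖ ^ 2 = 1 / (s ^ 2 * ‖q‖ ^ 2) := by
    rw [← mul_inv]
    have : κ * (1 - w ^ 2) = -Complex.I * s * q := by
      rw [hκ]
      calc _ = -Complex.I * s / 2 * (w⁻¹ - w ^ 2 * w⁻¹) := by ring
        _ = -Complex.I * s / 2 * (w⁻¹ - w) := by congr 2; field_simp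
        _ = _ := by rw [hd]; ring
    rw [this, norm_inv]
    simp [abs_of_pos hs]
    ring
  calc _ ≤ ‖κ⁻¹ * (1 - w ^ 2)⁻¹‖ ^ 2 := by
        rw [← sq_abs]
        exact pow_le_pow_left₀ (abs_nonneg _) (Complex.abs_re_le_norm _) 2
    _ = 1 / (s ^ 2 * ‖q‖ ^ 2) := hnorm
    _ ≤ 1 / (2 * s) := by
        apply one_div_le_one_div_of_le (by positivity)
        calc 2 * s = s ^ 2 * (2 / s) := by field_simp
          _ ≤ _ := by gcongr

/-- Cauchy's estimate for the coefficient of degree `l` of the polynomial `∏ (1 + x i * z)` on the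
circle of radius `r`. -/
theorem pow_mul_abs_esymm_le_circleAverage {ι : Type*} [Fintype ι] [DecidableEq ι] (x : ι → ℝ)
    {r : ℝ} (hr : 0 ≤ r) (l : ℕ) :
    r ^ l * |∑ S ∈ Finset.powersetCard l Finset.univ, ∏ i ∈ S, x i| ≤
      Real.circleAverage (fun z : ℂ => ∏ i, ‖1 + x i * r * z‖) 0 1 := by
  have hexp : ∀ z : ℂ, ∏ i, (1 + (x i : ℂ) * r * z) =
      ∑ S : Finset ι, ((r ^ S.card * ∏ i ∈ S, x i : ℝ) : ℂ) * z ^ S.card := by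
    intro z
    rw [Finset.prod_one_add, Finset.powerset_univ]
    refine Finset.sum_congr rfl fun S _ => ?_
    rw [Finset.prod_mul_distrib, Finset.prod_mul_distrib]
    push_cast
    simp only [Finset.prod_const]
    ring
  have hci : ∀ k : ℕ, CircleIntegrable (fun z : ℂ => z ^ k * z⁻¹ ^ l) 0 1 := by
    intro k
    refine ContinuousOn.circleIntegrable zero_le_one fun z hz => ?_
    have hz0 : z ≠ 0 := by rintro rfl; simp at hz
    exact ContinuousAt.continuousWithinAt
      ((continuousAt_id.pow k).mul ((continuousAt_inv₀ hz0).pow l))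
  have hco : Real.circleAverage (fun z : ℂ => (∏ i, (1 + (x i : ℂ) * r * z)) * z⁻¹ ^ l) 0 1 =
      ((r ^ l * ∑ S ∈ Finset.powersetCard l Finset.univ, ∏ i ∈ S, x i : ℝ) : ℂ) := by
    have e1 : (fun z : ℂ => (∏ i, (1 + (x i : ℂ) * r * z)) * z⁻¹ ^ l) =
        fun z : ℂ => ∑ S : Finset ι,
          ((r ^ S.card * ∏ i ∈ S, x i : ℝ) : ℂ) • (z ^ S.card * z⁻¹ ^ l) := by
      funext z
      rw [hexp, Finset.sum_mul]
      exact Finset.sum_congr rfl fun S _ => by rw [smul_eq_mul, mul_assoc]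
    rw [e1, Real.circleAverage_fun_sum]
    · have e2 : ∀ S : Finset ι, Real.circleAverage (fun z : ℂ =>
          ((r ^ S.card * ∏ i ∈ S, x i : ℝ) : ℂ) • (z ^ S.card * z⁻¹ ^ l)) 0 1 =
          if S.card = l then ((r ^ l * ∏ i ∈ S, x i : ℝ) : ℂ) else 0 := by
        intro S
        rw [Real.circleAverage_fun_smul, circleAverage_pow_mul_inv_pow]
        split_ifs with h
        · rw [h]; simp
        · simp
      simp only [e2]
      rw [← Finset.sum_filter, Finset.mul_sum, Complex.ofReal_sum]
      refine Finset.sum_congr ?_ fun _ _ => rfl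
      ext S; simp [Finset.mem_powersetCard]
    · intro S _
      exact (hci S.card).const_smul (a := ((r ^ S.card * ∏ i ∈ S, x i : ℝ) : ℂ))
  have h1 : r ^ l * |∑ S ∈ Finset.powersetCard l Finset.univ, ∏ i ∈ S, x i| =
      ‖Real.circleAverage (fun z : ℂ => (∏ i, (1 + (x i : ℂ) * r * z)) * z⁻¹ ^ l) 0 1‖ := by
    rw [hco, Complex.norm_real, Real.norm_eq_abs, abs_mul, abs_of_nonneg (pow_nonneg hr l)]
  rw [h1, Real.circleAverage, Real.circleAverage, norm_smul, smul_eq_mul, Real.norm_eq_abs,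
    abs_of_pos (by positivity)]
  refine mul_le_mul_of_nonneg_left ?_ (by positivity)
  refine (intervalIntegral.norm_integral_le_integral_norm (by positivity)).trans (le_of_eq ?_)
  refine intervalIntegral.integral_congr fun θ _ => ?_
  simp [circleMap, Complex.norm_exp]

/-! ### Elementary symmetric polynomials of centred vectors. -/

/-- AM-GM with a deficit: the constraint makes the exponent equal to `∑ (a i - 1)`, and `a ≤ exp (a
- 1)`. -/
theorem prod_le_exp_neg_sum_sq {ι : Type*} [Fintype ι] {a : ι → ℝ} (ha : ∀ i, 0 ≤ a i)
    (hs : ∑ i, a i ^ 2 = Fintype.card ι) :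
    ∏ i, a i ≤ Real.exp (-(∑ i, (a i - 1) ^ 2) / 2) := by
  have h : -(∑ i, (a i - 1) ^ 2) / 2 = ∑ i, (a i - 1) := by
    have : ∑ i, (a i - 1) ^ 2 = ∑ i, a i ^ 2 - 2 * ∑ i, (a i - 1) - Fintype.card ι := by
      rw [Finset.mul_sum, ← Finset.sum_sub_distrib]
      have : (Fintype.card ι : ℝ) = ∑ i : ι, (1 : ℝ) := by simp
      rw [this, ← Finset.sum_sub_distrib]
      exact Finset.sum_congr rfl fun i _ => by ring
    rw [this, hs]; ring
  rw [h, Real.exp_sum]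
  refine Finset.prod_le_prod (fun i _ => ha i) fun i _ => ?_
  have := Real.add_one_le_exp (a i - 1)
  linarith

theorem norm_one_add_mul_sq {z : ℂ} (hz : ‖z‖ = 1) (x r : ℝ) :
    ‖1 + (x : ℂ) * r * z‖ ^ 2 = 1 + 2 * x * r * z.re + x ^ 2 * r ^ 2 := by
  have h2 : z.re ^ 2 + z.im ^ 2 = 1 := by
    have := Complex.sq_norm z
    rw [hz, Complex.normSq_apply] at this
    linarith
  rw [Complex.sq_norm, Complex.normSq_apply]
  simp
  linear_combination (x ^ 2 * r ^ 2) * h2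

/-- A sum of squares of affine functions of `c` is at least its leading coefficient times the
squared distance to its minimiser. This is Cauchy-Schwarz against `v`. -/
theorem mul_sq_sub_le_sum_add_mul_sq {ι : Type*} (s : Finset ι) (u v : ι → ℝ)
    (hv : 0 < ∑ i ∈ s, v i ^ 2) (c : ℝ) :
    (∑ i ∈ s, v i ^ 2) * (c - -(∑ i ∈ s, u i * v i) / ∑ i ∈ s, v i ^ 2) ^ 2 ≤
      ∑ i ∈ s, (u i + v i * c) ^ 2 := by
  have h := Finset.sum_mul_sq_le_sq_mul_sq s (fun i => u i + v i * c) v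
  have h1 : ∑ i ∈ s, (u i + v i * c) * v i = ∑ i ∈ s, u i * v i + c * ∑ i ∈ s, v i ^ 2 := by
    rw [Finset.mul_sum, ← Finset.sum_add_distrib]
    exact Finset.sum_congr rfl fun i _ => by ring
  rw [h1] at h
  rw [← mul_le_mul_iff_left₀ hv]
  refine le_trans (le_of_eq ?_) h
  field_simp
  ring

/-- Since `x` is centred, the factors have mean square 1 on the whole circle, and the product decays
with their deviation from 1. Either coordinates of moderate size carry half of `∑ x i ^ 2`, and the
product is dominated by a Gaussian in `Re z`; or large coordinates do, and their factors stay far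
from 1 everywhere. -/
theorem exists_prod_norm_one_add_le {ι : Type*} [Fintype ι] [DecidableEq ι] [Nonempty ι] (x : ι → ℝ)
    (h0 : ∑ i, x i = 0) (h2 : ∑ i, x i ^ 2 = Fintype.card ι) {r : ℝ} (hr : 0 < r) :
    (∃ c : ℝ, ∀ z : ℂ, ‖z‖ = 1 → ∏ i, (‖1 + (x i : ℂ) * r * z‖ / √(1 + r ^ 2)) ≤
      Real.exp (-(Fintype.card ι * r ^ 2 / (1 + r ^ 2) ^ 2 / 36 * (z.re - c) ^ 2))) ∨
    (∀ z : ℂ, ‖z‖ = 1 → ∏ i, (‖1 + (x i : ℂ) * r * z‖ / √(1 + r ^ 2)) ≤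
      Real.exp (-(Fintype.card ι * r ^ 2 / (1 + r ^ 2) ^ 2 / 16))) := by
  set R := √(1 + r ^ 2) with hR
  have hRpos : 0 < R := by positivity
  have hR2 : R ^ 2 = 1 + r ^ 2 := Real.sq_sqrt (by positivity)
  have hR1 : 1 ≤ R := by nlinarith
  set n : ℝ := (Fintype.card ι : ℝ) with hn
  have hnpos : 0 < n := by rw [hn]; exact_mod_cast Fintype.card_pos
  -- The threshold `4 * R` gives `a ≤ 5` for the moderate factors, hence `(a ^ 2 - 1) ^ 2 ≤ 36 * (a
  -- - 1) ^ 2`, and `a - 1 ≥ |x i| * r / (2 * R)` for the others. The square `a ^ 2` is used because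
  -- it is affine in `Re z`.
  set s := Finset.univ.filter fun i => |x i| * r ≤ 4 * R with hs
  have hsq : ∀ z : ℂ, ‖z‖ = 1 → ∀ i, (‖1 + (x i : ℂ) * r * z‖ / R) ^ 2 =
      (1 + 2 * x i * r * z.re + x i ^ 2 * r ^ 2) / R ^ 2 := by
    intro z hz i
    rw [div_pow, norm_one_add_mul_sq hz]
  have hsum : ∀ z : ℂ, ‖z‖ = 1 → ∑ i, (‖1 + (x i : ℂ) * r * z‖ / R) ^ 2 = n := by
    intro z hz
    rw [Finset.sum_congr rfl fun i _ => hsq z hz i, ← Finset.sum_div]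
    have : ∑ i, (1 + 2 * x i * r * z.re + x i ^ 2 * r ^ 2) =
        n + 2 * r * z.re * ∑ i, x i + r ^ 2 * ∑ i, x i ^ 2 := by
      rw [Finset.mul_sum, Finset.mul_sum, Finset.sum_add_distrib, Finset.sum_add_distrib]
      simp only [Finset.sum_const, Finset.card_univ, nsmul_eq_mul, mul_one, ← hn]
      congr 1
      · congr 1
        exact Finset.sum_congr rfl fun i _ => by ring
      · exact Finset.sum_congr rfl fun i _ => by ring
    rw [this, h0, h2, hR2]
    field_simp
    ring
  have hprod : ∀ z : ℂ, ‖z‖ = 1 → ∏ i, (‖1 + (x i : ℂ) * r * z‖ / R) ≤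
      Real.exp (-(∑ i, (‖1 + (x i : ℂ) * r * z‖ / R - 1) ^ 2) / 2) := fun z hz =>
    prod_le_exp_neg_sum_sq (fun i => by positivity) (hsum z hz)
  have hnx : ∀ z : ℂ, ‖z‖ = 1 → ∀ i, ‖(x i : ℂ) * r * z‖ = |x i| * r := by
    intro z hz i
    simp [hz, abs_of_pos hr]
  rw [← hR2]
  by_cases hsmall : n / 2 ≤ ∑ i ∈ s, x i ^ 2
  · left
    set u : ι → ℝ := fun i => r ^ 2 * (x i ^ 2 - 1) / R ^ 2
    set v : ι → ℝ := fun i => 2 * x i * r / R ^ 2 with hv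
    have hV : ∑ i ∈ s, v i ^ 2 = 4 * r ^ 2 / (R ^ 2) ^ 2 * ∑ i ∈ s, x i ^ 2 := by
      rw [Finset.mul_sum]
      exact Finset.sum_congr rfl fun i _ => by simp only [hv]; ring
    have hV2 : 2 * (n * r ^ 2 / (R ^ 2) ^ 2) ≤ ∑ i ∈ s, v i ^ 2 := by
      rw [hV]
      calc _ = 4 * r ^ 2 / (R ^ 2) ^ 2 * (n / 2) := by ring
        _ ≤ _ := by gcongr
    have hVpos : 0 < ∑ i ∈ s, v i ^ 2 := lt_of_lt_of_le (by positivity) hV2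
    refine ⟨-(∑ i ∈ s, u i * v i) / ∑ i ∈ s, v i ^ 2, fun z hz => (hprod z hz).trans ?_⟩
    rw [Real.exp_le_exp]
    have key := mul_sq_sub_le_sum_add_mul_sq s u v hVpos z.re
    have h1 : ∀ i ∈ s, (u i + v i * z.re) ^ 2 ≤
        36 * (‖1 + (x i : ℂ) * r * z‖ / R - 1) ^ 2 := by
      intro i hi
      have hi' : |x i| * r ≤ 4 * R := (Finset.mem_filter.1 hi).2
      set a := ‖1 + (x i : ℂ) * r * z‖ / R with ha
      have ha0 : 0 ≤ a := by positivity
      have ha5 : a ≤ 5 := by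
        rw [ha, div_le_iff₀ hRpos]
        calc _ ≤ ‖(1 : ℂ)‖ + ‖(x i : ℂ) * r * z‖ := norm_add_le _ _
          _ = 1 + |x i| * r := by rw [hnx z hz, norm_one]
          _ ≤ _ := by linarith
      have : u i + v i * z.re = a ^ 2 - 1 := by
        rw [ha, hsq z hz i]
        simp only [u, v]
        field_simp
        rw [hR2]; ring
      rw [this]
      have : (a ^ 2 - 1) ^ 2 = (a + 1) ^ 2 * (a - 1) ^ 2 := by ring
      rw [this]
      refine mul_le_mul_of_nonneg_right ?_ (sq_nonneg _)
      nlinarith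
    have h3 : ∑ i ∈ s, (u i + v i * z.re) ^ 2 ≤
        36 * ∑ i, (‖1 + (x i : ℂ) * r * z‖ / R - 1) ^ 2 := by
      refine (Finset.sum_le_sum h1).trans ?_
      rw [← Finset.mul_sum]
      refine mul_le_mul_of_nonneg_left ?_ (by norm_num)
      exact Finset.sum_le_univ_sum_of_nonneg fun i => sq_nonneg _
    have h4 := mul_le_mul_of_nonneg_right hV2
      (sq_nonneg (z.re - -(∑ i ∈ s, u i * v i) / ∑ i ∈ s, v i ^ 2))
    linarith
  · right
    intro z hz
    refine (hprod z hz).trans ?_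
    rw [Real.exp_le_exp]
    have hbig : n / 2 ≤ ∑ i ∈ sᶜ, x i ^ 2 := by
      have := Finset.sum_add_sum_compl s fun i => x i ^ 2
      push Not at hsmall
      linarith
    have h1 : ∀ i ∈ sᶜ, r ^ 2 / (4 * R ^ 2) * x i ^ 2 ≤
        (‖1 + (x i : ℂ) * r * z‖ / R - 1) ^ 2 := by
      intro i hi
      have hi' : 4 * R < |x i| * r := by
        by_contra h
        exact (Finset.mem_compl.1 hi) (Finset.mem_filter.2 ⟨Finset.mem_univ _, not_lt.1 h⟩)
      have h5 : |x i| * r - 1 ≤ ‖1 + (x i : ℂ) * r * z‖ := by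
        have := norm_sub_norm_le ((x i : ℂ) * r * z) (-1)
        rw [hnx z hz, norm_neg, norm_one, sub_neg_eq_add, add_comm _ (1 : ℂ)] at this
        exact this
      have h6 : |x i| * r / (2 * R) ≤ ‖1 + (x i : ℂ) * r * z‖ / R - 1 := by
        rw [div_sub_one hRpos.ne', div_le_div_iff₀ (by positivity) hRpos]
        nlinarith
      calc _ = (|x i| * r / (2 * R)) ^ 2 := by
            rw [div_pow, mul_pow, sq_abs]; field_simp; ring
        _ ≤ _ := pow_le_pow_left₀ (by positivity) h6 2
    have h3 : r ^ 2 / (4 * R ^ 2) * ∑ i ∈ sᶜ, x i ^ 2 ≤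
        ∑ i, (‖1 + (x i : ℂ) * r * z‖ / R - 1) ^ 2 := by
      rw [Finset.mul_sum]
      exact (Finset.sum_le_sum h1).trans
        (Finset.sum_le_univ_sum_of_nonneg fun i => sq_nonneg _)
    have h4 : r ^ 2 / (4 * R ^ 2) * (n / 2) ≤ r ^ 2 / (4 * R ^ 2) * ∑ i ∈ sᶜ, x i ^ 2 := by
      gcongr
    have h5 : n * r ^ 2 / (R ^ 2) ^ 2 / 16 ≤ r ^ 2 / (4 * R ^ 2) * (n / 2) / 2 := by
      have : r ^ 2 / (4 * R ^ 2) * (n / 2) / 2 = n * r ^ 2 / R ^ 2 / 16 := by field_simp; ring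
      rw [this]
      gcongr
      nlinarith
    linarith

theorem factorial_le_exp_mul_sqrt_mul (n : ℕ) (hn : n ≠ 0) :
    (n ! : ℝ) ≤ Real.exp 1 * √n * (n / Real.exp 1) ^ n := by
  obtain ⟨k, rfl⟩ := Nat.exists_eq_succ_of_ne_zero hn
  have h := Stirling.stirlingSeq'_antitone (Nat.zero_le k)
  simp only [Function.comp] at h
  change Stirling.stirlingSeq (k + 1) ≤ Stirling.stirlingSeq 1 at h
  rw [Stirling.stirlingSeq_one, Stirling.stirlingSeq, div_le_iff₀ (by positivity)] at h
  refine h.trans (le_of_eq ?_)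
  rw [Real.sqrt_mul (by norm_num)]
  field_simp

/-- The constants leave room: Stirling from below for `n!` gives `√(2π) ≥ 2.5`, the upper bounds for
`l!` and `(n - l)!` cost a factor `e` each, and `3 * e ^ 2 ≤ 25`. -/
theorem stirling_le_choose {n l : ℕ} (hl : 0 < l) (hln : l < n) :
    3 * ((n : ℝ) ^ n / (l ^ l * ((n - l : ℕ) : ℝ) ^ (n - l))) * √(n / (l * (n - l : ℕ))) ≤
      10 * n.choose l := by
  have hk : 0 < n - l := by omega
  have h1 := Stirling.le_factorial_stirling n
  have h2 := factorial_le_exp_mul_sqrt_mul l hl.ne'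
  have h3 := factorial_le_exp_mul_sqrt_mul (n - l) hk.ne'
  have hc : (n.choose l : ℝ) = n ! / (l ! * (n - l)!) := Nat.cast_choose ℝ hln.le
  set k := n - l with hkdef
  have hnlk : n = l + k := by omega
  set e := Real.exp 1 with he
  have hepos : 0 < e := Real.exp_pos 1
  have he2 : e ^ 2 ≤ 7.4 := by
    have := Real.exp_one_lt_d9
    nlinarith
  have hl' : (0 : ℝ) < l := by exact_mod_cast hl
  have hk' : (0 : ℝ) < k := by exact_mod_cast hk
  have hn' : (0 : ℝ) < n := by rw [hnlk]; push_cast; positivity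
  have hpi : 2.5 * √(n : ℝ) ≤ √(2 * Real.pi * n) := by
    apply Real.le_sqrt_of_sq_le
    rw [mul_pow, Real.sq_sqrt hn'.le]
    have := Real.pi_gt_d2
    nlinarith
  rw [hc, ← mul_div_assoc (10 : ℝ), le_div_iff₀ (by positivity), Real.sqrt_div hn'.le,
    Real.sqrt_mul hl'.le]
  have hpow : ((n : ℝ) / e) ^ n = n ^ n / (e ^ l * e ^ k) := by
    rw [div_pow, ← pow_add, ← hnlk]
  calc _ ≤ 3 * ((n : ℝ) ^ n / (l ^ l * (k : ℝ) ^ k)) * (√n / (√l * √k)) *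
        ((e * √l * (l / e) ^ l) * (e * √k * (k / e) ^ k)) := by
        gcongr
    _ = 3 * e ^ 2 * √n * (n / e) ^ n := by
        rw [hpow, div_pow, div_pow]
        field_simp
    _ ≤ 10 * (2.5 * √n * (n / e) ^ n) := by
        have : 0 ≤ √(n : ℝ) * (n / e) ^ n := by positivity
        nlinarith
    _ ≤ 10 * n ! := by
        refine mul_le_mul_of_nonneg_left (le_trans ?_ h1) (by norm_num)
        gcongr

theorem sqrt_mul_exp_neg_le {m : ℝ} (hm : 0 < m) : Real.exp (-(m / 16)) ^ 2 ≤ 3 / √m := by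
  have h1 : Real.exp (-(m / 16)) ^ 2 = (Real.exp (m / 8))⁻¹ := by
    rw [← Real.exp_nat_mul, ← Real.exp_neg]; congr 1; push_cast; ring
  rw [h1, le_div_iff₀ (by positivity), inv_mul_le_iff₀ (by positivity)]
  have h2 := Real.add_one_le_exp (m / 8)
  nlinarith [Real.sq_sqrt hm.le, sq_nonneg (√m - 1), Real.sqrt_nonneg m]

/-- A Maclaurin-type inequality for real numbers which sum to zero. -/
theorem sq_esymm_le_of_sum_sq_eq_card {ι : Type*} [Fintype ι] [DecidableEq ι] (x : ι → ℝ)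
    (h0 : ∑ i, x i = 0) (h2 : ∑ i, x i ^ 2 = Fintype.card ι) {l : ℕ} (hl : 0 < l)
    (hln : l ≤ Fintype.card ι) :
    (∑ S ∈ Finset.powersetCard l Finset.univ, ∏ i ∈ S, x i) ^ 2 ≤
      10 * (Fintype.card ι).choose l := by
  -- For `l = n` the optimal radius is infinite, and AM-GM suffices.
  rcases hln.eq_or_lt with rfl | hlt
  · have hu : Finset.powersetCard (Fintype.card ι) (Finset.univ : Finset ι) = {Finset.univ} := by
      rw [← Finset.card_univ, Finset.powersetCard_self]
    rw [hu, Finset.sum_singleton, Nat.choose_self, ← Finset.prod_pow]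
    have h := prod_le_exp_neg_sum_sq (a := fun i => |x i|) (fun i => abs_nonneg _)
      (by simpa using h2)
    have h' : ∏ i, |x i| ≤ 1 := h.trans (by
      rw [Real.exp_le_one_iff]
      have : 0 ≤ ∑ i, (|x i| - 1) ^ 2 := Finset.sum_nonneg fun i _ => sq_nonneg _
      linarith)
    calc ∏ i, x i ^ 2 = (∏ i, |x i|) ^ 2 := by
          rw [← Finset.prod_pow]; simp
      _ ≤ 1 ^ 2 := pow_le_pow_left₀ (Finset.prod_nonneg fun i _ => abs_nonneg _) h' 2
      _ ≤ _ := by norm_num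
  · set n := Fintype.card ι with hn
    have hne : Nonempty ι := Fintype.card_pos_iff.1 (by omega)
    obtain ⟨k, hk, hnk⟩ : ∃ k, 0 < k ∧ n = l + k := ⟨n - l, by omega, by omega⟩
    have hl' : (0 : ℝ) < l := by exact_mod_cast hl
    have hk' : (0 : ℝ) < k := by exact_mod_cast hk
    have hn' : (n : ℝ) = l + k := by rw [hnk]; push_cast; ring
    set E := ∑ S ∈ Finset.powersetCard l Finset.univ, ∏ i ∈ S, x i with hE
    -- The saddle point: this `r` minimises `(1 + r ^ 2) ^ n / r ^ (2 * l)`, with minimum `n ^ n /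
    -- (l ^ l * k ^ k)`, which is `choose n l` up to the factor `√m` in Stirling's formula.
    set r := √((l : ℝ) / k) with hr
    have hrpos : 0 < r := by positivity
    have hr2 : r ^ 2 = l / k := Real.sq_sqrt (by positivity)
    have hR2 : 1 + r ^ 2 = n / k := by rw [hr2, hn']; field_simp; ring
    set R := √(1 + r ^ 2) with hR
    have hRpos : 0 < R := by positivity
    have hRsq : R ^ 2 = n / k := by rw [hR, Real.sq_sqrt (by positivity), hR2]
    set m : ℝ := n * r ^ 2 / (1 + r ^ 2) ^ 2 with hm
    have hnpos : (0 : ℝ) < n := by rw [hn']; positivity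
    have hmpos : 0 < m := by positivity
    have hm' : m = l * k / n := by rw [hm, hR2, hr2]; field_simp
    set A := Real.circleAverage (fun z : ℂ => ∏ i, (‖1 + (x i : ℂ) * r * z‖ / R)) 0 1 with hA
    have hcont : CircleIntegrable (fun z : ℂ => ∏ i, (‖1 + (x i : ℂ) * r * z‖ / R)) 0 1 :=
      ContinuousOn.circleIntegrable zero_le_one (Continuous.continuousOn (by fun_prop))
    have hA0 : 0 ≤ A := Real.circleAverage_nonneg_of_nonneg fun z _ => by positivity
    have hbound : r ^ l * |E| ≤ R ^ n * A := by
      refine (pow_mul_abs_esymm_le_circleAverage x hrpos.le l).trans (le_of_eq ?_)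
      rw [hA, ← smul_eq_mul, ← Real.circleAverage_fun_smul]
      refine congrArg (fun f => Real.circleAverage f 0 1) (funext fun z => ?_)
      rw [Finset.prod_div_distrib, Finset.prod_const, Finset.card_univ, ← hn, smul_eq_mul, mul_div_assoc',
        mul_div_cancel_left₀ _ (pow_ne_zero n hRpos.ne')]
    have hAle : A ^ 2 ≤ 3 / √m := by
      rcases exists_prod_norm_one_add_le x h0 h2 hrpos with ⟨c, hc⟩ | hc
      -- The Gaussian `exp (-y)` is replaced by `1 / (1 + y)`, whose average is known. Here `s ^ 2 =
      -- m / 36`, and `1 / (2 * s) = 3 / √m`.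
      · have hs : 0 < √m / 6 := by positivity
        refine le_trans (pow_le_pow_left₀ hA0 ?_ 2)
          ((circleAverage_inv_one_add_sq_mul_le hs c).trans (le_of_eq (by field_simp; norm_num)))
        refine Real.circleAverage_mono hcont ?_ fun z hz => ?_
        · refine ContinuousOn.circleIntegrable zero_le_one (Continuous.continuousOn ?_)
          refine Continuous.inv₀ (by fun_prop) fun z => ?_
          positivity
        · refine (hc z (by simpa using hz)).trans ?_
          rw [Real.exp_neg]
          refine inv_anti₀ (by positivity) ?_
          have := Real.add_one_le_exp (m / 36 * (z.re - c) ^ 2)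
          rw [div_pow, Real.sq_sqrt hmpos.le]
          linarith
      · refine le_trans (pow_le_pow_left₀ hA0 ?_ 2) (sqrt_mul_exp_neg_le hmpos)
        exact Real.circleAverage_mono_on_of_le_circle hcont fun z hz => hc z (by simpa using hz)
    have hE2 : (l / k : ℝ) ^ l * E ^ 2 ≤ (n / k : ℝ) ^ n * (3 / √m) := by
      have h3 := pow_le_pow_left₀ (by positivity) hbound 2
      rw [mul_pow, mul_pow, sq_abs, ← pow_mul, ← pow_mul, mul_comm l 2, mul_comm n 2, pow_mul,
        pow_mul, hr2, hRsq] at h3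
      exact h3.trans (by gcongr)
    refine le_trans ?_ (stirling_le_choose hl hlt)
    have hnl : n - l = k := by omega
    rw [hnl]
    have hsq : √((n : ℝ) / (l * k)) = 1 / √m := by
      rw [hm', one_div, ← Real.sqrt_inv, inv_div]
    rw [hsq]
    have hpos : (0 : ℝ) < (l / k : ℝ) ^ l := by positivity
    rw [← mul_le_mul_iff_right₀ hpos]
    refine hE2.trans (le_of_eq ?_)
    have : (k : ℝ) ^ n = k ^ l * k ^ k := by rw [← pow_add, ← hnk]
    rw [div_pow, div_pow, this]
    field_simp

/-! ### Banach's theorem on symmetric multilinear forms. -/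

/-- Freeze all slots but `i` and `j`, leaving a symmetric bilinear form `B` with `|B a a| ≤ N * ‖a‖
^ 2`. Polarisation and the parallelogram law give `4 * N ≤ |B p p| + |B d d| ≤ N * (‖p‖ ^ 2 + ‖d‖ ^
2) = 4 * N`, where `p` and `d` are the sum and the difference of `u i` and `u j`. Equality
throughout means that the direction of `p` in both slots is again extremal. -/
theorem MultilinearMap.exists_unit_abs_eq_of_isMaxOn {ι V : Type*} [Fintype ι] [DecidableEq ι]
    [NormedAddCommGroup V] [InnerProductSpace ℝ V] (E : MultilinearMap ℝ (fun _ : ι => V) ℝ)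
    (hE : ∀ (σ : Equiv.Perm ι) (v : ι → V), E (fun i => v (σ i)) = E v) {N : ℝ}
    (hN : ∀ v : ι → V, |E v| ≤ N * ∏ i, ‖v i‖) {u : ι → V} (hu : ∀ i, ‖u i‖ = 1)
    (huN : |E u| = N) {i j : ι} (hij : i ≠ j) :
    ∃ w : V, ‖w‖ = 1 ∧ ‖u i + u j‖ • w = u i + u j ∧
      |E (Function.update (Function.update u i w) j w)| = N := by
  set B : V → V → ℝ := fun a b => E (Function.update (Function.update u i a) j b) with hB
  have hBadd : ∀ a b c, B (a + b) c = B a c + B b c := by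
    intro a b c
    simp only [hB, Function.update_comm hij, E.map_update_add]
  have hBsmul : ∀ (t : ℝ) a b, B (t • a) b = t * B a b := by
    intro t a b
    simp only [hB, Function.update_comm hij, E.map_update_smul, smul_eq_mul]
  have hBsymm : ∀ a b, B a b = B b a := by
    intro a b
    simp only [hB]
    rw [← hE (Equiv.swap i j)]
    congr 1
    funext k
    rcases eq_or_ne k i with rfl | hki
    · simp [hij]
    rcases eq_or_ne k j with rfl | hkj
    · simp [hij]
    · rw [Equiv.swap_apply_of_ne_of_ne hki hkj]
      simp [hki, hkj]
  have hBle : ∀ a, |B a a| ≤ N * ‖a‖ ^ 2 := by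
    intro a
    refine (hN _).trans (le_of_eq ?_)
    congr 1
    rw [← Finset.mul_prod_erase _ _ (Finset.mem_univ j),
      ← Finset.mul_prod_erase _ _ (Finset.mem_erase.2 ⟨hij, Finset.mem_univ i⟩)]
    rw [Finset.prod_eq_one]
    · simp [hij, pow_two]
    · intro k hk
      simp only [Finset.mem_erase] at hk
      simp [hk.1, hk.2.1, hu]
  have hBu : B (u i) (u j) = E u := by simp [hB]
  have hN0 : 0 ≤ N := huN ▸ abs_nonneg _
  set p := u i + u j with hp
  have hpd : ‖p‖ ^ 2 + ‖u i - u j‖ ^ 2 = 4 := by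
    have := parallelogram_law_with_norm ℝ (u i) (u j)
    rw [hu, hu] at this
    rw [hp]; nlinarith
  have hpol : 4 * B (u i) (u j) = B p p - B (u i - u j) (u i - u j) := by
    have hneg : ∀ a b, B (-a) b = -B a b := by
      intro a b
      have := hBsmul (-1) a b
      simpa using this
    have hadd' : ∀ a b c, B c (a + b) = B c a + B c b := by
      intro a b c; rw [hBsymm, hBadd, hBsymm a, hBsymm b]
    have hneg' : ∀ a b, B b (-a) = -B b a := by
      intro a b; rw [hBsymm, hneg, hBsymm]
    rw [hp]
    simp only [sub_eq_add_neg, hBadd, hadd', hneg, hneg']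
    rw [hBsymm (u j) (u i)]
    ring
  by_cases hp0 : p = 0
  -- If `u j = -u i`, any unit vector satisfies the middle condition, and `u i` in both slots only
  -- changes the sign of the value.
  · refine ⟨u i, hu i, by simp [hp0], ?_⟩
    have hj : u j = -u i := by rw [eq_neg_iff_add_eq_zero, add_comm]; exact hp0
    have : B (u i) (u i) = - B (u i) (u j) := by
      rw [hj, hBsymm (u i) (-u i)]
      have := hBsmul (-1) (u i) (u i)
      simp only [neg_smul, one_smul] at this
      rw [this]; ring
    change |B (u i) (u i)| = N
    rw [this, hBu, abs_neg, huN]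
  · have hpn : 0 < ‖p‖ := norm_pos_iff.2 hp0
    have hBpp : N * ‖p‖ ^ 2 ≤ |B p p| := by
      have h1 : 4 * N ≤ |B p p| + |B (u i - u j) (u i - u j)| := by
        rw [← huN, ← hBu]
        calc 4 * |B (u i) (u j)| = |4 * B (u i) (u j)| := by rw [abs_mul]; norm_num
          _ ≤ _ := by rw [hpol]; exact abs_sub _ _
      have h2 := hBle (u i - u j)
      nlinarith
    have hpp : |B p p| = N * ‖p‖ ^ 2 := le_antisymm (hBle p) hBpp
    refine ⟨‖p‖⁻¹ • p, by simp [norm_smul, hpn.ne'], by rw [smul_smul]; simp [hpn.ne'], ?_⟩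
    change |B (‖p‖⁻¹ • p) (‖p‖⁻¹ • p)| = N
    rw [hBsmul, hBsymm, hBsmul, abs_mul, abs_mul, hpp, abs_of_pos (inv_pos.2 hpn)]
    field_simp

/-- Banach's theorem: a symmetric multilinear form on a finite-dimensional real inner product
space is bounded by the values which it takes on the diagonal. -/
theorem MultilinearMap.abs_le_of_abs_diag_le {ι V : Type*} [Fintype ι] [DecidableEq ι] [Nonempty ι]
    [NormedAddCommGroup V] [InnerProductSpace ℝ V] [FiniteDimensional ℝ V]
    (E : MultilinearMap ℝ (fun _ : ι => V) ℝ) (hEc : Continuous E)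
    (hE : ∀ (σ : Equiv.Perm ι) (v : ι → V), E (fun i => v (σ i)) = E v) {M : ℝ}
    (hM : ∀ x : V, |E (fun _ => x)| ≤ M * ‖x‖ ^ Fintype.card ι) (v : ι → V) :
    |E v| ≤ M * ∏ i, ‖v i‖ := by
  by_cases hv0 : ∃ i, v i = 0
  · obtain ⟨i, hi⟩ := hv0
    rw [E.map_coord_zero i hi, Finset.prod_eq_zero (Finset.mem_univ i) (by simp [hi])]
    simp
  push Not at hv0
  have hcont : Continuous fun v : ι → V => |E v| := hEc.abs
  set K : Set (ι → V) := Set.pi Set.univ fun _ => Metric.sphere (0 : V) 1 with hK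
  have hKc : IsCompact K := isCompact_univ_pi fun _ => isCompact_sphere _ _
  have hnorm : ∀ v : ι → V, (∀ i, v i ≠ 0) → (fun i => ‖v i‖⁻¹ • v i) ∈ K := by
    intro v hv i _
    simp [norm_smul, hv i]
  obtain ⟨u₀, hu₀, hmax₀⟩ := hKc.exists_isMaxOn ⟨_, hnorm v hv0⟩ hcont.continuousOn
  set N := |E u₀| with hN
  have hscale : ∀ v : ι → V, |E v| ≤ N * ∏ i, ‖v i‖ := by
    intro v
    by_cases hv : ∃ i, v i = 0
    · obtain ⟨i, hi⟩ := hv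
      rw [E.map_coord_zero i hi, Finset.prod_eq_zero (Finset.mem_univ i) (by simp [hi])]
      simp
    push Not at hv
    have h1 : v = fun i => ‖v i‖ • (‖v i‖⁻¹ • v i) := by
      funext i
      rw [smul_smul, mul_inv_cancel₀ (norm_ne_zero_iff.2 (hv i)), one_smul]
    have h2 : |E (fun i => ‖v i‖⁻¹ • v i)| ≤ N := hmax₀ (hnorm v hv)
    calc |E v| = |E fun i => ‖v i‖ • (‖v i‖⁻¹ • v i)| := by rw [← h1]
      _ = (∏ i, ‖v i‖) * |E (fun i => ‖v i‖⁻¹ • v i)| := by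
        rw [E.map_smul_univ (fun i => ‖v i‖) fun i => ‖v i‖⁻¹ • v i, smul_eq_mul, abs_mul,
          abs_of_nonneg (Finset.prod_nonneg fun i _ => norm_nonneg _)]
      _ ≤ _ := by
        rw [mul_comm]
        exact mul_le_mul_of_nonneg_right h2 (Finset.prod_nonneg fun i _ => norm_nonneg _)
  have hK'c : IsCompact (K ∩ {v | |E v| = N}) :=
    hKc.inter_right (isClosed_eq hcont continuous_const)
  have hscont : Continuous fun v : ι → V => ‖∑ i, v i‖ ^ 2 := by fun_prop
  -- Among the maximisers, take one whose sum is longest. If two entries differ, replacing both by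
  -- `w` or both by `-w` keeps the value and lengthens the sum for one choice of sign, since the
  -- replaced pair has a sum of norm less than 2.
  obtain ⟨u, ⟨huK, huN⟩, hmax⟩ := hK'c.exists_isMaxOn ⟨u₀, hu₀, rfl⟩ hscont.continuousOn
  have hu1 : ∀ i, ‖u i‖ = 1 := fun i => by simpa using huK i (Set.mem_univ i)
  have hall : ∀ i j, u i = u j := by
    intro i j
    by_contra hne
    have hij : i ≠ j := fun h => hne (h ▸ rfl)
    obtain ⟨w, hw1, hwp, hwN⟩ :=
      MultilinearMap.exists_unit_abs_eq_of_isMaxOn E hE hscale hu1 huN hij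
    set p := u i + u j with hp
    set q := ∑ k, u k - p with hq
    have hval : ∀ ε : ℝ, ε = 1 ∨ ε = -1 → ‖q + (2 * ε) • w‖ ^ 2 ≤ ‖q + p‖ ^ 2 := by
      intro ε hε
      have hεa : |ε| = 1 := by rcases hε with rfl | rfl <;> simp
      set u' := Function.update (Function.update u i (ε • w)) j (ε • w) with hu'
      have h1 : u' ∈ K := by
        intro k _
        simp only [hu', Function.update_apply]
        split_ifs <;> simp [norm_smul, hεa, hw1, hu1]
      have h2 : |E u'| = N := by
        rw [hu', E.map_update_smul, Function.update_comm hij, E.map_update_smul,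
          Function.update_comm hij.symm, smul_eq_mul, smul_eq_mul, abs_mul, abs_mul, hεa, hwN]
        ring
      have h3 : ∑ k, u' k = q + (2 * ε) • w := by
        rw [hu', Finset.sum_update_of_mem (Finset.mem_univ j),
          Finset.sdiff_singleton_eq_erase, Finset.sum_update_of_mem
            (Finset.mem_erase.2 ⟨hij, Finset.mem_univ i⟩), Finset.sdiff_singleton_eq_erase]
        have h4 : ∑ k, u k = u j + (u i + ∑ k ∈ (Finset.univ.erase j).erase i, u k) := by
          rw [Finset.add_sum_erase _ _ (Finset.mem_erase.2 ⟨hij, Finset.mem_univ i⟩),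
            Finset.add_sum_erase _ _ (Finset.mem_univ j)]
        rw [hq, h4, hp]
        module
      have h5 := hmax (a := u') ⟨h1, h2⟩
      simp only [Set.mem_ofPred_eq] at h5
      rw [h3] at h5
      simpa [hq] using h5
    have hpn : ‖p‖ < 2 := by
      have h1 := parallelogram_law_with_norm ℝ (u i) (u j)
      rw [hu1, hu1] at h1
      have h2 : 0 < ‖u i - u j‖ := norm_pos_iff.2 (sub_ne_zero.2 hne)
      rw [hp]; nlinarith [norm_nonneg (u i + u j)]
    have hexp : ∀ t : ℝ, ‖q + t • w‖ ^ 2 = ‖q‖ ^ 2 + 2 * t * inner ℝ q w + t ^ 2 := by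
      intro t
      rw [norm_add_sq_real, inner_smul_right, norm_smul, hw1, mul_one, Real.norm_eq_abs, sq_abs]
      ring
    have e1 := hval 1 (Or.inl rfl)
    have e2 := hval (-1) (Or.inr rfl)
    rw [← hwp, hexp, hexp] at e1 e2
    have hpp := norm_nonneg p
    rcases le_total 0 (inner ℝ q w : ℝ) with h | h <;> nlinarith
  obtain ⟨i₀⟩ := ‹Nonempty ι›
  have huc : u = fun _ => u i₀ := funext fun i => hall i i₀
  have hNM : N ≤ M := by
    have := hM (u i₀)
    rw [← huc, huN, hu1, one_pow, mul_one] at this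
    exact this
  exact (hscale v).trans
    (mul_le_mul_of_nonneg_right hNM (Finset.prod_nonneg fun i _ => norm_nonneg _))

/-! ### Polarised elementary symmetric polynomials and the expansion of the permanent. -/

/-- Permutations act transitively on subsets of a given size, so the inner sum over `τ` is the same
for every such subset; double counting then gives the identity. -/
theorem choose_mul_sum_perm_map {ι : Type*} [Fintype ι] [DecidableEq ι] (F : Finset ι → ℝ)
    (T : Finset ι) :
    ((Fintype.card ι).choose T.card : ℝ) * ∑ τ : Equiv.Perm ι, F (T.map τ.toEmbedding) =
      (Fintype.card ι)! * ∑ S ∈ Finset.powersetCard T.card Finset.univ, F S := by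
  have h1 : ∀ S ∈ Finset.powersetCard T.card (Finset.univ : Finset ι),
      ∑ τ : Equiv.Perm ι, F (S.map τ.toEmbedding) = ∑ τ : Equiv.Perm ι, F (T.map τ.toEmbedding) := by
    intro S hS
    have hc : T.card = S.card := ((Finset.mem_powersetCard.1 hS).2).symm
    set ρ : Equiv.Perm ι := (Finset.equivOfCardEq hc).extendSubtype with hρ
    have hT : T.map ρ.toEmbedding = S := by
      refine Finset.eq_of_subset_of_card_le ?_ (by simp [hc])
      intro y hy
      obtain ⟨x, hx, rfl⟩ := Finset.mem_map.1 hy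
      exact Equiv.extendSubtype_mem (Finset.equivOfCardEq hc) x hx
    rw [← hT]
    refine Fintype.sum_equiv (Equiv.mulRight ρ) _ _ fun τ => ?_
    rw [Finset.map_map]
    rfl
  have h2 : ∑ S ∈ Finset.powersetCard T.card (Finset.univ : Finset ι),
      ∑ τ : Equiv.Perm ι, F (S.map τ.toEmbedding) =
      ((Fintype.card ι).choose T.card : ℝ) * ∑ τ : Equiv.Perm ι, F (T.map τ.toEmbedding) := by
    rw [Finset.sum_congr rfl h1, Finset.sum_const, Finset.card_powersetCard, Finset.card_univ,
      nsmul_eq_mul]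
  rw [← h2, Finset.sum_comm]
  have h3 : ∀ τ : Equiv.Perm ι, ∑ S ∈ Finset.powersetCard T.card (Finset.univ : Finset ι),
      F (S.map τ.toEmbedding) = ∑ S ∈ Finset.powersetCard T.card Finset.univ, F S := by
    intro τ
    refine Finset.sum_bij' (fun S _ => S.map τ.toEmbedding) (fun S _ => S.map τ.symm.toEmbedding)
      ?_ ?_ ?_ ?_ ?_
    · intro S hS; simpa [Finset.mem_powersetCard] using hS
    · intro S hS; simpa [Finset.mem_powersetCard] using hS
    · intro S _; ext x; simp
    · intro S _; ext x; simp
    · intro S _; rfl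
  rw [Finset.sum_congr rfl fun τ _ => h3 τ, Finset.sum_const, Finset.card_univ,
    Fintype.card_perm, nsmul_eq_mul]

/-- The subspace of vectors whose coordinates sum to zero. -/
noncomputable def sumZero (ι : Type*) [Fintype ι] : Submodule ℝ (EuclideanSpace ℝ ι) :=
  LinearMap.ker (∑ i, (EuclideanSpace.proj i : EuclideanSpace ℝ ι →L[ℝ] ℝ).toLinearMap)

theorem mem_sumZero {ι : Type*} [Fintype ι] {v : EuclideanSpace ℝ ι} :
    v ∈ sumZero ι ↔ ∑ i, v i = 0 := by
  simp [sumZero, LinearMap.mem_ker]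

/-- The polarisation, up to a factor, of an elementary symmetric polynomial. -/
noncomputable def esymmForm {ι : Type*} [Fintype ι] [DecidableEq ι] (T : Finset ι) :
    MultilinearMap ℝ (fun _ : T => sumZero ι) ℝ :=
  ∑ τ : Equiv.Perm ι, (MultilinearMap.mkPiAlgebra ℝ T ℝ).compLinearMap fun i =>
    (EuclideanSpace.proj (τ i) : EuclideanSpace ℝ ι →L[ℝ] ℝ).toLinearMap ∘ₗ (sumZero ι).subtype

theorem esymmForm_apply {ι : Type*} [Fintype ι] [DecidableEq ι] (T : Finset ι)
    (v : T → sumZero ι) :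
    esymmForm T v = ∑ τ : Equiv.Perm ι, ∏ i : T, (v i : EuclideanSpace ℝ ι) (τ i) := by
  simp [esymmForm]

theorem esymmForm_comp_perm {ι : Type*} [Fintype ι] [DecidableEq ι] (T : Finset ι)
    (σ : Equiv.Perm T) (v : T → sumZero ι) :
    esymmForm T (fun i => v (σ i)) = esymmForm T v := by
  rw [esymmForm_apply, esymmForm_apply]
  refine Fintype.sum_equiv (Equiv.mulRight (Equiv.Perm.ofSubtype σ)⁻¹) _ _ fun τ => ?_
  refine Fintype.prod_equiv σ _ _ fun i => ?_
  rw [Equiv.coe_mulRight, Equiv.Perm.mul_apply, ← Equiv.Perm.ofSubtype_apply_coe σ i,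
    ← Equiv.Perm.mul_apply _⁻¹, inv_mul_cancel, Equiv.Perm.one_apply]

/-- Banach's theorem applied to `esymmForm T`. The form lives on the centred subspace because the
diagonal bound `hM` is available only there. -/
theorem sum_prod_perm_sq_le {ι : Type*} [Fintype ι] [DecidableEq ι] {T : Finset ι} (hT : T.Nonempty)
    {K : ℝ} (hK : 0 ≤ K) (hM : ∀ x : ι → ℝ, ∑ i, x i = 0 →
      (∑ S ∈ Finset.powersetCard T.card Finset.univ, ∏ i ∈ S, x i) ^ 2 ≤
        K * (∑ i, x i ^ 2) ^ T.card) (v : T → ι → ℝ) (hv : ∀ k, ∑ i, v k i = 0) :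
    (((Fintype.card ι).choose T.card : ℝ) * ∑ τ : Equiv.Perm ι, ∏ i : T, v i (τ i)) ^ 2 ≤
      (Fintype.card ι)! ^ 2 * K * ∏ k, ∑ i, v k i ^ 2 := by
  set C : ℝ := ((Fintype.card ι).choose T.card : ℝ) with hC
  have hCpos : 0 < C := by
    rw [hC]; exact_mod_cast Nat.choose_pos (Finset.card_le_univ T)
  have : Nonempty T := hT.to_subtype
  set w : T → sumZero ι := fun k => ⟨WithLp.toLp 2 (v k), mem_sumZero.2 (hv k)⟩ with hw
  have hwE : esymmForm T w = ∑ τ : Equiv.Perm ι, ∏ i : T, v i (τ i) := by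
    rw [esymmForm_apply]
  have hwn : ∀ k, ‖w k‖ ^ 2 = ∑ i, v k i ^ 2 := by
    intro k
    rw [← Submodule.norm_coe, EuclideanSpace.real_norm_sq_eq]
  have hcont : Continuous (esymmForm T) := by
    have : (esymmForm T : (T → sumZero ι) → ℝ) =
        fun v => ∑ τ : Equiv.Perm ι, ∏ i : T, (v i : EuclideanSpace ℝ ι) (τ i) :=
      funext fun v => esymmForm_apply T v
    rw [this]
    fun_prop
  have hdiag : ∀ x : sumZero ι, |esymmForm T fun _ => x| ≤
      ((Fintype.card ι)! * √K / C) * ‖x‖ ^ Fintype.card T := by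
    intro x
    have h1 := choose_mul_sum_perm_map (fun S => ∏ i ∈ S, (x : EuclideanSpace ℝ ι) i) T
    have h2 : ∀ τ : Equiv.Perm ι, ∏ i ∈ T.map τ.toEmbedding, (x : EuclideanSpace ℝ ι) i =
        ∏ i : T, (x : EuclideanSpace ℝ ι) (τ i) := by
      intro τ
      rw [Finset.prod_map, ← Finset.prod_coe_sort]
      rfl
    simp only [h2] at h1
    rw [← esymmForm_apply T fun _ => x] at h1
    have h3 := hM (fun i => (x : EuclideanSpace ℝ ι) i) (mem_sumZero.1 x.2)
    rw [← EuclideanSpace.real_norm_sq_eq, Submodule.norm_coe] at h3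
    have h4 := Real.abs_le_sqrt h3
    rw [Real.sqrt_mul hK, ← pow_mul, mul_comm 2, pow_mul, Real.sqrt_sq (by positivity)] at h4
    have h5 : C * |esymmForm T fun _ => x| ≤
        (Fintype.card ι)! * (√K * ‖x‖ ^ T.card) := by
      rw [← abs_of_pos hCpos, ← abs_mul, h1, abs_mul, Nat.abs_cast]
      gcongr
    rw [Fintype.card_coe, div_mul_eq_mul_div, le_div_iff₀ hCpos]
    linarith
  have hmain := MultilinearMap.abs_le_of_abs_diag_le (esymmForm T) hcont
    (esymmForm_comp_perm T) hdiag w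
  rw [hwE] at hmain
  have h6 := pow_le_pow_left₀ (abs_nonneg _) hmain 2
  rw [sq_abs, mul_pow, ← Finset.prod_pow, Finset.prod_congr rfl fun k _ => hwn k, div_pow,
    mul_pow, Real.sq_sqrt hK, div_mul_eq_mul_div, le_div_iff₀ (by positivity)] at h6
  linarith

/-- Symmetrising the subsets by a second permutation makes the left side a sum of squares, one for
each assignment `T → κ`. Each square is bounded by `sum_prod_perm_sq_le`, and the products of
squared norms sum to a power of the trace. -/
theorem sum_powersetCard_sum_perm_prod_le {ι κ : Type*} [Fintype ι] [DecidableEq ι] [Fintype κ]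
    (b : κ → ι → ℝ) (hb : ∀ k, ∑ i, b k i = 0) {l : ℕ} (hl : 0 < l) (hln : l ≤ Fintype.card ι)
    {K : ℝ} (hK : 0 ≤ K) (hM : ∀ x : ι → ℝ, ∑ i, x i = 0 →
      (∑ S ∈ Finset.powersetCard l Finset.univ, ∏ i ∈ S, x i) ^ 2 ≤
        K * (∑ i, x i ^ 2) ^ l) :
    ((Fintype.card ι).choose l : ℝ) * ∑ S ∈ Finset.powersetCard l (Finset.univ : Finset ι),
      ∑ τ : Equiv.Perm ι, ∏ i ∈ S, ∑ k, b k i * b k (τ i) ≤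
      (Fintype.card ι)! * K * (∑ k, ∑ i, b k i ^ 2) ^ l := by
  classical
  obtain ⟨T, -, rfl⟩ := Finset.exists_subset_card_eq (s := (Finset.univ : Finset ι))
    (by simpa using hln)
  have hT : T.Nonempty := Finset.card_pos.1 hl
  set C : ℝ := ((Fintype.card ι).choose T.card : ℝ) with hC
  have hCpos : 0 < C := by
    rw [hC]; exact_mod_cast Nat.choose_pos (Finset.card_le_univ T)
  have hf : (0 : ℝ) < (Fintype.card ι)! := by positivity
  have h1 := choose_mul_sum_perm_map
    (fun S => ∑ τ : Equiv.Perm ι, ∏ i ∈ S, ∑ k, b k i * b k (τ i)) T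
  have h2 : ∑ ρ : Equiv.Perm ι, ∑ τ : Equiv.Perm ι, ∏ i ∈ T.map ρ.toEmbedding,
      ∑ k, b k i * b k (τ i) =
      ∑ k : T → κ, (∑ τ : Equiv.Perm ι, ∏ i : T, b (k i) (τ i)) ^ 2 := by
    -- Replacing `τ` by `τ * ρ⁻¹` decouples the two permutations, so that the sums over `ρ` and `τ`
    -- are equal factors.
    have e1 : ∀ ρ : Equiv.Perm ι, ∑ τ : Equiv.Perm ι, ∏ i ∈ T.map ρ.toEmbedding,
        ∑ k, b k i * b k (τ i) =
        ∑ τ : Equiv.Perm ι, ∑ k : T → κ, (∏ i : T, b (k i) (ρ i)) * ∏ i : T, b (k i) (τ i) := by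
      intro ρ
      refine Fintype.sum_equiv (Equiv.mulRight ρ) _ _ fun τ => ?_
      rw [Finset.prod_map, ← Finset.prod_coe_sort]
      simp only [Equiv.coe_toEmbedding, Equiv.coe_mulRight, Equiv.Perm.mul_apply]
      rw [Finset.prod_univ_sum, Fintype.piFinset_univ]
      exact Finset.sum_congr rfl fun k _ => Finset.prod_mul_distrib
    rw [Finset.sum_congr rfl fun ρ _ => e1 ρ]
    rw [Finset.sum_congr rfl fun ρ _ => Finset.sum_comm, Finset.sum_comm]
    refine Finset.sum_congr rfl fun k _ => ?_
    rw [pow_two, Finset.sum_mul_sum]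
  rw [h2] at h1
  have h3 : C ^ 2 * ∑ k : T → κ, (∑ τ : Equiv.Perm ι, ∏ i : T, b (k i) (τ i)) ^ 2 ≤
      (Fintype.card ι)! ^ 2 * K * (∑ k, ∑ i, b k i ^ 2) ^ T.card := by
    rw [Finset.mul_sum]
    calc _ ≤ ∑ k : T → κ, (Fintype.card ι)! ^ 2 * K * ∏ j, ∑ i, b (k j) i ^ 2 := by
          refine Finset.sum_le_sum fun k _ => ?_
          rw [← mul_pow]
          exact sum_prod_perm_sq_le hT hK hM (fun j => b (k j)) fun j => hb (k j)
      _ = _ := by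
          rw [← Finset.mul_sum]
          congr 1
          rw [← Fintype.card_coe T, ← Finset.card_univ, ← Finset.prod_const,
            Finset.prod_univ_sum, Fintype.piFinset_univ]
  rw [← mul_le_mul_iff_right₀ hf]
  calc _ = C * ((Fintype.card ι)! * ∑ S ∈ Finset.powersetCard T.card (Finset.univ : Finset ι),
      ∑ τ : Equiv.Perm ι, ∏ i ∈ S, ∑ k, b k i * b k (τ i)) := by ring
    _ = C ^ 2 * ∑ k : T → κ, (∑ τ : Equiv.Perm ι, ∏ i : T, b (k i) (τ i)) ^ 2 := by
      rw [← h1]; ring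
    _ ≤ _ := h3.trans (le_of_eq (by ring))

theorem sq_esymm_le {ι : Type*} [Fintype ι] [DecidableEq ι] (x : ι → ℝ)
    (h0 : ∑ i, x i = 0) {l : ℕ} (hl : 0 < l) (hln : l ≤ Fintype.card ι) :
    (∑ S ∈ Finset.powersetCard l Finset.univ, ∏ i ∈ S, x i) ^ 2 ≤
      10 * (Fintype.card ι).choose l / Fintype.card ι ^ l * (∑ i, x i ^ 2) ^ l := by
  have hn : (0 : ℝ) < Fintype.card ι := by exact_mod_cast (by omega : 0 < Fintype.card ι)
  set s := ∑ i, x i ^ 2 with hs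
  rcases (Finset.sum_nonneg fun i _ => sq_nonneg (x i) : 0 ≤ s).eq_or_lt with h | h
  · have hx : ∀ i, x i = 0 := fun i => by
      have := (Finset.sum_eq_zero_iff_of_nonneg fun i _ => sq_nonneg (x i)).1 h.symm i
        (Finset.mem_univ i)
      exact pow_eq_zero_iff (two_ne_zero) |>.1 this
    rw [Finset.sum_eq_zero, hs, ← h]
    · simp [hl.ne']
    · intro S hS
      have hS' := (Finset.mem_powersetCard.1 hS).2
      obtain ⟨i, hi⟩ := Finset.card_pos.1 (by omega : 0 < S.card)
      exact Finset.prod_eq_zero hi (hx i)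
  · set t := √(Fintype.card ι / s) with ht
    have ht2 : t ^ 2 = Fintype.card ι / s := Real.sq_sqrt (by positivity)
    have key := sq_esymm_le_of_sum_sq_eq_card (fun i => t * x i)
      (by rw [← Finset.mul_sum, h0, mul_zero])
      (by simp only [mul_pow]; rw [← Finset.mul_sum, ht2]; exact div_mul_cancel₀ _ h.ne')
      hl hln
    have e1 : ∑ S ∈ Finset.powersetCard l Finset.univ, ∏ i ∈ S, t * x i =
        t ^ l * ∑ S ∈ Finset.powersetCard l Finset.univ, ∏ i ∈ S, x i := by
      rw [Finset.mul_sum]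
      refine Finset.sum_congr rfl fun S hS => ?_
      rw [Finset.prod_mul_distrib, Finset.prod_const, (Finset.mem_powersetCard.1 hS).2]
    rw [e1, mul_pow, ← pow_mul, mul_comm l 2, pow_mul, ht2, div_pow, div_mul_eq_mul_div,
      div_le_iff₀ (by positivity)] at key
    rw [div_mul_eq_mul_div, le_div_iff₀ (by positivity)]
    linarith

/-- Expand each factor into its constant and its centred part. With the constant `10 * choose n l /
n ^ l` of `sq_esymm_le`, all dependence on `n` cancels in the term of order `l`. -/
theorem permanent_le_of_sum_eq_zero {ι κ : Type*} [Fintype ι] [DecidableEq ι] [Nonempty ι]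
    [Fintype κ] (b : κ → ι → ℝ) (hb : ∀ k, ∑ i, b k i = 0) :
    (Fintype.card ι : ℝ) ^ Fintype.card ι / (Fintype.card ι)! *
      ∑ τ : Equiv.Perm ι, ∏ i, (1 / (Fintype.card ι : ℝ) + ∑ k, b k i * b k (τ i)) ≤
      1 + 10 * ∑ l ∈ Finset.Icc 2 (Fintype.card ι), (∑ k, ∑ i, b k i ^ 2) ^ l := by
  set n := Fintype.card ι with hn
  have hnpos : 0 < n := Fintype.card_pos
  have hn' : (0 : ℝ) < n := by exact_mod_cast hnpos
  set t := ∑ k, ∑ i, b k i ^ 2 with ht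
  set G : ℕ → ℝ := fun l => ∑ S ∈ Finset.powersetCard l (Finset.univ : Finset ι),
      ∑ τ : Equiv.Perm ι, ∏ i ∈ S, ∑ k, b k i * b k (τ i) with hG
  have hexp : ∑ τ : Equiv.Perm ι, ∏ i, (1 / (n : ℝ) + ∑ k, b k i * b k (τ i)) =
      ∑ l ∈ Finset.range (n + 1), (1 / (n : ℝ)) ^ (n - l) * G l := by
    have e1 : ∀ τ : Equiv.Perm ι, ∏ i, (1 / (n : ℝ) + ∑ k, b k i * b k (τ i)) =
        ∑ S : Finset ι, (1 / (n : ℝ)) ^ (n - S.card) * ∏ i ∈ S, ∑ k, b k i * b k (τ i) := by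
      intro τ
      rw [Finset.prod_congr rfl fun i _ => add_comm (1 / (n : ℝ)) _, Fintype.prod_add]
      refine Finset.sum_congr rfl fun S _ => ?_
      rw [Finset.prod_const, Finset.card_compl, mul_comm]
    rw [Finset.sum_congr rfl fun τ _ => e1 τ, Finset.sum_comm]
    rw [← Finset.powerset_univ, Finset.sum_powerset, Finset.card_univ]
    refine Finset.sum_congr rfl fun l _ => ?_
    rw [hG, Finset.mul_sum]
    refine Finset.sum_congr rfl fun S hS => ?_
    rw [(Finset.mem_powersetCard.1 hS).2, Finset.mul_sum]
  have hG0 : G 0 = n ! := by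
    simp [hG, Fintype.card_perm, hn]
  have hG1 : G 1 ≤ 0 := by
    -- In degree one the elementary symmetric polynomial is `∑ x i = 0`, so `K = 0` is admissible.
    have h := sum_powersetCard_sum_perm_prod_le b hb one_pos hnpos le_rfl (fun x hx => by
      rw [Finset.powersetCard_one, Finset.sum_map]
      simp [hx])
    simp only [mul_zero, zero_mul, Nat.choose_one_right] at h
    exact (mul_nonpos_iff_pos_imp_nonpos.1 h).1 hn'
  have hG2 : ∀ l ∈ Finset.Icc 2 n, (1 / (n : ℝ)) ^ (n - l) * G l ≤ 10 * n ! / n ^ n * t ^ l := by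
    intro l hl
    rw [Finset.mem_Icc] at hl
    have hC : (0 : ℝ) < n.choose l := by exact_mod_cast Nat.choose_pos hl.2
    have h := sum_powersetCard_sum_perm_prod_le b hb (by omega : 0 < l) hl.2
      (by positivity : (0 : ℝ) ≤ 10 * n.choose l / n ^ l)
      (fun x hx => sq_esymm_le x hx (by omega) hl.2)
    have h' : G l ≤ 10 * n ! / n ^ l * t ^ l := by
      rw [← mul_le_mul_iff_right₀ hC]
      exact h.trans (le_of_eq (by field_simp; rfl))
    calc _ ≤ (1 / (n : ℝ)) ^ (n - l) * (10 * n ! / n ^ l * t ^ l) := by gcongr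
      _ = _ := by
        have : (n : ℝ) ^ n = n ^ (n - l) * n ^ l := by rw [← pow_add]; congr 1; omega
        rw [this, div_pow, one_pow]; field_simp
  rw [hexp, Finset.range_eq_Ico, Finset.sum_eq_sum_Ico_succ_bot (by omega),
    Finset.sum_eq_sum_Ico_succ_bot (by omega)]
  have h5 : Finset.Ico (0 + 1 + 1) (n + 1) = Finset.Icc 2 n := by
    ext; simp only [Finset.mem_Ico, Finset.mem_Icc]; omega
  rw [h5]
  have h6 : (1 / (n : ℝ)) ^ (n - (0 + 1)) * G (0 + 1) ≤ 0 :=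
    mul_nonpos_of_nonneg_of_nonpos (by positivity) hG1
  have h7 := Finset.sum_le_sum hG2
  rw [← Finset.mul_sum] at h7
  calc _ ≤ (n : ℝ) ^ n / n ! * ((1 / (n : ℝ)) ^ (n - 0) * n ! +
      (0 + 10 * n ! / n ^ n * ∑ l ∈ Finset.Icc 2 n, t ^ l)) := by
        rw [hG0]
        gcongr
    _ = _ := by
        rw [Nat.sub_zero, div_pow, one_pow]; field_simp; ring

/-! ### Wick's formula and permanents of Gram matrices. -/

theorem integral_prod_pow_mul_prod_pow_conj {κ Ω : Type*} [Fintype κ] [MeasurableSpace Ω]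
    {γ : Measure Ω} [SigmaFinite γ] {Z : Ω → ℂ}
    (hZ : ∀ a b : ℕ, ∫ ω, Z ω ^ a * (starRingEnd ℂ) (Z ω) ^ b ∂γ = if a = b then (a ! : ℂ) else 0)
    (p q : κ → ℕ) :
    ∫ ω : κ → Ω, (∏ j, Z (ω j) ^ p j) * ∏ j, (starRingEnd ℂ) (Z (ω j)) ^ q j
      ∂(Measure.pi fun _ => γ) = ∏ j, if p j = q j then ((p j)! : ℂ) else 0 := by
  simp only [← Finset.prod_mul_distrib]
  rw [integral_fintype_prod_eq_prod (f := fun j ω => Z ω ^ p j * (starRingEnd ℂ) (Z ω) ^ q j)]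
  exact Finset.prod_congr rfl fun j _ => hZ _ _

/-- The combinatorial side of Wick's formula. If the fibres of `k` and `l` have equal sizes, the
permutations carrying one to the other form a coset of the stabiliser of `l`, whose order is the
product of the factorials; otherwise there are none. -/
theorem card_perm_comp_eq {ι κ : Type*} [Fintype ι] [DecidableEq ι] [Fintype κ] [DecidableEq κ]
    (k l : ι → κ) :
    ((Finset.univ.filter fun σ : Equiv.Perm ι => l = k ∘ σ).card : ℂ) =
      ∏ j, if Fintype.card {i // k i = j} = Fintype.card {i // l i = j} then
        ((Fintype.card {i // k i = j})! : ℂ) else 0 := by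
  by_cases h : ∀ j, Fintype.card {i // k i = j} = Fintype.card {i // l i = j}
  · set σ₀ : Equiv.Perm ι := Equiv.ofFiberEquiv (f := l) (g := k)
      fun j => Fintype.equivOfCardEq (h j).symm with hσ₀
    have hσ : ∀ i, k (σ₀ i) = l i := fun i => Equiv.ofFiberEquiv_map _ i
    simp only [h, if_true]
    rw [← Nat.cast_prod, ← DomMulAct.stabilizer_card l, Fintype.card_subtype]
    congr 1
    refine Finset.card_equiv (Equiv.mulLeft σ₀⁻¹) fun σ => ?_
    simp only [Finset.mem_filter, Finset.mem_univ, true_and, Equiv.coe_mulLeft]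
    have : l ∘ (σ₀⁻¹ * σ : Equiv.Perm ι) = k ∘ σ := by
      funext i
      simp only [Function.comp]
      rw [← hσ, ← Equiv.Perm.mul_apply, mul_inv_cancel_left]
    rw [this]
    exact eq_comm
  · push Not at h
    obtain ⟨j, hj⟩ := h
    rw [Finset.prod_eq_zero (Finset.mem_univ j) (if_neg hj), Nat.cast_eq_zero, Finset.card_eq_zero,
      Finset.filter_eq_empty_iff]
    rintro σ - rfl
    apply hj
    exact (Fintype.card_congr (σ.subtypeEquiv fun i => Iff.rfl)).symm

theorem integral_prod_comp_mul_prod_conj_comp {ι κ Ω : Type*} [Fintype ι] [DecidableEq ι]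
    [Fintype κ] [DecidableEq κ] [MeasurableSpace Ω] {γ : Measure Ω} [SigmaFinite γ] {Z : Ω → ℂ}
    (hZ : ∀ a b : ℕ, ∫ ω, Z ω ^ a * (starRingEnd ℂ) (Z ω) ^ b ∂γ = if a = b then (a ! : ℂ) else 0)
    (k l : ι → κ) :
    ∫ ω : κ → Ω, (∏ i, Z (ω (k i))) * ∏ i, (starRingEnd ℂ) (Z (ω (l i)))
      ∂(Measure.pi fun _ => γ) =
      ∑ σ : Equiv.Perm ι, if l = k ∘ σ then (1 : ℂ) else 0 := by
  have h : ∀ (f : κ → ℂ) (k : ι → κ), ∏ i, f (k i) = ∏ j, f j ^ Fintype.card {i // k i = j} := by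
    intro f k
    rw [← Finset.prod_fiberwise Finset.univ k]
    refine Finset.prod_congr rfl fun j _ => ?_
    rw [Fintype.card_subtype, ← Finset.prod_const]
    exact Finset.prod_congr rfl fun i hi => by rw [(Finset.mem_filter.1 hi).2]
  simp only [fun ω : κ → Ω => h (fun j => Z (ω j)) k,
    fun ω : κ → Ω => h (fun j => (starRingEnd ℂ) (Z (ω j))) l]
  rw [integral_prod_pow_mul_prod_pow_conj hZ, ← card_perm_comp_eq, Finset.sum_boole]

theorem integrable_prod_comp_mul_prod_conj_comp {ι κ Ω : Type*} [Fintype ι]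
    [Fintype κ] [DecidableEq κ] [MeasurableSpace Ω] {γ : Measure Ω} [SigmaFinite γ] {Z : Ω → ℂ}
    (hZ : ∀ a b : ℕ, Integrable (fun ω => Z ω ^ a * (starRingEnd ℂ) (Z ω) ^ b) γ)
    (k l : ι → κ) :
    Integrable (fun ω : κ → Ω => (∏ i, Z (ω (k i))) * ∏ i, (starRingEnd ℂ) (Z (ω (l i))))
      (Measure.pi fun _ => γ) := by
  have h : ∀ (f : κ → ℂ) (k : ι → κ), ∏ i, f (k i) = ∏ j, f j ^ Fintype.card {i // k i = j} := by
    intro f k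
    rw [← Finset.prod_fiberwise Finset.univ k]
    refine Finset.prod_congr rfl fun j _ => ?_
    rw [Fintype.card_subtype, ← Finset.prod_const]
    exact Finset.prod_congr rfl fun i hi => by rw [(Finset.mem_filter.1 hi).2]
  simp only [fun ω : κ → Ω => h (fun j => Z (ω j)) k,
    fun ω : κ → Ω => h (fun j => (starRingEnd ℂ) (Z (ω j))) l, ← Finset.prod_mul_distrib]
  exact Integrable.fintype_prod (f := fun j ω => Z ω ^ _ * (starRingEnd ℂ) (Z ω) ^ _)
    fun j => hZ _ _

/-- Wick's formula for the permanent of a Gram matrix. -/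
theorem integral_prod_norm_sq_eq_permanent {ι κ Ω : Type*} [Fintype ι] [DecidableEq ι]
    [Fintype κ] [DecidableEq κ] [MeasurableSpace Ω] {γ : Measure Ω} [SigmaFinite γ] {Z : Ω → ℂ}
    (hZi : ∀ a b : ℕ, Integrable (fun ω => Z ω ^ a * (starRingEnd ℂ) (Z ω) ^ b) γ)
    (hZ : ∀ a b : ℕ, ∫ ω, Z ω ^ a * (starRingEnd ℂ) (Z ω) ^ b ∂γ = if a = b then (a ! : ℂ) else 0)
    (B : κ → ι → ℝ) :
    Integrable (fun ω : κ → Ω => ∏ i, ‖∑ j, (B j i : ℂ) * Z (ω j)‖ ^ 2) (Measure.pi fun _ => γ) ∧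
    ∫ ω : κ → Ω, ∏ i, ‖∑ j, (B j i : ℂ) * Z (ω j)‖ ^ 2 ∂(Measure.pi fun _ => γ) =
      ∑ τ : Equiv.Perm ι, ∏ i, ∑ j, B j i * B j (τ i) := by
  have hexp : ∀ ω : κ → Ω, ((∏ i, ‖∑ j, (B j i : ℂ) * Z (ω j)‖ ^ 2 : ℝ) : ℂ) =
      ∑ k : ι → κ, ∑ l : ι → κ, ((∏ i, B (k i) i * B (l i) i : ℝ) : ℂ) *
        ((∏ i, Z (ω (k i))) * ∏ i, (starRingEnd ℂ) (Z (ω (l i)))) := by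
    intro ω
    push_cast
    simp only [← Complex.mul_conj', map_sum, map_mul, Complex.conj_ofReal]
    rw [Finset.prod_mul_distrib, Finset.prod_univ_sum, Finset.prod_univ_sum,
      Fintype.piFinset_univ, Finset.sum_mul_sum]
    refine Finset.sum_congr rfl fun k _ => Finset.sum_congr rfl fun l _ => ?_
    simp only [Finset.prod_mul_distrib]
    ring
  have hint : ∀ k l : ι → κ, Integrable (fun ω : κ → Ω =>
      ((∏ i, B (k i) i * B (l i) i : ℝ) : ℂ) *
        ((∏ i, Z (ω (k i))) * ∏ i, (starRingEnd ℂ) (Z (ω (l i))))) (Measure.pi fun _ => γ) :=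
    fun k l => (integrable_prod_comp_mul_prod_conj_comp hZi k l).const_mul _
  have hintC : Integrable (fun ω : κ → Ω => ((∏ i, ‖∑ j, (B j i : ℂ) * Z (ω j)‖ ^ 2 : ℝ) : ℂ))
      (Measure.pi fun _ => γ) := by
    simp only [hexp]
    exact integrable_finsetSum _ fun k _ => integrable_finsetSum _ fun l _ => hint k l
  refine ⟨hintC.re.congr (ae_of_all _ fun ω => Complex.ofReal_re _), ?_⟩
  rw [← Complex.ofReal_inj, ← integral_complex_ofReal]
  simp only [hexp]
  rw [integral_finsetSum _ fun k _ => integrable_finsetSum _ fun l _ => hint k l]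
  -- For fixed `k`, only the assignments `l = k ∘ σ` survive; passing to `σ⁻¹` moves the permutation
  -- to the row index.
  have h1 : ∀ k : ι → κ, ∫ ω : κ → Ω, ∑ l : ι → κ, ((∏ i, B (k i) i * B (l i) i : ℝ) : ℂ) *
      ((∏ i, Z (ω (k i))) * ∏ i, (starRingEnd ℂ) (Z (ω (l i)))) ∂(Measure.pi fun _ => γ) =
      ∑ σ : Equiv.Perm ι, ((∏ i, B (k i) i * B (k i) (σ i) : ℝ) : ℂ) := by
    intro k
    rw [integral_finsetSum _ fun l _ => hint k l]
    simp only [integral_const_mul, integral_prod_comp_mul_prod_conj_comp hZ, Finset.mul_sum]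
    rw [Finset.sum_comm]
    refine Fintype.sum_equiv (Equiv.inv _) _ _ fun σ => ?_
    simp only [mul_ite, mul_one, mul_zero, Finset.sum_ite_eq', Finset.mem_univ, if_true,
      Finset.prod_mul_distrib, Complex.ofReal_mul]
    congr 2
    refine Fintype.prod_equiv σ _ _ fun i => ?_
    simp
  rw [Finset.sum_congr rfl fun k _ => h1 k, Finset.sum_comm, Complex.ofReal_sum]
  refine Finset.sum_congr rfl fun σ _ => ?_
  rw [← Complex.ofReal_sum, Finset.prod_univ_sum, Fintype.piFinset_univ]

/-- The moments of `‖Z‖ ^ 2` are the factorials `a!`, which cancel the denominators of the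
multinomial coefficients and leave `n!` times the complete homogeneous polynomial in `c`. -/
theorem integral_sum_mul_norm_sq_pow {κ Ω : Type*} [Fintype κ] [DecidableEq κ]
    [MeasurableSpace Ω] {γ : Measure Ω} [SigmaFinite γ] {Z : Ω → ℂ}
    (hZi : ∀ a b : ℕ, Integrable (fun ω => Z ω ^ a * (starRingEnd ℂ) (Z ω) ^ b) γ)
    (hZ : ∀ a b : ℕ, ∫ ω, Z ω ^ a * (starRingEnd ℂ) (Z ω) ^ b ∂γ = if a = b then (a ! : ℂ) else 0)
    (c : κ → ℝ) (n : ℕ) :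
    Integrable (fun ω : κ → Ω => (∑ j, c j * ‖Z (ω j)‖ ^ 2) ^ n) (Measure.pi fun _ => γ) ∧
    ∫ ω : κ → Ω, (∑ j, c j * ‖Z (ω j)‖ ^ 2) ^ n ∂(Measure.pi fun _ => γ) =
      n ! * ∑ m ∈ Finset.piAntidiag Finset.univ n, ∏ j, c j ^ m j := by
  have hmi : ∀ a : ℕ, Integrable (fun ω => (‖Z ω‖ ^ 2) ^ a) γ := by
    intro a
    have h := (hZi a a).re
    refine h.congr (ae_of_all _ fun ω => ?_)
    simp only [← mul_pow, Complex.mul_conj']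
    norm_cast
  have hm : ∀ a : ℕ, ∫ ω, (‖Z ω‖ ^ 2) ^ a ∂γ = a ! := by
    intro a
    have h := hZ a a
    simp only [← mul_pow, Complex.mul_conj', if_true] at h
    rw [← Complex.ofReal_inj, ← integral_complex_ofReal]
    push_cast
    exact h
  have hexp : ∀ ω : κ → Ω, (∑ j, c j * ‖Z (ω j)‖ ^ 2) ^ n =
      ∑ m ∈ Finset.piAntidiag Finset.univ n, (Nat.multinomial Finset.univ m * ∏ j, c j ^ m j) *
        ∏ j, (‖Z (ω j)‖ ^ 2) ^ m j := by
    intro ω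
    rw [Finset.sum_pow_eq_sum_piAntidiag]
    refine Finset.sum_congr rfl fun m _ => ?_
    simp only [mul_pow, Finset.prod_mul_distrib]
    ring
  have hint : ∀ m : κ → ℕ, Integrable (fun ω : κ → Ω => ∏ j, (‖Z (ω j)‖ ^ 2) ^ m j)
      (Measure.pi fun _ => γ) := fun m =>
    Integrable.fintype_prod (f := fun j ω => (‖Z ω‖ ^ 2) ^ m j) fun j => hmi _
  simp only [hexp]
  refine ⟨integrable_finsetSum _ fun m _ => (hint m).const_mul _, ?_⟩
  rw [integral_finsetSum _ fun m _ => (hint m).const_mul _, Finset.mul_sum]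
  refine Finset.sum_congr rfl fun m hmem => ?_
  rw [integral_const_mul, integral_fintype_prod_eq_prod (f := fun j ω => (‖Z ω‖ ^ 2) ^ m j)]
  simp only [hm]
  have hs : ∑ j, m j = n := (Finset.mem_piAntidiag.1 hmem).1
  have := Nat.multinomial_spec Finset.univ m
  rw [hs] at this
  rw [← this]
  push_cast
  ring

/-- A complex-valued function `Z` whose mixed moments are those of a standard complex Gaussian. -/
theorem exists_complex_gaussian_moments : ∃ (γ : Measure (ℝ × ℝ)) (Z : ℝ × ℝ → ℂ),
    SigmaFinite γ ∧
    (∀ a b : ℕ, Integrable (fun ω => Z ω ^ a * (starRingEnd ℂ) (Z ω) ^ b) γ) ∧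
    ∀ a b : ℕ, ∫ ω, Z ω ^ a * (starRingEnd ℂ) (Z ω) ^ b ∂γ = if a = b then (a ! : ℂ) else 0 := by
  -- Polar coordinates: the squared modulus is exponential with parameter 1, and the angle is
  -- independent and uniform. The angle kills the moments with `a ≠ b`, and the Gamma integral gives
  -- `a!` for the rest.
  set ν₁ : Measure ℝ := (volume.restrict (Set.Ioi 0)).withDensity
    fun x => ENNReal.ofReal (Real.exp (-x)) with hν₁
  set ν₂ : Measure ℝ := ENNReal.ofReal (2 * Real.pi)⁻¹ •
    volume.restrict (Set.Ioc 0 (2 * Real.pi)) with hν₂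
  have hmeas : Measurable fun x : ℝ => ENNReal.ofReal (Real.exp (-x)) := by fun_prop
  have hs1 : SigmaFinite ν₁ := by
    rw [hν₁]
    exact SigmaFinite.withDensity_ofReal _
  have hs2 : IsFiniteMeasure ν₂ := by
    rw [hν₂]
    refine ⟨?_⟩
    simp only [Measure.smul_apply, smul_eq_mul]
    exact ENNReal.mul_lt_top ENNReal.ofReal_lt_top (measure_lt_top _ _)
  refine ⟨ν₁.prod ν₂, fun p => (√p.1 : ℂ) * circleMap 0 1 p.2, inferInstance, ?_⟩
  have hconj : ∀ θ : ℝ, (starRingEnd ℂ) (circleMap 0 1 θ) = (circleMap 0 1 θ)⁻¹ := fun θ =>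
    (Complex.inv_eq_conj (by simp)).symm
  have hform : ∀ (a b : ℕ) (p : ℝ × ℝ), ((√p.1 : ℂ) * circleMap 0 1 p.2) ^ a *
      (starRingEnd ℂ) ((√p.1 : ℂ) * circleMap 0 1 p.2) ^ b =
      ((√p.1 ^ (a + b) : ℝ) : ℂ) * (circleMap 0 1 p.2 ^ a * (circleMap 0 1 p.2)⁻¹ ^ b) := by
    intro a b p
    rw [map_mul, Complex.conj_ofReal, hconj]
    push_cast
    ring
  have hrpow : ∀ (k : ℕ), Set.EqOn
      (fun x : ℝ => Real.exp (-x) * x ^ ((k / 2 + 1 : ℝ) - 1))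
      (fun x : ℝ => Real.exp (-x) * √x ^ k) (Set.Ioi 0) := by
    intro k x hx
    have hx' : (0 : ℝ) < x := hx
    simp only [add_sub_cancel_right]
    rw [Real.sqrt_eq_rpow, ← Real.rpow_natCast, ← Real.rpow_mul hx'.le]
    congr 2; ring
  have hint1 : ∀ k : ℕ, Integrable (fun x : ℝ => √x ^ k) ν₁ := by
    intro k
    rw [hν₁, integrable_withDensity_iff_integrable_smul' hmeas (ae_of_all _ fun x =>
      ENNReal.ofReal_lt_top)]
    have h := Real.GammaIntegral_convergent (s := k / 2 + 1) (by positivity)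
    refine (h.congr_fun (hrpow k) measurableSet_Ioi).congr (ae_of_all _ fun x => ?_)
    simp [ENNReal.toReal_ofReal (Real.exp_pos _).le]
  have hval1 : ∀ a : ℕ, ∫ x : ℝ, √x ^ (a + a) ∂ν₁ = a ! := by
    intro a
    rw [hν₁, integral_withDensity_eq_integral_toReal_smul hmeas (ae_of_all _ fun x =>
      ENNReal.ofReal_lt_top)]
    rw [← Real.Gamma_nat_eq_factorial, Real.Gamma_eq_integral (by positivity)]
    refine setIntegral_congr_fun measurableSet_Ioi fun x hx => ?_
    have := hrpow (a + a) hx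
    simp only [ENNReal.toReal_ofReal (Real.exp_pos _).le, smul_eq_mul] at this ⊢
    rw [← this]
    push_cast
    congr 2; ring
  have hcirc : ∀ a b : ℕ, ∫ θ, circleMap 0 1 θ ^ a * (circleMap 0 1 θ)⁻¹ ^ b ∂ν₂ =
      if a = b then 1 else 0 := by
    intro a b
    rw [← circleAverage_pow_mul_inv_pow, Real.circleAverage, hν₂, integral_smul_measure,
      intervalIntegral.integral_of_le (by positivity),
      ENNReal.toReal_ofReal (by positivity)]
  have hcont : ∀ a b : ℕ, Continuous fun θ : ℝ =>
      circleMap 0 1 θ ^ a * (circleMap 0 1 θ)⁻¹ ^ b := by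
    intro a b
    simp only [← hconj]
    fun_prop
  have hint2 : ∀ a b : ℕ, Integrable (fun θ : ℝ =>
      circleMap 0 1 θ ^ a * (circleMap 0 1 θ)⁻¹ ^ b) ν₂ := by
    intro a b
    refine (integrable_const (1 : ℝ)).mono' (hcont a b).aestronglyMeasurable
      (ae_of_all _ fun θ => ?_)
    simp
  simp only [hform]
  refine ⟨fun a b => ?_, fun a b => ?_⟩
  · exact Integrable.mul_prod (hint1 (a + b)).ofReal (hint2 a b)
  · rw [integral_prod_mul (fun x : ℝ => ((√x ^ (a + b) : ℝ) : ℂ))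
      (fun θ => circleMap 0 1 θ ^ a * (circleMap 0 1 θ)⁻¹ ^ b), hcirc]
    split_ifs with h
    · subst h
      rw [integral_complex_ofReal, hval1]
      simp
    · simp

theorem prod_le_sum_div_card_pow {ι : Type*} [Fintype ι] [Nonempty ι] {a : ι → ℝ}
    (ha : ∀ i, 0 ≤ a i) : ∏ i, a i ≤ ((∑ i, a i) / Fintype.card ι) ^ Fintype.card ι := by
  have hn : (0 : ℝ) < Fintype.card ι := by exact_mod_cast Fintype.card_pos
  have h := Real.geom_mean_le_arith_mean_weighted Finset.univ (fun _ : ι => 1 / (Fintype.card ι : ℝ))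
    a (fun _ _ => by positivity) (by simp [hn.ne']) fun i _ => ha i
  have h2 := pow_le_pow_left₀ (Finset.prod_nonneg fun i _ => Real.rpow_nonneg (ha i) _) h
    (Fintype.card ι)
  rw [← Finset.prod_pow, ← Finset.mul_sum, one_div_mul_eq_div] at h2
  refine le_trans (le_of_eq (Finset.prod_congr rfl fun i _ => ?_)) h2
  rw [← Real.rpow_natCast, ← Real.rpow_mul (ha i), one_div_mul_cancel hn.ne', Real.rpow_one]

/-- By Wick, the permanent is the mean of `∏ ‖ξ i‖ ^ 2` with `ξ i = ∑ j, B j i * Z j`. AM-GM bounds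
the product by `(∑ ‖ξ i‖ ^ 2 / n) ^ n`, and orthogonality of the `B j` makes the sum diagonal,
namely `∑ c j * ‖Z j‖ ^ 2`. -/
theorem permanent_le_sum_piAntidiag {ι κ : Type*} [Fintype ι] [DecidableEq ι] [Nonempty ι]
    [Fintype κ] [DecidableEq κ] (B : κ → ι → ℝ) (c : κ → ℝ)
    (hB : ∀ j j', ∑ i, B j i * B j' i = if j = j' then c j else 0) :
    (Fintype.card ι : ℝ) ^ Fintype.card ι / (Fintype.card ι)! *
      ∑ τ : Equiv.Perm ι, ∏ i, ∑ j, B j i * B j (τ i) ≤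
      ∑ m ∈ Finset.piAntidiag Finset.univ (Fintype.card ι), ∏ j, c j ^ m j := by
  obtain ⟨γ, Z, hγ, hZi, hZ⟩ := exists_complex_gaussian_moments
  obtain ⟨hi1, he1⟩ := integral_prod_norm_sq_eq_permanent hZi hZ B
  obtain ⟨hi2, he2⟩ := integral_sum_mul_norm_sq_pow hZi hZ c (Fintype.card ι)
  set n := Fintype.card ι
  have hn : (0 : ℝ) < n := by exact_mod_cast Fintype.card_pos
  have hsum : ∀ ω : κ → ℝ × ℝ, ∑ i, ‖∑ j, (B j i : ℂ) * Z (ω j)‖ ^ 2 =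
      ∑ j, c j * ‖Z (ω j)‖ ^ 2 := by
    intro ω
    rw [← Complex.ofReal_inj]
    push_cast
    simp only [← Complex.mul_conj', map_sum, map_mul, Complex.conj_ofReal, Finset.sum_mul_sum]
    rw [Finset.sum_comm]
    refine Finset.sum_congr rfl fun j _ => ?_
    rw [Finset.sum_comm]
    have : ∀ j', ∑ i, (B j i : ℂ) * Z (ω j) * ((B j' i : ℂ) * (starRingEnd ℂ) (Z (ω j'))) =
        if j = j' then (c j : ℂ) * (Z (ω j) * (starRingEnd ℂ) (Z (ω j'))) else 0 := by
      intro j'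
      have h := congrArg (fun x : ℝ => (x : ℂ)) (hB j j')
      simp only [Complex.ofReal_sum, Complex.ofReal_mul] at h
      calc _ = (∑ i, (B j i : ℂ) * B j' i) * (Z (ω j) * (starRingEnd ℂ) (Z (ω j'))) := by
            rw [Finset.sum_mul]; exact Finset.sum_congr rfl fun i _ => by ring
        _ = _ := by rw [h]; split_ifs <;> simp
    simp only [this, Finset.sum_ite_eq, Finset.mem_univ, if_true]
  have hle : ∀ ω : κ → ℝ × ℝ, ∏ i, ‖∑ j, (B j i : ℂ) * Z (ω j)‖ ^ 2 ≤
      (1 / (n : ℝ) ^ n) * (∑ j, c j * ‖Z (ω j)‖ ^ 2) ^ n := by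
    intro ω
    refine (prod_le_sum_div_card_pow fun i => sq_nonneg _).trans (le_of_eq ?_)
    rw [hsum, div_pow]
    ring
  have hmain := integral_mono hi1 (hi2.const_mul (1 / (n : ℝ) ^ n)) hle
  rw [he1, integral_const_mul, he2] at hmain
  rw [div_mul_eq_mul_div, div_le_iff₀ (by positivity)]
  calc _ ≤ (n : ℝ) ^ n * (1 / n ^ n * (n ! * ∑ m ∈ Finset.piAntidiag Finset.univ n,
        ∏ j, c j ^ m j)) := by gcongr
    _ = _ := by field_simp

theorem permanent_le_prod_inv_one_sub {ι κ : Type*} [Fintype ι] [DecidableEq ι] [Nonempty ι]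
    [Fintype κ] [DecidableEq κ] (b : κ → ι → ℝ) (lam : κ → ℝ)
    (hb : ∀ k, ∑ i, b k i = 0)
    (hB : ∀ j j', ∑ i, b j i * b j' i = if j = j' then lam j else 0) (hlam : ∀ j, lam j < 1) :
    (Fintype.card ι : ℝ) ^ Fintype.card ι / (Fintype.card ι)! *
      ∑ τ : Equiv.Perm ι, ∏ i, (1 / (Fintype.card ι : ℝ) + ∑ k, b k i * b k (τ i)) ≤
      ∏ k, (1 - lam k)⁻¹ := by
  set n := Fintype.card ι with hn
  have hn' : (0 : ℝ) < n := by exact_mod_cast Fintype.card_pos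
  have hlam0 : ∀ j, 0 ≤ lam j := fun j => by
    have := hB j j
    rw [if_pos rfl] at this
    rw [← this]
    exact Finset.sum_nonneg fun i _ => mul_self_nonneg _
  -- The index `none` carries the normalised constant vector, with eigenvalue 1.
  set B : Option κ → ι → ℝ := fun o => o.elim (fun _ => 1 / √(n : ℝ)) b with hBdef
  set c : Option κ → ℝ := fun o => o.elim 1 lam with hc
  have hsq : 1 / √(n : ℝ) * (1 / √(n : ℝ)) = 1 / n := by
    rw [div_mul_div_comm, Real.mul_self_sqrt hn'.le, one_mul]
  have horth : ∀ j j', ∑ i, B j i * B j' i = if j = j' then c j else 0 := by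
    rintro (_ | j) (_ | j')
    · simp only [hBdef, hc, Option.elim, hsq]
      simp [← hn, hn'.ne']
    · simp [hBdef, ← Finset.mul_sum, hb]
    · simp [hBdef, ← Finset.sum_mul, hb]
    · simp [hBdef, hc, hB]
  have h := permanent_le_sum_piAntidiag B c horth
  have e1 : ∀ i i', ∑ j, B j i * B j i' = 1 / (n : ℝ) + ∑ k, b k i * b k i' := by
    intro i i'
    rw [Fintype.sum_option]
    simp only [hBdef, Option.elim, hsq]
  simp only [e1] at h
  refine h.trans ?_
  -- The exponent at `none` contributes a factor 1 and is determined by the total degree `n`.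
  -- Forgetting it leaves distinct monomials in `lam`, which are dominated by a product of geometric
  -- series.
  set f : (Option κ → ℕ) → κ → ℕ := fun m j => m (some j) with hf
  have hinj : Set.InjOn f (Finset.piAntidiag Finset.univ n : Finset (Option κ → ℕ)) := by
    intro m hm m' hm' hmm
    have h1 := (Finset.mem_piAntidiag.1 hm).1
    have h2 := (Finset.mem_piAntidiag.1 hm').1
    rw [Fintype.sum_option] at h1 h2
    have h3 : ∀ j, m (some j) = m' (some j) := fun j => congrFun hmm j
    funext o
    rcases o with _ | j
    · rw [Finset.sum_congr rfl fun j _ => h3 j] at h1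
      omega
    · exact h3 j
  calc ∑ m ∈ Finset.piAntidiag Finset.univ n, ∏ j, c j ^ m j
      = ∑ m ∈ (Finset.piAntidiag Finset.univ n : Finset (Option κ → ℕ)).image f,
          ∏ j, lam j ^ m j := by
        rw [Finset.sum_image hinj]
        refine Finset.sum_congr rfl fun m _ => ?_
        rw [Fintype.prod_option]
        simp [hc, hf]
    _ ≤ ∑ m ∈ Fintype.piFinset fun _ : κ => Finset.range (n + 1), ∏ j, lam j ^ m j := by
        refine Finset.sum_le_sum_of_subset_of_nonneg ?_ fun m _ _ =>
          Finset.prod_nonneg fun j _ => pow_nonneg (hlam0 j) _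
        intro m hm
        obtain ⟨m', hm', rfl⟩ := Finset.mem_image.1 hm
        rw [Fintype.mem_piFinset]
        intro j
        have h1 := (Finset.mem_piAntidiag.1 hm').1
        rw [Finset.mem_range, Nat.lt_succ_iff, ← h1]
        exact Finset.single_le_sum (f := m') (fun _ _ => Nat.zero_le _) (Finset.mem_univ (some j))
    _ = ∏ j, ∑ a ∈ Finset.range (n + 1), lam j ^ a := by
        rw [Finset.prod_univ_sum]
    _ ≤ ∏ k, (1 - lam k)⁻¹ := by
        refine Finset.prod_le_prod
          (fun j _ => Finset.sum_nonneg fun a _ => pow_nonneg (hlam0 j) _) fun j _ => ?_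
        rw [← tsum_geometric_of_lt_one (hlam0 j) (hlam j)]
        exact (summable_geometric_of_lt_one (hlam0 j) (hlam j)).sum_le_tsum _
          fun a _ => pow_nonneg (hlam0 j) a

/-! ### The `χ²` divergence and its variational form. -/

theorem chiSqDiv_of_absolutelyContinuous {X : Type*} [MeasurableSpace X] {P Q : Measure X}
    (h : P ≪ Q) :
    chiSqDiv P Q = ∫⁻ x, ENNReal.ofReal (((P.rnDeriv Q x).toReal - 1) ^ 2) ∂Q := if_pos h

theorem absolutelyContinuous_of_chiSqDiv_ne_top {X : Type*} [MeasurableSpace X] {P Q : Measure X}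
    (h : chiSqDiv P Q ≠ ∞) : P ≪ Q := by
  by_contra hn
  exact h (if_neg hn)

theorem chiSqDiv_add_one {X : Type*} [MeasurableSpace X] {P Q : Measure X}
    [IsProbabilityMeasure P] [IsProbabilityMeasure Q] (h : P ≪ Q) :
    chiSqDiv P Q + 1 = ∫⁻ x, P.rnDeriv Q x ^ 2 ∂Q := by
  have hm : Measurable (P.rnDeriv Q) := Measure.measurable_rnDeriv P Q
  have h1 : ∫⁻ x, P.rnDeriv Q x ∂Q = 1 := by
    rw [Measure.lintegral_rnDeriv h, measure_univ]
  have h2 : ∫⁻ x, (ENNReal.ofReal (((P.rnDeriv Q x).toReal - 1) ^ 2) + 2 * P.rnDeriv Q x) ∂Q =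
      ∫⁻ x, (P.rnDeriv Q x ^ 2 + 1) ∂Q := by
    refine lintegral_congr_ae ?_
    filter_upwards [Measure.rnDeriv_lt_top P Q] with x hx
    set p := (P.rnDeriv Q x).toReal with hp
    have hp0 : 0 ≤ p := ENNReal.toReal_nonneg
    have hpe : P.rnDeriv Q x = ENNReal.ofReal p := (ENNReal.ofReal_toReal hx.ne).symm
    rw [hpe, ← ENNReal.ofReal_pow hp0, ← ENNReal.ofReal_one, ← ENNReal.ofReal_ofNat 2,
      ← ENNReal.ofReal_mul (by norm_num), ← ENNReal.ofReal_add (by positivity) (by positivity),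
      ← ENNReal.ofReal_add (by positivity) (by positivity)]
    congr 1; ring
  rw [lintegral_add_right _ (hm.const_mul 2), lintegral_const_mul _ hm, h1,
    lintegral_add_right _ measurable_const, lintegral_const, measure_univ, mul_one, mul_one,
    ← chiSqDiv_of_absolutelyContinuous h, ← one_add_one_eq_two, ← add_assoc] at h2
  exact (ENNReal.add_left_inj ENNReal.one_ne_top).1 h2

theorem sq_lintegral_mul_le {X : Type*} [MeasurableSpace X] (Q : Measure X) {f g : X → ℝ≥0∞}
    (hf : Measurable f) (hg : Measurable g) :
    (∫⁻ x, f x * g x ∂Q) ^ 2 ≤ (∫⁻ x, f x ^ 2 ∂Q) * ∫⁻ x, g x ^ 2 ∂Q := by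
  have h := ENNReal.lintegral_mul_le_Lp_mul_Lq Q Real.HolderConjugate.two_two hf.aemeasurable
    hg.aemeasurable
  have h2 := pow_le_pow_left₀ (zero_le) h 2
  simp only [Pi.mul_apply, mul_pow, ← ENNReal.rpow_natCast, ← ENNReal.rpow_mul] at h2
  simpa using h2

theorem sq_lintegral_le_of_chiSqDiv_le {X : Type*} [MeasurableSpace X] {P Q : Measure X}
    [IsProbabilityMeasure P] [IsProbabilityMeasure Q] {D : ℝ≥0∞} (hD : D ≠ ∞)
    (h : chiSqDiv P Q ≤ D) {g : X → ℝ≥0∞} (hg : Measurable g) :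
    (∫⁻ x, g x ∂P) ^ 2 ≤ (1 + D) * ∫⁻ x, g x ^ 2 ∂Q := by
  have hac : P ≪ Q := absolutelyContinuous_of_chiSqDiv_ne_top (ne_top_of_le_ne_top hD h)
  rw [← lintegral_rnDeriv_mul hac hg.aemeasurable]
  refine (sq_lintegral_mul_le Q (Measure.measurable_rnDeriv P Q) hg).trans ?_
  rw [← chiSqDiv_add_one hac, add_comm]
  gcongr

/-- Converse of `sq_lintegral_le_of_chiSqDiv_le`. The variational form is linear in `Q` on its right
side, which makes bounds pass to mixtures in the second argument. -/
theorem chiSqDiv_le_of_sq_lintegral_le {X : Type*} [MeasurableSpace X] {P Q : Measure X}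
    [IsProbabilityMeasure P] [IsProbabilityMeasure Q] {D : ℝ≥0∞}
    (h : ∀ g : X → ℝ≥0∞, Measurable g → (∫⁻ x, g x ∂P) ^ 2 ≤ (1 + D) * ∫⁻ x, g x ^ 2 ∂Q) :
    chiSqDiv P Q ≤ D := by
  have hac : P ≪ Q := by
    refine Measure.AbsolutelyContinuous.mk fun s hs hQs => ?_
    have h1 := h (s.indicator 1) (measurable_one.indicator hs)
    have h2 : ∫⁻ x, (s.indicator 1 x : ℝ≥0∞) ^ 2 ∂Q = 0 := by
      rw [← hQs, ← lintegral_indicator_one hs]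
      refine lintegral_congr fun x => ?_
      by_cases hx : x ∈ s <;> simp [hx]
    rw [h2, mul_zero, lintegral_indicator_one hs] at h1
    exact pow_eq_zero_iff two_ne_zero |>.1 (le_antisymm h1 zero_le)
  have hm := Measure.measurable_rnDeriv P Q
  set p := P.rnDeriv Q
  -- The optimal test function is the density itself; truncation makes its second moment finite, so
  -- that it can be cancelled.
  have hk : ∀ k : ℕ, ∫⁻ x, (min (p x) k) ^ 2 ∂Q ≤ 1 + D := by
    intro k
    have hmk : Measurable fun x => min (p x) (k : ℝ≥0∞) := hm.min measurable_const
    set I := ∫⁻ x, (min (p x) (k : ℝ≥0∞)) ^ 2 ∂Q with hI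
    have hfin : I ≠ ∞ := by
      refine ne_top_of_le_ne_top (b := ((k : ℝ≥0∞) ^ 2)) (by finiteness) ?_
      calc I ≤ ∫⁻ _, (k : ℝ≥0∞) ^ 2 ∂Q := lintegral_mono fun x => by
            exact pow_le_pow_left₀ zero_le (min_le_right _ _) 2
        _ = _ := by simp
    have h1 := h _ hmk
    have h2 : I ≤ ∫⁻ x, min (p x) (k : ℝ≥0∞) ∂P := by
      rw [← lintegral_rnDeriv_mul hac hmk.aemeasurable]
      refine lintegral_mono fun x => ?_
      simp only [pow_two]
      gcongr
      exact min_le_left _ _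
    have h3 : I * I ≤ (1 + D) * I := by
      rw [← pow_two]
      exact (pow_le_pow_left₀ zero_le h2 2).trans h1
    rcases eq_or_ne I 0 with h0 | h0
    · rw [h0]; exact zero_le
    · exact (ENNReal.mul_le_mul_iff_left h0 hfin).1 h3
  have hlim : ∫⁻ x, p x ^ 2 ∂Q ≤ 1 + D := by
    have h1 : ∀ᵐ x ∂Q, p x ^ 2 = ⨆ k : ℕ, (min (p x) (k : ℝ≥0∞)) ^ 2 := by
      filter_upwards [Measure.rnDeriv_lt_top P Q] with x hx
      refine le_antisymm ?_ (iSup_le fun k => pow_le_pow_left₀ zero_le (min_le_left _ _) 2)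
      obtain ⟨k, hk⟩ := ENNReal.exists_nat_gt hx.ne
      refine le_iSup_of_le k ?_
      rw [min_eq_left hk.le]
    rw [lintegral_congr_ae h1, lintegral_iSup]
    · exact iSup_le hk
    · exact fun k => (hm.min measurable_const).pow_const 2
    · intro k l hkl x
      have : (k : ℝ≥0∞) ≤ l := by exact_mod_cast hkl
      dsimp only
      gcongr
  rw [← chiSqDiv_add_one hac, add_comm] at hlim
  exact (ENNReal.add_le_add_iff_left ENNReal.one_ne_top).1 hlim

theorem FamilyPrior.isProbabilityMeasure_mixture {X : Type*} [MeasurableSpace X]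
    {𝓕 : Set (ProbabilityMeasure X)} (ρ : FamilyPrior 𝓕) : IsProbabilityMeasure ρ.mixture := by
  let _ := ρ.sigmaAlg
  have := ρ.isProbabilityMeasure_law
  refine ⟨?_⟩
  rw [FamilyPrior.mixture, Measure.bind_apply MeasurableSet.univ ρ.measurable_coe.aemeasurable]
  simp

theorem chiSqCapacity_le_chiSqDiam {X : Type*} [MeasurableSpace X]
    {𝓕 : Set (ProbabilityMeasure X)} (h : chiSqDiam 𝓕 ≠ ∞) :
    chiSqCapacity 𝓕 ≤ chiSqDiam 𝓕 := by
  refine iSup_le fun ρ => ?_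
  let _ := ρ.sigmaAlg
  have := ρ.isProbabilityMeasure_law
  have := ρ.isProbabilityMeasure_mixture
  have key : ∀ P : 𝓕, chiSqDiv (P.1 : Measure X) ρ.mixture ≤ chiSqDiam 𝓕 := by
    intro P
    refine chiSqDiv_le_of_sq_lintegral_le fun g hg => ?_
    rw [FamilyPrior.mixture, Measure.lintegral_bind ρ.measurable_coe.aemeasurable
      (hg.pow_const 2).aemeasurable, ← lintegral_const_mul'']
    · calc (∫⁻ x, g x ∂(P.1 : Measure X)) ^ 2
          = ∫⁻ _, (∫⁻ x, g x ∂(P.1 : Measure X)) ^ 2 ∂ρ.law := by simp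
        _ ≤ _ := lintegral_mono fun P' => sq_lintegral_le_of_chiSqDiv_le h
            (le_iSup₂_of_le P.1 P.2 (le_iSup₂_of_le P'.1 P'.2 le_rfl)) hg
    · exact ((Measure.measurable_lintegral (hg.pow_const 2)).comp ρ.measurable_coe).aemeasurable
  calc ρ.chiSqInfo ≤ ∫⁻ _, chiSqDiam 𝓕 ∂ρ.law := lintegral_mono key
    _ = _ := by simp

/-- The Chapman-Robbins inequality: the shift of a mean is controlled by `χ²` times a variance. It
follows by applying the uncentred inequality to `g - t` for every `t`. -/
theorem sq_integral_sub_integral_le {X : Type*} [MeasurableSpace X] {P Q : Measure X}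
    [IsProbabilityMeasure P] [IsProbabilityMeasure Q] {D : ℝ} (hD : 0 ≤ D)
    (h : chiSqDiv P Q ≤ ENNReal.ofReal D) {g : X → ℝ} (hg : Measurable g) {K : ℝ}
    (hK : ∀ x, |g x| ≤ K) :
    (∫ x, g x ∂P - ∫ x, g x ∂Q) ^ 2 ≤ D * (∫ x, g x ^ 2 ∂Q - (∫ x, g x ∂Q) ^ 2) := by
  have hi : ∀ (R : Measure X) [IsProbabilityMeasure R], Integrable g R := fun R _ =>
    Integrable.of_bound hg.aestronglyMeasurable K (ae_of_all _ hK)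
  have hi2 : Integrable (fun x => g x ^ 2) Q :=
    Integrable.of_bound (hg.pow_const 2).aestronglyMeasurable (K ^ 2) (ae_of_all _ fun x => by
      rw [Real.norm_eq_abs, abs_pow]; exact pow_le_pow_left₀ (abs_nonneg _) (hK x) 2)
  set a := ∫ x, g x ∂P with ha
  set b := ∫ x, g x ∂Q with hb
  set V := ∫ x, g x ^ 2 ∂Q - b ^ 2 with hV
  have key : ∀ t : ℝ, (a - t) ^ 2 ≤ (1 + D) * (V + (b - t) ^ 2) := by
    intro t
    have hmt : Measurable fun x => g x - t := hg.sub_const t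
    have h1 := sq_lintegral_le_of_chiSqDiv_le ENNReal.ofReal_ne_top h
      (g := fun x => ENNReal.ofReal |g x - t|) (by fun_prop)
    have hit : ∀ (R : Measure X) [IsProbabilityMeasure R], Integrable (fun x => g x - t) R :=
      fun R _ => (hi R).sub (integrable_const t)
    have hexp : ∀ x, (g x - t) ^ 2 = g x ^ 2 - 2 * t * g x + t ^ 2 := fun x => by ring
    have hit2 : Integrable (fun x => (g x - t) ^ 2) Q := by
      simp only [hexp]
      exact (hi2.sub ((hi Q).const_mul _)).add (integrable_const _)
    have h2 : ∫ x, (g x - t) ^ 2 ∂Q = V + (b - t) ^ 2 := by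
      simp only [hexp]
      have hsub : Integrable (fun x => g x ^ 2 - 2 * t * g x) Q := hi2.sub ((hi Q).const_mul _)
      rw [integral_add hsub (integrable_const _),
        integral_sub hi2 ((hi Q).const_mul _), integral_const_mul]
      simp [hV, ← hb]
      ring
    have hpos2 : 0 ≤ ∫ x, (g x - t) ^ 2 ∂Q := integral_nonneg fun x => sq_nonneg _
    simp only [← ENNReal.ofReal_pow (abs_nonneg _), sq_abs] at h1
    rw [← ofReal_integral_eq_lintegral_ofReal (hit P).abs (ae_of_all _ fun x => abs_nonneg _),
      ← ofReal_integral_eq_lintegral_ofReal hit2 (ae_of_all _ fun x => sq_nonneg _),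
      ← ENNReal.ofReal_pow (integral_nonneg fun x => abs_nonneg _), ← ENNReal.ofReal_one,
      ← ENNReal.ofReal_add zero_le_one hD, ← ENNReal.ofReal_mul (by positivity),
      ENNReal.ofReal_le_ofReal_iff (by positivity), h2] at h1
    refine le_trans ?_ h1
    rw [← sq_abs (a - t)]
    refine pow_le_pow_left₀ (abs_nonneg _) ?_ 2
    have h3 : a - t = ∫ x, (g x - t) ∂P := by
      rw [integral_sub (hi P) (integrable_const t)]; simp [ha]
    rw [h3]
    exact abs_integral_le_integral_abs
  -- For `D = 0` no finite `t` is optimal, but a suitable one contradicts `a ≠ b`. For `D > 0` the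
  -- optimum is `t = b - (a - b) / D`.
  rcases hD.eq_or_lt with rfl | hDpos
  · have hab : a = b := by
      by_contra hne
      have hne' : a - b ≠ 0 := sub_ne_zero.2 hne
      have h1 := key (b - V / (2 * (a - b)))
      have h2 : (a - (b - V / (2 * (a - b)))) ^ 2 =
          (a - b) ^ 2 + V + (V / (2 * (a - b))) ^ 2 := by field_simp; ring
      rw [h2] at h1
      have h3 : 0 < (a - b) ^ 2 := by positivity
      have h4 : (b - (b - V / (2 * (a - b)))) ^ 2 = (V / (2 * (a - b))) ^ 2 := by ring
      rw [h4] at h1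
      linarith
    rw [hab]; simp
  · have h1 := key (b - (a - b) / D)
    have h2 : (a - (b - (a - b) / D)) ^ 2 = (a - b) ^ 2 * (1 + D) ^ 2 / D ^ 2 := by
      field_simp; ring
    have h3 : (b - (b - (a - b) / D)) ^ 2 = (a - b) ^ 2 / D ^ 2 := by
      field_simp; ring
    rw [h2, h3, div_le_iff₀ (by positivity)] at h1
    have h4 : (1 + D) * (V + (a - b) ^ 2 / D ^ 2) * D ^ 2 =
        (1 + D) * (V * D ^ 2 + (a - b) ^ 2) := by field_simp
    rw [h4] at h1
    have h5 : 0 < D * (1 + D) := by positivity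
    nlinarith

/-! ### Densities with respect to the average, and `χ²` as a permanent. -/

theorem pi_withDensity_ofReal {ι X : Type*} [Fintype ι] [MeasurableSpace X] (Q : Measure X)
    [IsProbabilityMeasure Q] {f : ι → X → ℝ} (hf0 : ∀ i x, 0 ≤ f i x)
    (hfi : ∀ i, Integrable (f i) Q) :
    Measure.pi (fun i => Q.withDensity fun x => ENNReal.ofReal (f i x)) =
      (Measure.pi fun _ : ι => Q).withDensity fun x => ENNReal.ofReal (∏ i, f i (x i)) := by
  have hsf : ∀ i, SigmaFinite (Q.withDensity fun x => ENNReal.ofReal (f i x)) := fun i =>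
    SigmaFinite.withDensity_ofReal _
  refine Measure.pi_eq fun s hs => ?_
  have hmeas : MeasurableSet (Set.univ.pi s) := MeasurableSet.univ_pi hs
  rw [withDensity_apply _ hmeas, ← lintegral_indicator hmeas]
  have h1 : ∀ x : ι → X, (Set.univ.pi s).indicator
      (fun x => ENNReal.ofReal (∏ i, f i (x i))) x =
      ENNReal.ofReal (∏ i, (s i).indicator (f i) (x i)) := by
    intro x
    by_cases hx : x ∈ Set.univ.pi s
    · rw [Set.indicator_of_mem hx]
      congr 1
      exact Finset.prod_congr rfl fun i _ => (Set.indicator_of_mem (hx i (Set.mem_univ i)) _).symm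
    · rw [Set.indicator_of_notMem hx]
      simp only [Set.mem_pi, Set.mem_univ, true_implies, not_forall] at hx
      obtain ⟨i, hi⟩ := hx
      rw [Finset.prod_eq_zero (Finset.mem_univ i) (Set.indicator_of_notMem hi _),
        ENNReal.ofReal_zero]
  have hii : ∀ i, Integrable ((s i).indicator (f i)) Q := fun i => (hfi i).indicator (hs i)
  have hn0 : ∀ i x, 0 ≤ (s i).indicator (f i) x := fun i x =>
    Set.indicator_nonneg (fun x _ => hf0 i x) x
  simp only [h1]
  rw [← ofReal_integral_eq_lintegral_ofReal (Integrable.fintype_prod hii)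
    (ae_of_all _ fun x => Finset.prod_nonneg fun i _ => hn0 i _),
    integral_fintype_prod_eq_prod (f := fun i => (s i).indicator (f i)),
    ENNReal.ofReal_prod_of_nonneg fun i _ => integral_nonneg (hn0 i)]
  refine Finset.prod_congr rfl fun i _ => ?_
  rw [withDensity_apply _ (hs i), ofReal_integral_eq_lintegral_ofReal (hii i)
    (ae_of_all _ (hn0 i)), ← lintegral_indicator (hs i)]
  refine lintegral_congr fun x => ?_
  by_cases hx : x ∈ s i <;> simp [hx]

theorem chiSqDiv_withDensity_ofReal {X : Type*} [MeasurableSpace X] {Q : Measure X}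
    [IsProbabilityMeasure Q] {F : X → ℝ} (hF : Measurable F) (hF0 : ∀ x, 0 ≤ F x) {K : ℝ}
    (hK : ∀ x, F x ≤ K) [IsProbabilityMeasure (Q.withDensity fun x => ENNReal.ofReal (F x))] :
    chiSqDiv (Q.withDensity fun x => ENNReal.ofReal (F x)) Q =
      ENNReal.ofReal (∫ x, F x ^ 2 ∂Q - 1) := by
  have hi : Integrable F Q := Integrable.of_bound hF.aestronglyMeasurable K
    (ae_of_all _ fun x => by rw [Real.norm_eq_abs, abs_of_nonneg (hF0 x)]; exact hK x)
  have hi2 : Integrable (fun x => F x ^ 2) Q :=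
    Integrable.of_bound (hF.pow_const 2).aestronglyMeasurable (K ^ 2) (ae_of_all _ fun x => by
      rw [Real.norm_eq_abs, abs_of_nonneg (sq_nonneg _)]
      exact pow_le_pow_left₀ (hF0 x) (hK x) 2)
  have h1 : ∫ x, F x ∂Q = 1 := by
    have h := measure_univ (μ := Q.withDensity fun x => ENNReal.ofReal (F x))
    rw [withDensity_apply _ MeasurableSet.univ, Measure.restrict_univ,
      ← ofReal_integral_eq_lintegral_ofReal hi (ae_of_all _ hF0), ENNReal.ofReal_eq_one] at h
    exact h
  rw [chiSqDiv_of_absolutelyContinuous (withDensity_absolutelyContinuous _ _)]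
  have h2 : ∫⁻ x, ENNReal.ofReal
      ((((Q.withDensity fun x => ENNReal.ofReal (F x)).rnDeriv Q x).toReal - 1) ^ 2) ∂Q =
      ∫⁻ x, ENNReal.ofReal ((F x - 1) ^ 2) ∂Q := by
    refine lintegral_congr_ae ?_
    filter_upwards [Measure.rnDeriv_withDensity Q hF.ennreal_ofReal] with x hx
    rw [hx, ENNReal.toReal_ofReal (hF0 x)]
  have hexp : ∀ x, (F x - 1) ^ 2 = F x ^ 2 - 2 * F x + 1 := fun x => by ring
  have hsub : Integrable (fun x => F x ^ 2 - 2 * F x) Q := hi2.sub (hi.const_mul 2)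
  rw [h2, ← ofReal_integral_eq_lintegral_ofReal _ (ae_of_all _ fun x => sq_nonneg _)]
  · congr 1
    simp only [hexp]
    rw [integral_add hsub (integrable_const _), integral_sub hi2 (hi.const_mul 2),
      integral_const_mul, h1]
    simp
    ring
  · simp only [hexp]
    exact hsub.add (integrable_const _)

/-- The average of finitely many probability measures. -/
noncomputable def averageMeasure {X : Type*} [MeasurableSpace X] {n : ℕ}
    (P : Fin n → ProbabilityMeasure X) : Measure X :=
  (n : ℝ≥0∞)⁻¹ • ∑ i, (P i : Measure X)

theorem isProbabilityMeasure_averageMeasure {X : Type*} [MeasurableSpace X] {n : ℕ} (hn : n ≠ 0)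
    (P : Fin n → ProbabilityMeasure X) : IsProbabilityMeasure (averageMeasure P) := by
  refine ⟨?_⟩
  rw [averageMeasure, Measure.smul_apply, Measure.finsetSum_apply]
  simp only [measure_univ, Finset.sum_const, Finset.card_univ, Fintype.card_fin, nsmul_eq_mul,
    mul_one, smul_eq_mul]
  exact ENNReal.inv_mul_cancel (by exact_mod_cast hn) (ENNReal.natCast_ne_top n)

/-- Since `P i ≤ n • Q`, the density is almost everywhere at most `n`. Truncating it gives the bound
everywhere, which settles integrability from here on. -/
theorem exists_density_averageMeasure {X : Type*} [MeasurableSpace X] {n : ℕ} (hn : n ≠ 0)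
    (P : Fin n → ProbabilityMeasure X) :
    ∃ f : Fin n → X → ℝ, (∀ i, Measurable (f i)) ∧ (∀ i x, 0 ≤ f i x) ∧ (∀ i x, f i x ≤ n) ∧
      ∀ i, (P i : Measure X) = (averageMeasure P).withDensity fun x => ENNReal.ofReal (f i x) := by
  have hprob := isProbabilityMeasure_averageMeasure hn P
  set Q := averageMeasure P with hQ
  have hn0 : (n : ℝ≥0∞) ≠ 0 := by exact_mod_cast hn
  have hle : ∀ i, (P i : Measure X) ≤ (n : ℝ≥0∞) • Q := by
    intro i
    rw [hQ, averageMeasure, smul_smul, ENNReal.mul_inv_cancel hn0 (ENNReal.natCast_ne_top n),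
      one_smul]
    refine Measure.le_iff.2 fun s _ => ?_
    rw [Measure.finsetSum_apply]
    exact Finset.single_le_sum (f := fun i => (P i : Measure X) s) (fun _ _ => zero_le)
      (Finset.mem_univ i)
  have hac : ∀ i, (P i : Measure X) ≪ Q := fun i =>
    (Measure.absolutelyContinuous_of_le (hle i)).trans Measure.smul_absolutelyContinuous
  have hbound : ∀ i, (P i : Measure X).rnDeriv Q ≤ᵐ[Q] fun _ => (n : ℝ≥0∞) := by
    intro i
    refine ae_le_of_forall_setLIntegral_le_of_sigmaFinite (Measure.measurable_rnDeriv _ _)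
      fun s hs _ => ?_
    rw [Measure.setLIntegral_rnDeriv (hac i), setLIntegral_const]
    exact hle i s
  refine ⟨fun i x => min ((P i : Measure X).rnDeriv Q x).toReal n, fun i => ?_, fun i x => ?_,
    fun i x => min_le_right _ _, fun i => ?_⟩
  · exact (Measure.measurable_rnDeriv _ _).ennreal_toReal.min measurable_const
  · exact le_min ENNReal.toReal_nonneg (Nat.cast_nonneg n)
  · rw [← Measure.withDensity_rnDeriv_eq _ _ (hac i)]
    refine withDensity_congr_ae ?_
    filter_upwards [hbound i] with x hx
    have h1 : ((P i : Measure X).rnDeriv Q x).toReal ≤ n := by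
      have := ENNReal.toReal_mono (ENNReal.natCast_ne_top n) hx
      simpa using this
    rw [min_eq_left h1, ENNReal.ofReal_toReal (ne_top_of_le_ne_top (ENNReal.natCast_ne_top n) hx)]

theorem isProbabilityMeasure_permMixture {X : Type*} [MeasurableSpace X] {n : ℕ}
    (P : Fin n → ProbabilityMeasure X) : IsProbabilityMeasure (permMixture P) := by
  refine ⟨?_⟩
  rw [permMixture, Measure.smul_apply, Measure.finsetSum_apply]
  simp only [measure_univ, Finset.sum_const, Finset.card_univ, Fintype.card_perm,
    Fintype.card_fin, nsmul_eq_mul, mul_one, smul_eq_mul]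
  exact ENNReal.inv_mul_cancel (by exact_mod_cast (Nat.factorial_pos n).ne')
    (ENNReal.natCast_ne_top _)

theorem permMixture_eq_withDensity {X : Type*} [MeasurableSpace X] {n : ℕ}
    (P : Fin n → ProbabilityMeasure X) [IsProbabilityMeasure (averageMeasure P)]
    {f : Fin n → X → ℝ} (hf : ∀ i, Measurable (f i)) (hf0 : ∀ i x, 0 ≤ f i x)
    (hfn : ∀ i x, f i x ≤ n)
    (hP : ∀ i, (P i : Measure X) = (averageMeasure P).withDensity fun x => ENNReal.ofReal (f i x)) :
    permMixture P = (iidMixture P).withDensity fun x =>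
      ENNReal.ofReal ((n ! : ℝ)⁻¹ * ∑ π : Equiv.Perm (Fin n), ∏ i, f (π i) (x i)) := by
  have hfi : ∀ i, Integrable (f i) (averageMeasure P) := fun i =>
    Integrable.of_bound (hf i).aestronglyMeasurable n
      (ae_of_all _ fun x => by rw [Real.norm_eq_abs, abs_of_nonneg (hf0 i x)]; exact hfn i x)
  have h1 : ∀ π : Equiv.Perm (Fin n), Measure.pi (fun i => (P (π i) : Measure X)) =
      (iidMixture P).withDensity fun x => ENNReal.ofReal (∏ i, f (π i) (x i)) := by
    intro π
    simp only [hP]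
    exact pi_withDensity_ofReal (averageMeasure P) (fun i => hf0 (π i))
      fun i => hfi (π i)
  have hm : ∀ π : Equiv.Perm (Fin n), Measurable fun x : Fin n → X => ∏ i, f (π i) (x i) :=
    fun π => Finset.measurable_fun_prod _ fun i _ => (hf (π i)).comp (measurable_pi_apply i)
  rw [permMixture]
  simp only [h1]
  ext s hs
  rw [Measure.smul_apply, Measure.finsetSum_apply, withDensity_apply _ hs, smul_eq_mul]
  have h2 : ∀ x : Fin n → X,
      ENNReal.ofReal ((n ! : ℝ)⁻¹ * ∑ π : Equiv.Perm (Fin n), ∏ i, f (π i) (x i)) =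
      ((n ! : ℕ) : ℝ≥0∞)⁻¹ * ∑ π : Equiv.Perm (Fin n), ENNReal.ofReal (∏ i, f (π i) (x i)) := by
    intro x
    rw [ENNReal.ofReal_mul (by positivity), ENNReal.ofReal_inv_of_pos (by positivity),
      ENNReal.ofReal_natCast, ENNReal.ofReal_sum_of_nonneg fun π _ =>
        Finset.prod_nonneg fun i _ => hf0 _ _]
  simp only [h2]
  rw [lintegral_const_mul _ (Finset.measurable_fun_sum _ fun π _ => (hm π).ennreal_ofReal),
    lintegral_finsetSum _ fun π _ => (hm π).ennreal_ofReal]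
  congr 1
  exact Finset.sum_congr rfl fun π _ => withDensity_apply _ hs

/-- The second moment of the density is a double sum over permutations `π`, `σ`. After relabelling
the coordinates each term depends only on `σ * π⁻¹`, so one of the two factors `1 / n!` is absorbed.
-/
theorem chiSqDiv_permMixture {X : Type*} [MeasurableSpace X] {n : ℕ}
    (P : Fin n → ProbabilityMeasure X) [IsProbabilityMeasure (averageMeasure P)]
    {f : Fin n → X → ℝ} (hf : ∀ i, Measurable (f i)) (hf0 : ∀ i x, 0 ≤ f i x)
    (hfn : ∀ i x, f i x ≤ n)
    (hP : ∀ i, (P i : Measure X) = (averageMeasure P).withDensity fun x => ENNReal.ofReal (f i x)) :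
    chiSqDiv (permMixture P) (iidMixture P) =
      ENNReal.ofReal ((n ! : ℝ)⁻¹ *
        ∑ τ : Equiv.Perm (Fin n), ∏ i, (∫ x, f i x * f (τ i) x ∂(averageMeasure P)) - 1) := by
  have hprob := isProbabilityMeasure_permMixture P
  have hiid : IsProbabilityMeasure (iidMixture P) := by
    change IsProbabilityMeasure (Measure.pi fun _ => averageMeasure P)
    infer_instance
  have hden := permMixture_eq_withDensity P hf hf0 hfn hP
  set F : (Fin n → X) → ℝ :=
    fun x => (n ! : ℝ)⁻¹ * ∑ π : Equiv.Perm (Fin n), ∏ i, f (π i) (x i) with hF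
  have hm : ∀ π : Equiv.Perm (Fin n), Measurable fun x : Fin n → X => ∏ i, f (π i) (x i) :=
    fun π => Finset.measurable_fun_prod _ fun i _ => (hf (π i)).comp (measurable_pi_apply i)
  have hFm : Measurable F := (Finset.measurable_fun_sum _ fun π _ => hm π).const_mul _
  have hF0 : ∀ x, 0 ≤ F x := fun x => mul_nonneg (by positivity)
    (Finset.sum_nonneg fun π _ => Finset.prod_nonneg fun i _ => hf0 _ _)
  have hFK : ∀ x, F x ≤ (n ! : ℝ)⁻¹ * ∑ π : Equiv.Perm (Fin n), ∏ i : Fin n, (n : ℝ) := fun x => by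
    refine mul_le_mul_of_nonneg_left (Finset.sum_le_sum fun π _ =>
      Finset.prod_le_prod (fun i _ => hf0 _ _) fun i _ => hfn _ _) (by positivity)
  have hpi : iidMixture P = Measure.pi fun _ => averageMeasure P := rfl
  rw [hden] at hprob ⊢
  rw [chiSqDiv_withDensity_ofReal hFm hF0 hFK]
  congr 2
  have hii : ∀ i j, Integrable (fun x => f i x * f j x) (averageMeasure P) := fun i j =>
    Integrable.of_bound ((hf i).mul (hf j)).aestronglyMeasurable (n * n)
      (ae_of_all _ fun x => by
        rw [Real.norm_eq_abs, abs_of_nonneg (mul_nonneg (hf0 i x) (hf0 j x))]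
        exact mul_le_mul (hfn i x) (hfn j x) (hf0 j x) (Nat.cast_nonneg n))
  have hexp : ∀ x, F x ^ 2 = (n ! : ℝ)⁻¹ ^ 2 * ∑ π : Equiv.Perm (Fin n), ∑ σ : Equiv.Perm (Fin n),
      ∏ i, f (π i) (x i) * f (σ i) (x i) := by
    intro x
    rw [hF, mul_pow, pow_two (∑ π : Equiv.Perm (Fin n), _), Finset.sum_mul_sum]
    simp only [Finset.prod_mul_distrib]
  have hint : ∀ π σ : Equiv.Perm (Fin n), Integrable
      (fun x : Fin n → X => ∏ i, f (π i) (x i) * f (σ i) (x i))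
      (Measure.pi fun _ => averageMeasure P) := fun π σ =>
    Integrable.fintype_prod (f := fun i x => f (π i) x * f (σ i) x) fun i => hii _ _
  simp only [hexp, hpi]
  rw [integral_const_mul, integral_finsetSum _ fun π _ => integrable_finsetSum _ fun σ _ => hint π σ]
  have h1 : ∀ π : Equiv.Perm (Fin n), ∫ x, ∑ σ : Equiv.Perm (Fin n),
      ∏ i, f (π i) (x i) * f (σ i) (x i) ∂(Measure.pi fun _ => averageMeasure P) =
      ∑ τ : Equiv.Perm (Fin n), ∏ i, (∫ x, f i x * f (τ i) x ∂(averageMeasure P)) := by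
    intro π
    rw [integral_finsetSum _ fun σ _ => hint π σ]
    refine Fintype.sum_equiv (Equiv.mulRight π⁻¹) _ _ fun σ => ?_
    refine (integral_fintype_prod_eq_prod (f := fun i x => f (π i) x * f (σ i) x)).trans ?_
    refine Fintype.prod_equiv π _ _ fun i => ?_
    simp
  rw [Finset.sum_congr rfl fun π _ => h1 π, Finset.sum_const, Finset.card_univ, Fintype.card_perm,
    Fintype.card_fin, nsmul_eq_mul]
  have : (n ! : ℝ) ≠ 0 := by positivity
  field_simp

/-- The left side is the information of the uniform prior on the indices, realised on the σ-algebra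
of all subsets so that no measurability condition arises. -/
theorem sum_chiSqDiv_averageMeasure_le_chiSqCapacity {X : Type*} [MeasurableSpace X]
    {𝓕 : Set (ProbabilityMeasure X)} {n : ℕ} (hn : n ≠ 0) (P : Fin n → ProbabilityMeasure X)
    (hP : ∀ i, P i ∈ 𝓕) :
    (n : ℝ≥0∞)⁻¹ * ∑ i, chiSqDiv (P i : Measure X) (averageMeasure P) ≤ chiSqCapacity 𝓕 := by
  let _ : MeasurableSpace 𝓕 := ⊤
  set μ : Measure 𝓕 := (n : ℝ≥0∞)⁻¹ • ∑ i, Measure.dirac ⟨P i, hP i⟩ with hμ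
  have hlint : ∀ g : 𝓕 → ℝ≥0∞, ∫⁻ p, g p ∂μ = (n : ℝ≥0∞)⁻¹ * ∑ i, g ⟨P i, hP i⟩ := by
    intro g
    rw [hμ, lintegral_smul_measure, lintegral_finsetSum_measure, smul_eq_mul]
    congr 1
    exact Finset.sum_congr rfl fun i _ => lintegral_dirac' _ measurable_from_top
  have hprob : IsProbabilityMeasure μ := by
    refine ⟨?_⟩
    have := hlint fun _ => 1
    rw [lintegral_one] at this
    rw [this]
    simp only [Finset.sum_const, Finset.card_univ, Fintype.card_fin, nsmul_eq_mul,
      mul_one]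
    exact ENNReal.inv_mul_cancel (by exact_mod_cast hn) (ENNReal.natCast_ne_top n)
  let ρ : FamilyPrior 𝓕 := ⟨⊤, measurable_from_top, μ, hprob⟩
  have hmix : ρ.mixture = averageMeasure P := by
    ext s hs
    have hb : ρ.mixture s = ∫⁻ p, (p.1 : Measure X) s ∂μ :=
      Measure.bind_apply hs (measurable_from_top.aemeasurable)
    rw [hb, hlint, averageMeasure, Measure.smul_apply, Measure.finsetSum_apply, smul_eq_mul]
  have hinfo : ρ.chiSqInfo = (n : ℝ≥0∞)⁻¹ *
      ∑ i, chiSqDiv (P i : Measure X) (averageMeasure P) := by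
    have h1 : ρ.chiSqInfo = ∫⁻ p, chiSqDiv (p.1 : Measure X) ρ.mixture ∂μ := rfl
    rw [h1, hlint, hmix]
  rw [← hinfo]
  exact le_iSup (fun ρ : FamilyPrior 𝓕 => ρ.chiSqInfo) ρ

/-! ### Hellinger distance and lower bounds on overlaps. -/

/-- Independence of the dominating measure: the chain rule for densities, together with homogeneity
of degree one of `(√p - √q) ^ 2`. -/
theorem hellingerSq_withDensity_ofReal {X : Type*} [MeasurableSpace X] {Q : Measure X}
    [IsProbabilityMeasure Q] {f g : X → ℝ} (hf : Measurable f) (hg : Measurable g)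
    (hf0 : ∀ x, 0 ≤ f x) (hg0 : ∀ x, 0 ≤ g x)
    [IsProbabilityMeasure (Q.withDensity fun x => ENNReal.ofReal (f x))]
    [IsProbabilityMeasure (Q.withDensity fun x => ENNReal.ofReal (g x))] :
    hellingerSq (Q.withDensity fun x => ENNReal.ofReal (f x))
      (Q.withDensity fun x => ENNReal.ofReal (g x)) =
      ∫⁻ x, ENNReal.ofReal ((√(f x) - √(g x)) ^ 2) ∂Q := by
  set P₁ := Q.withDensity fun x => ENNReal.ofReal (f x) with hP₁
  set P₂ := Q.withDensity fun x => ENNReal.ofReal (g x) with hP₂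
  have hsum : P₁ + P₂ = Q.withDensity fun x => ENNReal.ofReal (f x + g x) := by
    rw [hP₁, hP₂, ← withDensity_add_left hf.ennreal_ofReal]
    refine congrArg _ (funext fun x => ?_)
    rw [Pi.add_apply, ENNReal.ofReal_add (hf0 x) (hg0 x)]
  have hac₁ : P₁ ≪ P₁ + P₂ := Measure.AbsolutelyContinuous.rfl.add_right _
  have hac₂ : P₂ ≪ P₁ + P₂ := Measure.AbsolutelyContinuous.rfl.add_right' _
  have hr₁ := Measure.rnDeriv_mul_rnDeriv (κ := Q) hac₁
  have hr₂ := Measure.rnDeriv_mul_rnDeriv (κ := Q) hac₂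
  have hd₁ : P₁.rnDeriv Q =ᵐ[Q] _ := Measure.rnDeriv_withDensity Q hf.ennreal_ofReal
  have hd₂ : P₂.rnDeriv Q =ᵐ[Q] _ := Measure.rnDeriv_withDensity Q hg.ennreal_ofReal
  have hds : (P₁ + P₂).rnDeriv Q =ᵐ[Q] fun x => ENNReal.ofReal (f x + g x) := by
    rw [hsum]; exact Measure.rnDeriv_withDensity Q (hf.add hg).ennreal_ofReal
  set p := P₁.rnDeriv (P₁ + P₂) with hp
  set q := P₂.rnDeriv (P₁ + P₂) with hq
  have hpm : Measurable p := Measure.measurable_rnDeriv _ _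
  have hqm : Measurable q := Measure.measurable_rnDeriv _ _
  rw [hellingerSq, ← hp, ← hq]
  nth_rewrite 1 [hsum]
  rw [lintegral_withDensity_eq_lintegral_mul _
    (show Measurable fun x => ENNReal.ofReal (f x + g x) from (hf.add hg).ennreal_ofReal)
    (by fun_prop)]
  refine lintegral_congr_ae ?_
  filter_upwards [hr₁, hr₂, hd₁, hd₂, hds] with x h1 h2 h3 h4 h5
  simp only [Pi.mul_apply] at h1 h2 ⊢
  have hs0 : 0 ≤ f x + g x := add_nonneg (hf0 x) (hg0 x)
  have e1 : (p x).toReal * (f x + g x) = f x := by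
    have := congrArg ENNReal.toReal (h1.trans h3)
    rw [h5, ENNReal.toReal_mul, ENNReal.toReal_ofReal hs0, ENNReal.toReal_ofReal (hf0 x)] at this
    exact this
  have e2 : (q x).toReal * (f x + g x) = g x := by
    have := congrArg ENNReal.toReal (h2.trans h4)
    rw [h5, ENNReal.toReal_mul, ENNReal.toReal_ofReal hs0, ENNReal.toReal_ofReal (hg0 x)] at this
    exact this
  rw [← ENNReal.ofReal_mul hs0]
  congr 1
  nth_rewrite 2 [← e1]
  nth_rewrite 3 [← e2]
  rw [Real.sqrt_mul ENNReal.toReal_nonneg, Real.sqrt_mul ENNReal.toReal_nonneg, ← sub_mul,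
    mul_pow, Real.sq_sqrt hs0, mul_comm]

/-- The affinity `∫ √(f g)` is one minus half the squared Hellinger distance, and its square is at
most `∫ f g` because `Q` has mass 1. -/
theorem one_sub_sq_le_integral_mul_of_hellingerSq_le {X : Type*} [MeasurableSpace X] {Q : Measure X}
    [IsProbabilityMeasure Q] {f g : X → ℝ} (hf : Measurable f) (hg : Measurable g)
    (hf0 : ∀ x, 0 ≤ f x) (hg0 : ∀ x, 0 ≤ g x) {K : ℝ} (hfK : ∀ x, f x ≤ K) (hgK : ∀ x, g x ≤ K)
    (hf1 : ∫ x, f x ∂Q = 1) (hg1 : ∫ x, g x ∂Q = 1) {d : ℝ} (hd : 0 ≤ d) (hd2 : d ≤ 2)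
    (h : ∫⁻ x, ENNReal.ofReal ((√(f x) - √(g x)) ^ 2) ∂Q ≤ ENNReal.ofReal d) :
    (1 - d / 2) ^ 2 ≤ ∫ x, f x * g x ∂Q := by
  have hK0 : ∀ x, 0 ≤ K := fun x => (hf0 x).trans (hfK x)
  have hfi : Integrable f Q := Integrable.of_bound hf.aestronglyMeasurable K
    (ae_of_all _ fun x => by rw [Real.norm_eq_abs, abs_of_nonneg (hf0 x)]; exact hfK x)
  have hgi : Integrable g Q := Integrable.of_bound hg.aestronglyMeasurable K
    (ae_of_all _ fun x => by rw [Real.norm_eq_abs, abs_of_nonneg (hg0 x)]; exact hgK x)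
  have hfgm : Measurable fun x => f x * g x := hf.mul hg
  have hfgb : ∀ x, f x * g x ≤ K * K := fun x =>
    mul_le_mul (hfK x) (hgK x) (hg0 x) (hK0 x)
  have hfg0 : ∀ x, 0 ≤ f x * g x := fun x => mul_nonneg (hf0 x) (hg0 x)
  have hfgi : Integrable (fun x => f x * g x) Q := Integrable.of_bound hfgm.aestronglyMeasurable
    (K * K) (ae_of_all _ fun x => by
      rw [Real.norm_eq_abs, abs_of_nonneg (hfg0 x)]; exact hfgb x)
  have hsi : Integrable (fun x => √(f x * g x)) Q :=
    Integrable.of_bound hfgm.sqrt.aestronglyMeasurable (√(K * K)) (ae_of_all _ fun x => by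
      rw [Real.norm_eq_abs, abs_of_nonneg (Real.sqrt_nonneg _)]
      exact Real.sqrt_le_sqrt (hfgb x))
  set a := ∫ x, √(f x * g x) ∂Q with ha
  have hexp : ∀ x, (√(f x) - √(g x)) ^ 2 = f x + g x - 2 * √(f x * g x) := by
    intro x
    rw [sub_sq, Real.sq_sqrt (hf0 x), Real.sq_sqrt (hg0 x), Real.sqrt_mul (hf0 x)]
    ring
  have hadd : Integrable (fun x => f x + g x) Q := hfi.add hgi
  have hsub2 : Integrable (fun x => f x + g x - 2 * √(f x * g x)) Q := hadd.sub (hsi.const_mul 2)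
  simp only [hexp] at h
  rw [← ofReal_integral_eq_lintegral_ofReal hsub2
    (ae_of_all _ fun x => (sq_nonneg _).trans_eq (hexp x)),
    ENNReal.ofReal_le_ofReal_iff hd, integral_sub hadd (hsi.const_mul 2), integral_add hfi hgi,
    integral_const_mul, hf1, hg1] at h
  have h1 : a ^ 2 ≤ ∫ x, f x * g x ∂Q := by
    have h2 : 0 ≤ ∫ x, (√(f x * g x) - a) ^ 2 ∂Q := integral_nonneg fun x => sq_nonneg _
    have hexp2 : ∀ x, (√(f x * g x) - a) ^ 2 = f x * g x - 2 * a * √(f x * g x) + a ^ 2 := by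
      intro x
      rw [sub_sq, Real.sq_sqrt (hfg0 x)]; ring
    have hsub : Integrable (fun x => f x * g x - 2 * a * √(f x * g x)) Q :=
      hfgi.sub (hsi.const_mul _)
    simp only [hexp2] at h2
    rw [integral_add hsub (integrable_const _), integral_sub hfgi (hsi.const_mul _),
      integral_const_mul, ← ha] at h2
    simp only [integral_const, probReal_univ, smul_eq_mul, one_mul] at h2
    nlinarith
  refine le_trans (pow_le_pow_left₀ (by linarith) ?_ 2) h1
  linarith

/-! ### The Gram matrix of the densities. -/

section Gram

variable {X : Type*} [MeasurableSpace X] {n : ℕ} {P : Fin n → ProbabilityMeasure X}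
  {f : Fin n → X → ℝ}

theorem integral_eq_integral_mul_density (hf : ∀ i, Measurable (f i)) (hf0 : ∀ i x, 0 ≤ f i x)
    (hP : ∀ i, (P i : Measure X) = (averageMeasure P).withDensity fun x => ENNReal.ofReal (f i x))
    (i : Fin n) (h : X → ℝ) :
    ∫ x, h x ∂(P i : Measure X) = ∫ x, f i x * h x ∂(averageMeasure P) := by
  rw [hP i, integral_withDensity_eq_integral_toReal_smul (hf i).ennreal_ofReal
    (ae_of_all _ fun x => ENNReal.ofReal_lt_top)]
  refine integral_congr_ae (ae_of_all _ fun x => ?_)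
  simp [ENNReal.toReal_ofReal (hf0 i x)]

theorem sum_integral_eq_integral_averageMeasure (hn : n ≠ 0) {h : X → ℝ}
    (hh : ∀ i, Integrable h (P i : Measure X)) :
    ∑ i, ∫ x, h x ∂(P i : Measure X) = n * ∫ x, h x ∂(averageMeasure P) := by
  rw [averageMeasure, integral_smul_measure, integral_finsetSum_measure fun i _ => hh i]
  have : (n : ℝ) ≠ 0 := by exact_mod_cast hn
  simp [this]

theorem integrable_of_abs_le (μ : Measure X) [IsFiniteMeasure μ] {h : X → ℝ} (hm : Measurable h)
    {K : ℝ} (hK : ∀ x, |h x| ≤ K) : Integrable h μ :=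
  Integrable.of_bound hm.aestronglyMeasurable K (ae_of_all _ hK)

theorem integral_density_eq_one (hf : ∀ i, Measurable (f i)) (hf0 : ∀ i x, 0 ≤ f i x)
    (hP : ∀ i, (P i : Measure X) = (averageMeasure P).withDensity fun x => ENNReal.ofReal (f i x))
    (i : Fin n) : ∫ x, f i x ∂(averageMeasure P) = 1 := by
  have h := integral_eq_integral_mul_density hf hf0 hP i fun _ => 1
  simpa using h.symm

/-- Double stochasticity of `G / n`: averaging over `j` replaces `P j` by the average measure, for
which `f i` has integral 1. -/
theorem sum_integral_density_mul_density (hn : n ≠ 0) [IsProbabilityMeasure (averageMeasure P)]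
    (hf : ∀ i, Measurable (f i)) (hf0 : ∀ i x, 0 ≤ f i x) (hfn : ∀ i x, f i x ≤ n)
    (hP : ∀ i, (P i : Measure X) = (averageMeasure P).withDensity fun x => ENNReal.ofReal (f i x))
    (i : Fin n) : ∑ j, ∫ x, f i x * f j x ∂(averageMeasure P) = n := by
  have hb : ∀ x, |f i x| ≤ n := fun x => by rw [abs_of_nonneg (hf0 i x)]; exact hfn i x
  have h1 := sum_integral_eq_integral_averageMeasure (P := P) hn
    fun j => integrable_of_abs_le (P j : Measure X) (hf i) hb
  simp only [integral_eq_integral_mul_density hf hf0 hP] at h1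
  rw [integral_density_eq_one hf hf0 hP, mul_one] at h1
  rw [← h1]
  exact Finset.sum_congr rfl fun j _ => by simp only [mul_comm]

theorem sum_sum_mul_integral_density (hf : ∀ i, Measurable (f i)) (hf0 : ∀ i x, 0 ≤ f i x)
    (hfn : ∀ i x, f i x ≤ n) [IsProbabilityMeasure (averageMeasure P)] (v : Fin n → ℝ) :
    ∑ i, ∑ j, v i * v j * ∫ x, f i x * f j x ∂(averageMeasure P) =
      ∫ x, (∑ i, v i * f i x) ^ 2 ∂(averageMeasure P) := by
  have hexp : ∀ x, (∑ i, v i * f i x) ^ 2 = ∑ i, ∑ j, v i * v j * (f i x * f j x) := by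
    intro x
    rw [pow_two, Finset.sum_mul_sum]
    exact Finset.sum_congr rfl fun i _ => Finset.sum_congr rfl fun j _ => by ring
  have hint : ∀ i j, Integrable (fun x => v i * v j * (f i x * f j x)) (averageMeasure P) :=
    fun i j => (integrable_of_abs_le (averageMeasure P)
      (show Measurable fun x => f i x * f j x from (hf i).mul (hf j)) (K := n * n)
      fun x => by
        rw [abs_of_nonneg (mul_nonneg (hf0 i x) (hf0 j x))]
        exact mul_le_mul (hfn i x) (hfn j x) (hf0 j x) (Nat.cast_nonneg n)).const_mul _
  simp only [hexp]
  rw [integral_finsetSum _ fun i _ => integrable_finsetSum _ fun j _ => hint i j]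
  refine Finset.sum_congr rfl fun i _ => ?_
  rw [integral_finsetSum _ fun j _ => hint i j]
  exact Finset.sum_congr rfl fun j _ => (integral_const_mul _ _).symm

/-- The variance of `∑ v i * f i` is nonnegative; this makes the Gram matrix positive semidefinite
even after the all-ones matrix is subtracted. -/
theorem sq_sum_le_sum_sum_mul_integral_density (hf : ∀ i, Measurable (f i))
    (hf0 : ∀ i x, 0 ≤ f i x)
    (hfn : ∀ i x, f i x ≤ n) [IsProbabilityMeasure (averageMeasure P)]
    (hP : ∀ i, (P i : Measure X) = (averageMeasure P).withDensity fun x => ENNReal.ofReal (f i x))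
    (v : Fin n → ℝ) :
    (∑ i, v i) ^ 2 ≤ ∑ i, ∑ j, v i * v j * ∫ x, f i x * f j x ∂(averageMeasure P) := by
  rw [sum_sum_mul_integral_density hf hf0 hfn]
  set g : X → ℝ := fun x => ∑ i, v i * f i x with hg
  have hfi : ∀ i, Integrable (fun x => v i * f i x) (averageMeasure P) := fun i =>
    (integrable_of_abs_le (averageMeasure P) (hf i) (K := n) fun x => by
      rw [abs_of_nonneg (hf0 i x)]; exact hfn i x).const_mul _
  have hgm : Measurable g := Finset.measurable_fun_sum _ fun i _ => (hf i).const_mul _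
  have hgK : ∀ x, |g x| ≤ ∑ i, |v i| * n := fun x =>
    (Finset.abs_sum_le_sum_abs _ _).trans (Finset.sum_le_sum fun i _ => by
      rw [abs_mul, abs_of_nonneg (hf0 i x)]
      exact mul_le_mul_of_nonneg_left (hfn i x) (abs_nonneg _))
  have hgi : Integrable g (averageMeasure P) := integrable_of_abs_le _ hgm hgK
  have hgi2 : Integrable (fun x => g x ^ 2) (averageMeasure P) :=
    integrable_of_abs_le _ (hgm.pow_const 2) (K := (∑ i, |v i| * n) ^ 2) fun x => by
      rw [abs_pow]; exact pow_le_pow_left₀ (abs_nonneg _) (hgK x) 2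
  have hint : ∫ x, g x ∂(averageMeasure P) = ∑ i, v i := by
    rw [hg, integral_finsetSum _ fun i _ => hfi i]
    refine Finset.sum_congr rfl fun i _ => ?_
    rw [integral_const_mul, integral_density_eq_one hf hf0 hP, mul_one]
  set a := ∑ i, v i with ha
  have h2 : 0 ≤ ∫ x, (g x - a) ^ 2 ∂(averageMeasure P) := integral_nonneg fun x => sq_nonneg _
  have hexp2 : ∀ x, (g x - a) ^ 2 = g x ^ 2 - 2 * a * g x + a ^ 2 := fun x => by ring
  have hsub : Integrable (fun x => g x ^ 2 - 2 * a * g x) (averageMeasure P) :=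
    hgi2.sub (hgi.const_mul _)
  simp only [hexp2] at h2
  rw [integral_add hsub (integrable_const _), integral_sub hgi2 (hgi.const_mul _),
    integral_const_mul, hint] at h2
  simp only [integral_const, probReal_univ, smul_eq_mul, one_mul] at h2
  linarith

theorem sum_integral_density_sq_le (hn : n ≠ 0) {𝓕 : Set (ProbabilityMeasure X)}
    (hF : ∀ i, P i ∈ 𝓕) (hC : chiSqCapacity 𝓕 ≠ ∞) [IsProbabilityMeasure (averageMeasure P)]
    (hf : ∀ i, Measurable (f i)) (hf0 : ∀ i x, 0 ≤ f i x) (hfn : ∀ i x, f i x ≤ n)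
    (hP : ∀ i, (P i : Measure X) = (averageMeasure P).withDensity fun x => ENNReal.ofReal (f i x)) :
    ∑ i, ((∫ x, f i x * f i x ∂(averageMeasure P)) / n - 1 / n) ≤
      (chiSqCapacity 𝓕).toReal := by
  have h := sum_chiSqDiv_averageMeasure_le_chiSqCapacity hn P hF
  have h1 : ∀ i, chiSqDiv (P i : Measure X) (averageMeasure P) =
      ENNReal.ofReal ((∫ x, f i x * f i x ∂(averageMeasure P)) - 1) := by
    intro i
    have hpr : IsProbabilityMeasure
        ((averageMeasure P).withDensity fun x => ENNReal.ofReal (f i x)) := by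
      rw [← hP i]; infer_instance
    rw [hP i, chiSqDiv_withDensity_ofReal (hf i) (hf0 i) (hfn i)]
    simp only [pow_two]
  have h0 : ∀ i, 0 ≤ (∫ x, f i x * f i x ∂(averageMeasure P)) - 1 := by
    intro i
    have := sq_sum_le_sum_sum_mul_integral_density hf hf0 hfn hP (Pi.single i 1)
    simp [Pi.single_apply] at this
    linarith
  simp only [h1] at h
  have h2 := ENNReal.toReal_mono hC h
  rw [ENNReal.toReal_mul, ENNReal.toReal_inv, ENNReal.toReal_natCast,
    ENNReal.toReal_sum fun i _ => ENNReal.ofReal_ne_top] at h2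
  refine le_trans (le_of_eq ?_) h2
  rw [Finset.mul_sum]
  refine Finset.sum_congr rfl fun i _ => ?_
  rw [ENNReal.toReal_ofReal (h0 i)]
  ring

end Gram

/-! ### Spectral decomposition and spectral gaps. -/

theorem exists_orthogonal_decomposition {ι : Type*} [Fintype ι] [DecidableEq ι]
    {M : Matrix ι ι ℝ} (hM : M.PosSemidef) :
    ∃ (b : ι → ι → ℝ) (lam : ι → ℝ), (∀ k, 0 ≤ lam k) ∧
      (∀ k k', ∑ i, b k i * b k' i = if k = k' then lam k else 0) ∧
      (∀ i i', M i i' = ∑ k, b k i * b k i') ∧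
      (∀ k i, ∑ j, M i j * b k j = lam k * b k i) := by
  set u := hM.1.eigenvectorBasis with hu
  set lam := hM.1.eigenvalues with hl
  have h0 : ∀ k, 0 ≤ lam k := hM.eigenvalues_nonneg
  have horth : ∀ k k', ∑ i, u k i * u k' i = if k = k' then 1 else 0 := by
    intro k k'
    have h := orthonormal_iff_ite.1 u.orthonormal k' k
    rw [PiLp.inner_apply] at h
    simp only [RCLike.inner_apply, conj_trivial] at h
    rw [h]
    simp only [eq_comm]
  refine ⟨fun k i => √(lam k) * u k i, lam, h0, ?_, ?_, ?_⟩
  · intro k k'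
    have : ∀ i, √(lam k) * u k i * (√(lam k') * u k' i) =
        √(lam k) * √(lam k') * (u k i * u k' i) := fun i => by ring
    simp only [this]
    rw [← Finset.mul_sum, horth]
    split_ifs with h
    · rw [← h, mul_one, Real.mul_self_sqrt (h0 k)]
    · rw [mul_zero]
  · intro i i'
    have h := congrFun (congrFun hM.1.spectral_theorem i) i'
    rw [Unitary.conjStarAlgAut_apply, Matrix.mul_apply] at h
    rw [h]
    refine Finset.sum_congr rfl fun k _ => ?_
    rw [Matrix.mul_diagonal, Matrix.star_apply]
    simp only [Matrix.IsHermitian.eigenvectorUnitary_apply, Function.comp_apply, star_trivial]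
    rw [← hu, ← hl]
    simp only [RCLike.ofReal_real_eq_id, id]
    have := Real.mul_self_sqrt (h0 k)
    linear_combination (- (u k i * u k i')) * this
  · intro k i
    have h := congrFun (hM.1.mulVec_eigenvectorBasis k) i
    rw [Matrix.mulVec, dotProduct, Pi.smul_apply, smul_eq_mul, ← hu, ← hl] at h
    have : ∀ j, M i j * (√(lam k) * u k j) = √(lam k) * (M i j * u k j) := fun j => by ring
    simp only [this]
    rw [← Finset.mul_sum, h]
    ring

theorem posSemidef_of_sum_sum_nonneg {ι : Type*} [Fintype ι] {M : Matrix ι ι ℝ}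
    (hs : ∀ i j, M i j = M j i) (h : ∀ v : ι → ℝ, 0 ≤ ∑ i, ∑ j, v i * v j * M i j) :
    M.PosSemidef := by
  refine Matrix.PosSemidef.of_dotProduct_mulVec_nonneg ?_ fun v => ?_
  · ext i j
    rw [Matrix.conjTranspose_apply, star_trivial, hs]
  · refine (h v).trans_eq ?_
    simp only [dotProduct, Matrix.mulVec, Pi.star_apply, star_trivial, Finset.mul_sum]
    exact Finset.sum_congr rfl fun i _ => Finset.sum_congr rfl fun j _ => by ring

theorem sum_sum_sub_sq {ι : Type*} [Fintype ι] (v : ι → ℝ) (hv : ∑ i, v i = 0) :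
    ∑ i, ∑ j, (v i - v j) ^ 2 = 2 * Fintype.card ι * ∑ i, v i ^ 2 := by
  have : ∀ i j, (v i - v j) ^ 2 = v i ^ 2 + v j ^ 2 - 2 * v i * v j := fun i j => by ring
  simp only [this, Finset.sum_sub_distrib, Finset.sum_add_distrib, ← Finset.mul_sum, hv,
    Finset.sum_const, Finset.card_univ, nsmul_eq_mul, mul_zero]
  ring

/-- Poincaré inequality for a doubly stochastic kernel with entries bounded below. -/
theorem le_one_sub_of_le_entries {ι : Type*} [Fintype ι] [Nonempty ι] {G : ι → ι → ℝ} {δ a : ℝ}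
    (hs : ∀ i j, G i j = G j i)
    (hrow : ∀ i, ∑ j, G i j = Fintype.card ι) (hδ : ∀ i j, δ ≤ G i j) {v : ι → ℝ}
    (hv : ∑ i, v i = 0) (hv0 : 0 < ∑ i, v i ^ 2)
    (ha : ∀ i, ∑ j, G i j * v j = Fintype.card ι * a * v i) : δ ≤ 1 - a := by
  have hcard : (0 : ℝ) < Fintype.card ι := by exact_mod_cast Fintype.card_pos
  -- The Dirichlet form of `G` dominates `δ` times that of the complete graph; on a centred
  -- eigenvector both are explicit multiples of `∑ v i ^ 2`.
  have h1 : 0 ≤ ∑ i, ∑ j, (G i j - δ) * (v i - v j) ^ 2 :=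
    Finset.sum_nonneg fun i _ => Finset.sum_nonneg fun j _ =>
      mul_nonneg (sub_nonneg.2 (hδ i j)) (sq_nonneg _)
  have hcol : ∀ j, ∑ i, G i j = Fintype.card ι := fun j => by
    rw [← hrow j]; exact Finset.sum_congr rfl fun i _ => hs i j
  have e1 : ∑ i, ∑ j, G i j * v i ^ 2 = Fintype.card ι * ∑ i, v i ^ 2 := by
    simp only [← Finset.sum_mul, hrow, ← Finset.mul_sum]
  have e2 : ∑ i, ∑ j, G i j * v j ^ 2 = Fintype.card ι * ∑ i, v i ^ 2 := by
    rw [Finset.sum_comm]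
    simp only [← Finset.sum_mul, hcol, ← Finset.mul_sum]
  have e3 : ∑ i, ∑ j, v i * (G i j * v j) = Fintype.card ι * a * ∑ i, v i ^ 2 := by
    simp only [← Finset.mul_sum, ha]
    rw [Finset.mul_sum]
    exact Finset.sum_congr rfl fun i _ => by ring
  have e4 := sum_sum_sub_sq v hv
  have h2 : ∑ i, ∑ j, (G i j - δ) * (v i - v j) ^ 2 =
      (∑ i, ∑ j, G i j * v i ^ 2) + (∑ i, ∑ j, G i j * v j ^ 2) -
        2 * (∑ i, ∑ j, v i * (G i j * v j)) - δ * ∑ i, ∑ j, (v i - v j) ^ 2 := by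
    simp only [Finset.mul_sum, ← Finset.sum_add_distrib, ← Finset.sum_sub_distrib]
    exact Finset.sum_congr rfl fun i _ => Finset.sum_congr rfl fun j _ => by ring
  rw [h2, e1, e2, e3, e4] at h1
  have h3 : 0 ≤ (2 * Fintype.card ι * ∑ i, v i ^ 2) * (1 - a - δ) := by linarith
  have h4 := nonneg_of_mul_nonneg_right h3 (by positivity)
  linarith

/-- The inequality `log y ≤ y - 1` at `y = (1 - a)⁻¹` rearranges to `-log (1 - a) ≤ a * (1 - log (1
- a))`, and the gap bounds the last logarithm by `log Δ`. -/
theorem inv_one_sub_le_rpow_of_inv_le {Δ a : ℝ} (hΔ : 0 < Δ) (ha : 0 ≤ a) (h : Δ⁻¹ ≤ 1 - a) :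
    (1 - a)⁻¹ ≤ (Real.exp 1 * Δ) ^ a := by
  have h1 : 0 < 1 - a := (inv_pos.2 hΔ).trans_le h
  have hlog : -Real.log (1 - a) ≤ Real.log Δ := by
    rw [← Real.log_inv]
    exact Real.log_le_log (inv_pos.2 h1) (inv_le_of_inv_le₀ hΔ h)
  have h2 : 1 + Real.log (1 - a)⁻¹ ≤ (1 - a)⁻¹ := by
    have := Real.add_one_le_exp (Real.log (1 - a)⁻¹)
    rw [Real.exp_log (inv_pos.2 h1)] at this
    linarith
  rw [Real.log_inv] at h2
  have h3 : -Real.log (1 - a) ≤ a * (1 - Real.log (1 - a)) := by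
    have := mul_le_mul_of_nonneg_left h2 h1.le
    rw [mul_inv_cancel₀ h1.ne'] at this
    linarith
  rw [← Real.exp_log (inv_pos.2 h1), Real.rpow_def_of_pos (by positivity),
    Real.log_mul (Real.exp_pos _).ne' hΔ.ne', Real.log_exp, Real.exp_le_exp, Real.log_inv]
  nlinarith

/-- Bernoulli's inequality `(1 + s) ^ p ≤ 1 + p * s` for `0 ≤ p ≤ 1`, with `s = -D / (1 + D)` and `p
= a * (1 + D) / D`, chosen so that the right side is `1 - a`. -/
theorem inv_one_sub_le_rpow_of_mul_le {D a : ℝ} (hD : 0 < D) (ha : 0 ≤ a) (h : a * (1 + D) ≤ D) :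
    (1 - a)⁻¹ ≤ (1 + D) ^ (a * (1 + D) / D) := by
  have hD1 : 0 < 1 + D := by linarith
  have h1 : a * (1 + D) / D ≤ 1 := (div_le_one hD).2 h
  have h0 : 0 ≤ a * (1 + D) / D := by positivity
  have h2 := rpow_one_add_le_one_add_mul_self (s := -(D / (1 + D)))
    (by rw [neg_le_neg_iff, div_le_one hD1]; linarith) h0 h1
  have e1 : 1 + -(D / (1 + D)) = (1 + D)⁻¹ := by field_simp; ring
  have e2 : 1 + a * (1 + D) / D * -(D / (1 + D)) = 1 - a := by field_simp; ring
  rw [e1, e2, Real.inv_rpow hD1.le] at h2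
  exact inv_le_of_inv_le₀ (Real.rpow_pos_of_pos hD1 _) h2

theorem exists_centered_decomposition {ι : Type*} [Fintype ι] [DecidableEq ι] [Nonempty ι]
    {G : ι → ι → ℝ} (hs : ∀ i j, G i j = G j i) (hrow : ∀ i, ∑ j, G i j = Fintype.card ι)
    (hG : ∀ v : ι → ℝ, (∑ i, v i) ^ 2 ≤ ∑ i, ∑ j, v i * v j * G i j) :
    ∃ (b : ι → ι → ℝ) (lam : ι → ℝ), (∀ k, 0 ≤ lam k) ∧ (∀ k, ∑ i, b k i = 0) ∧
      (∀ k k', ∑ i, b k i * b k' i = if k = k' then lam k else 0) ∧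
      (∀ k i, ∑ j, G i j * b k j = Fintype.card ι * lam k * b k i) ∧
      (∑ k, lam k = ∑ i, (G i i / Fintype.card ι - 1 / Fintype.card ι)) ∧
      ((Fintype.card ι)! : ℝ)⁻¹ * ∑ τ : Equiv.Perm ι, ∏ i, G i (τ i) =
        (Fintype.card ι : ℝ) ^ Fintype.card ι / (Fintype.card ι)! *
          ∑ τ : Equiv.Perm ι, ∏ i, (1 / (Fintype.card ι : ℝ) + ∑ k, b k i * b k (τ i)) := by
  set n : ℝ := (Fintype.card ι : ℝ) with hn
  have hn0 : 0 < n := by rw [hn]; exact_mod_cast Fintype.card_pos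
  set M : Matrix ι ι ℝ := Matrix.of fun i j => G i j / n - 1 / n with hM
  have hMij : ∀ i j, M i j = G i j / n - 1 / n := fun i j => rfl
  have hpsd : M.PosSemidef := by
    refine posSemidef_of_sum_sum_nonneg (fun i j => by rw [hMij, hMij, hs]) fun v => ?_
    have h1 : ∑ i, ∑ j, v i * v j * M i j =
        (∑ i, ∑ j, v i * v j * G i j) / n - (∑ i, v i) ^ 2 / n := by
      rw [pow_two, Finset.sum_mul_sum]
      simp only [Finset.sum_div, ← Finset.sum_sub_distrib, hMij]
      exact Finset.sum_congr rfl fun i _ => Finset.sum_congr rfl fun j _ => by ring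
    rw [h1, ← sub_div]
    exact div_nonneg (sub_nonneg.2 (hG v)) hn0.le
  obtain ⟨b, lam, h0, horth, hdec, heig⟩ := exists_orthogonal_decomposition hpsd
  have hcol : ∀ j, ∑ i, M i j = 0 := by
    intro j
    simp only [hMij, Finset.sum_sub_distrib, ← Finset.sum_div, fun i => hs i j, hrow]
    rw [Finset.sum_const, Finset.card_univ, nsmul_eq_mul, ← hn]
    field_simp
    ring
  have hb : ∀ k, ∑ i, b k i = 0 := by
    intro k
    have h1 : ∑ i, ∑ j, M i j * b k j = 0 := by
      rw [Finset.sum_comm]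
      simp only [← Finset.sum_mul, hcol, zero_mul, Finset.sum_const_zero]
    simp only [heig, ← Finset.mul_sum] at h1
    -- Constants lie in the kernel of `M`, so an eigenvector with nonzero eigenvalue is centred; for
    -- eigenvalue 0 the rescaled vector vanishes.
    rcases mul_eq_zero.1 h1 with h | h
    · have h2 := horth k k
      rw [if_pos rfl, h, Finset.sum_eq_zero_iff_of_nonneg fun i _ => mul_self_nonneg _] at h2
      exact Finset.sum_eq_zero fun i hi => mul_self_eq_zero.1 (h2 i hi)
    · exact h
  refine ⟨b, lam, h0, hb, horth, fun k i => ?_, ?_, ?_⟩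
  · have h1 : ∀ j, G i j = n * M i j + 1 := fun j => by rw [hMij]; field_simp; ring
    simp only [h1, add_mul, Finset.sum_add_distrib, one_mul, hb, add_zero, mul_assoc,
      ← Finset.mul_sum, heig]
  · have h1 : ∀ k, lam k = ∑ i, b k i * b k i := fun k => by rw [horth, if_pos rfl]
    simp only [h1]
    rw [Finset.sum_comm]
    exact Finset.sum_congr rfl fun i _ => by rw [← hMij, hdec]
  · simp only [← hdec]
    have h1 : ∀ i j, 1 / n + M i j = G i j / n := fun i j => by rw [hMij]; ring
    simp only [h1, Finset.prod_div_distrib, Finset.prod_const, Finset.card_univ]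
    rw [← Finset.sum_div]
    field_simp

section Gram

variable {X : Type*} [MeasurableSpace X] {n : ℕ} {P : Fin n → ProbabilityMeasure X}
  {f : Fin n → X → ℝ}

/-- The eigenfunction `g = ∑ v i * f i` has mean `n * a * v i` under `P i`, so the Chapman-Robbins
inequality bounds `(v i - v j) ^ 2` by a variance under `P j`. Summing over all pairs gives `2 * a ≤
D * (1 - a)`, slightly more than is needed. -/
theorem mul_one_add_le_of_chiSqDiv_le (hn : n ≠ 0) [IsProbabilityMeasure (averageMeasure P)]
    (hf : ∀ i, Measurable (f i)) (hf0 : ∀ i x, 0 ≤ f i x) (hfn : ∀ i x, f i x ≤ n)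
    (hP : ∀ i, (P i : Measure X) = (averageMeasure P).withDensity fun x => ENNReal.ofReal (f i x))
    {D : ℝ} (hD : 0 ≤ D)
    (h : ∀ i j, chiSqDiv (P i : Measure X) (P j : Measure X) ≤ ENNReal.ofReal D)
    {v : Fin n → ℝ} {a : ℝ} (ha : 0 < a) (hv : ∑ i, v i = 0) (hv0 : 0 < ∑ i, v i ^ 2)
    (heig : ∀ i, ∑ j, (∫ x, f i x * f j x ∂(averageMeasure P)) * v j = n * a * v i) :
    a * (1 + D) ≤ D := by
  have hn0 : (0 : ℝ) < n := by exact_mod_cast Nat.pos_of_ne_zero hn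
  set S := ∑ i, v i ^ 2 with hS
  set g : X → ℝ := fun x => ∑ i, v i * f i x with hg
  have hgm : Measurable g := Finset.measurable_fun_sum _ fun i _ => (hf i).const_mul _
  have hgK : ∀ x, |g x| ≤ ∑ i, |v i| * n := fun x =>
    (Finset.abs_sum_le_sum_abs _ _).trans (Finset.sum_le_sum fun i _ => by
      rw [abs_mul, abs_of_nonneg (hf0 i x)]
      exact mul_le_mul_of_nonneg_left (hfn i x) (abs_nonneg _))
  have hgi2 : ∀ j, Integrable (fun x => g x ^ 2) (P j : Measure X) := fun j =>
    integrable_of_abs_le _ (hgm.pow_const 2) (K := (∑ i, |v i| * n) ^ 2) fun x => by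
      rw [abs_pow]; exact pow_le_pow_left₀ (abs_nonneg _) (hgK x) 2
  have hint : ∀ i j, Integrable (fun x => f i x * f j x) (averageMeasure P) :=
    fun i j => integrable_of_abs_le (averageMeasure P)
      (show Measurable fun x => f i x * f j x from (hf i).mul (hf j)) (K := n * n)
      fun x => by
        rw [abs_of_nonneg (mul_nonneg (hf0 i x) (hf0 j x))]
        exact mul_le_mul (hfn i x) (hfn j x) (hf0 j x) (Nat.cast_nonneg n)
  have hEg : ∀ i, ∫ x, g x ∂(P i : Measure X) = n * a * v i := by
    intro i
    rw [integral_eq_integral_mul_density hf hf0 hP, ← heig i]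
    have : ∀ x, f i x * g x = ∑ j, f i x * f j x * v j := fun x => by
      rw [hg, Finset.mul_sum]; exact Finset.sum_congr rfl fun j _ => by ring
    simp only [this]
    rw [integral_finsetSum _ fun j _ => (hint i j).mul_const _]
    exact Finset.sum_congr rfl fun j _ => integral_mul_const _ _
  have hEg2 : ∑ j, ∫ x, g x ^ 2 ∂(P j : Measure X) = n * (n * a * S) := by
    rw [sum_integral_eq_integral_averageMeasure hn hgi2, hg,
      ← sum_sum_mul_integral_density hf hf0 hfn v]
    congr 1
    have : ∀ i j, v i * v j * ∫ x, f i x * f j x ∂(averageMeasure P) =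
      v i * ((∫ x, f i x * f j x ∂(averageMeasure P)) * v j) := fun i j => by ring
    simp only [this, ← Finset.mul_sum, heig]
    rw [hS, Finset.mul_sum]
    exact Finset.sum_congr rfl fun i _ => by ring
  have h1 : ∀ i j, (n * a) ^ 2 * (v i - v j) ^ 2 ≤
      D * (∫ x, g x ^ 2 ∂(P j : Measure X) - (n * a) ^ 2 * v j ^ 2) := by
    intro i j
    have := sq_integral_sub_integral_le hD (h i j) hgm hgK
    rw [hEg, hEg] at this
    linarith
  have h2 := Finset.sum_le_sum fun i (_ : i ∈ Finset.univ) =>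
    Finset.sum_le_sum fun j (_ : j ∈ Finset.univ) => h1 i j
  have hSS := sum_sum_sub_sq v hv
  simp only [← Finset.mul_sum, Finset.sum_sub_distrib, hEg2, hSS] at h2
  rw [Finset.sum_const, Finset.card_univ, Fintype.card_fin, nsmul_eq_mul, ← hS] at h2
  have h3 : 0 ≤ (n ^ 3 * S * a) * (D * (1 - a) - 2 * a) := by linarith
  have h4 := nonneg_of_mul_nonneg_right h3 (by positivity)
  linarith

end Gram

theorem toReal_hellingerSingularity {X : Type*} [MeasurableSpace X]
    {𝓕 : Set (ProbabilityMeasure X)} (h : hellingerSingularity 𝓕 < ∞) :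
    (hellingerDiam 𝓕).toReal < 2 ∧ hellingerDiam 𝓕 ≠ ∞ ∧
      (hellingerSingularity 𝓕).toReal = ((1 - (hellingerDiam 𝓕).toReal / 2) ^ 2)⁻¹ := by
  rw [hellingerSingularity, ENNReal.inv_lt_top] at h
  have h1 : hellingerDiam 𝓕 / 2 < 1 := by
    by_contra h2
    rw [tsub_eq_zero_of_le (not_lt.1 h2)] at h
    simp at h
  have h2 : hellingerDiam 𝓕 < 2 := by
    rwa [ENNReal.div_lt_iff (Or.inl two_ne_zero) (Or.inl ENNReal.ofNat_ne_top), one_mul] at h1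
  have h3 : hellingerDiam 𝓕 ≠ ∞ := (h2.trans ENNReal.ofNat_lt_top).ne
  refine ⟨?_, h3, ?_⟩
  · have := (ENNReal.toReal_lt_toReal h3 ENNReal.ofNat_ne_top).2 h2
    simpa using this
  · rw [hellingerSingularity, ENNReal.toReal_inv, ENNReal.toReal_pow,
      ENNReal.toReal_sub_of_le h1.le ENNReal.one_ne_top, ENNReal.toReal_div]
    simp

theorem prod_le_rpow_sum {κ : Type*} [Fintype κ] {a x : κ → ℝ} {A s : ℝ} (hA : 1 ≤ A)
    (ha : ∀ k, 0 ≤ a k) (h : ∀ k, a k ≤ A ^ x k) (hs : ∑ k, x k ≤ s) :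
    ∏ k, a k ≤ A ^ s :=
  calc ∏ k, a k ≤ ∏ k, A ^ x k := Finset.prod_le_prod (fun k _ => ha k) fun k _ => h k
    _ = A ^ ∑ k, x k := (Real.rpow_sum_of_pos (by linarith) _ _).symm
    _ ≤ A ^ s := Real.rpow_le_rpow_of_exponent_le hA hs

/-! ### The three bounds. -/

theorem theorem1 {X : Type*} [MeasurableSpace X] (𝓕 : Set (ProbabilityMeasure X))
    (n : ℕ) (hn : 1 ≤ n) (P : Fin n → ProbabilityMeasure X) (hP : ∀ i, P i ∈ 𝓕) :
    (chiSqCapacity 𝓕 < ∞ →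
      chiSqDiv (permMixture P) (iidMixture P) ≤
        10 * ∑ ℓ ∈ Finset.Icc 2 n, chiSqCapacity 𝓕 ^ ℓ) ∧
    (hellingerSingularity 𝓕 < ∞ → chiSqCapacity 𝓕 < ∞ →
      chiSqDiv (permMixture P) (iidMixture P) ≤
        ENNReal.ofReal
          ((Real.exp 1 * (hellingerSingularity 𝓕).toReal) ^ (chiSqCapacity 𝓕).toReal - 1)) ∧
    (chiSqDiam 𝓕 < ∞ →
      chiSqCapacity 𝓕 < ∞ ∧
      chiSqDiv (permMixture P) (iidMixture P) ≤
        ENNReal.ofReal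
          ((1 + (chiSqDiam 𝓕).toReal) ^ (1 + (chiSqCapacity 𝓕).toReal) - 1)) := by
  have hn0 : n ≠ 0 := by omega
  have : Nonempty (Fin n) := ⟨⟨0, hn⟩⟩
  have hQ := isProbabilityMeasure_averageMeasure hn0 P
  obtain ⟨f, hf, hf0, hfn, hPf⟩ := exists_density_averageMeasure hn0 P
  have hchi := chiSqDiv_permMixture P hf hf0 hfn hPf
  have hs : ∀ i j, ∫ x, f i x * f j x ∂(averageMeasure P) =
      ∫ x, f j x * f i x ∂(averageMeasure P) := fun i j => by simp only [mul_comm]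
  have hrow := sum_integral_density_mul_density hn0 hf hf0 hfn hPf
  obtain ⟨b, lam, hlam0, hb, horth, heig, htr, hperm⟩ := exists_centered_decomposition hs
    (by rw [Fintype.card_fin]; exact hrow)
    (sq_sum_le_sum_sum_mul_integral_density hf hf0 hfn hPf)
  have hle10 := permanent_le_of_sum_eq_zero b hb
  have hprod := permanent_le_prod_inv_one_sub b lam hb horth
  rw [← hperm, Fintype.card_fin] at hle10 hprod
  rw [Fintype.card_fin] at htr heig
  have hnorm : ∀ k, ∑ i, b k i ^ 2 = lam k := fun k => by
    simpa only [pow_two, if_true] using horth k k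
  have htrC : chiSqCapacity 𝓕 < ∞ → ∑ k, lam k ≤ (chiSqCapacity 𝓕).toReal := fun hC => by
    rw [htr]; exact sum_integral_density_sq_le hn0 hP hC.ne hf hf0 hfn hPf
  have hpr : ∀ i, IsProbabilityMeasure
      ((averageMeasure P).withDensity fun x => ENNReal.ofReal (f i x)) := fun i => by
    rw [← hPf i]; infer_instance
  rw [hchi]
  refine ⟨fun hC => ?_, fun hΔ hC => ?_, fun hD => ?_⟩
  · have e : 10 * ∑ ℓ ∈ Finset.Icc 2 n, chiSqCapacity 𝓕 ^ ℓ =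
        ENNReal.ofReal (10 * ∑ ℓ ∈ Finset.Icc 2 n, (chiSqCapacity 𝓕).toReal ^ ℓ) := by
      rw [ENNReal.ofReal_mul (by norm_num), ENNReal.ofReal_ofNat,
        ENNReal.ofReal_sum_of_nonneg fun _ _ => pow_nonneg ENNReal.toReal_nonneg _]
      simp only [ENNReal.ofReal_pow ENNReal.toReal_nonneg, ENNReal.ofReal_toReal hC.ne]
    rw [e]
    refine ENNReal.ofReal_le_ofReal ?_
    rw [sub_le_iff_le_add']
    refine hle10.trans ?_
    simp only [hnorm]
    gcongr
    · exact Finset.sum_nonneg fun k _ => hlam0 k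
    · exact htrC hC
  · obtain ⟨hd2, hdtop, hsing⟩ := toReal_hellingerSingularity hΔ
    set d := (hellingerDiam 𝓕).toReal with hd
    set Δ := (hellingerSingularity 𝓕).toReal with hΔdef
    have hd0 : 0 ≤ d := ENNReal.toReal_nonneg
    have hδ : 0 < (1 - d / 2) ^ 2 := pow_pos (by linarith) 2
    have hΔ0 : 0 < Δ := by rw [hsing]; exact inv_pos.2 hδ
    have hinv : Δ⁻¹ = (1 - d / 2) ^ 2 := by rw [hsing, inv_inv]
    have hΔ1 : 1 ≤ Δ := by
      rw [hsing]
      exact (one_le_inv₀ hδ).2 (pow_le_one₀ (by linarith) (by linarith))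
    have hent : ∀ i j, (1 - d / 2) ^ 2 ≤ ∫ x, f i x * f j x ∂(averageMeasure P) := by
      intro i j
      refine one_sub_sq_le_integral_mul_of_hellingerSq_le (hf i) (hf j) (hf0 i) (hf0 j) (hfn i)
        (hfn j) (integral_density_eq_one hf hf0 hPf i) (integral_density_eq_one hf hf0 hPf j)
        hd0 hd2.le ?_
      rw [← hellingerSq_withDensity_ofReal (hf i) (hf j) (hf0 i) (hf0 j), ← hPf i, ← hPf j,
        hd, ENNReal.ofReal_toReal hdtop]
      exact le_iSup₂_of_le (P i) (hP i) (le_iSup₂_of_le (P j) (hP j) le_rfl)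
    have hgap : ∀ k, Δ⁻¹ ≤ 1 - lam k := by
      intro k
      rcases (hlam0 k).eq_or_lt with h | h
      · rw [← h, sub_zero]; exact inv_le_one_of_one_le₀ hΔ1
      · rw [hinv]
        exact le_one_sub_of_le_entries hs (by rw [Fintype.card_fin]; exact hrow) hent (hb k)
          (by rw [hnorm]; exact h) (by rw [Fintype.card_fin]; exact heig k)
    have hpos : ∀ k, 0 < 1 - lam k := fun k => (inv_pos.2 hΔ0).trans_le (hgap k)
    refine ENNReal.ofReal_le_ofReal (sub_le_sub_right ?_ 1)
    refine (hprod fun k => by linarith [hpos k]).trans ?_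
    exact prod_le_rpow_sum (one_le_mul_of_one_le_of_one_le (Real.one_le_exp zero_le_one) hΔ1)
      (fun k => inv_nonneg.2 (hpos k).le)
      (fun k => inv_one_sub_le_rpow_of_inv_le hΔ0 (hlam0 k) (hgap k)) (htrC hC)
  · have hCD := chiSqCapacity_le_chiSqDiam hD.ne
    have hC : chiSqCapacity 𝓕 < ∞ := hCD.trans_lt hD
    refine ⟨hC, ?_⟩
    have hCD' := ENNReal.toReal_mono hD.ne hCD
    set D := (chiSqDiam 𝓕).toReal with hDdef
    set C := (chiSqCapacity 𝓕).toReal with hCdef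
    have hC0 : 0 ≤ C := ENNReal.toReal_nonneg
    have hD0 : 0 ≤ D := ENNReal.toReal_nonneg
    have hdiv : ∀ i j, chiSqDiv (P i : Measure X) (P j : Measure X) ≤ ENNReal.ofReal D := by
      intro i j
      rw [hDdef, ENNReal.ofReal_toReal hD.ne]
      exact le_iSup₂_of_le (P i) (hP i) (le_iSup₂_of_le (P j) (hP j) le_rfl)
    have hgap : ∀ k, lam k * (1 + D) ≤ D := by
      intro k
      rcases (hlam0 k).eq_or_lt with h | h
      · rw [← h, zero_mul]; exact hD0
      · exact mul_one_add_le_of_chiSqDiv_le hn0 hf hf0 hfn hPf hD0 hdiv h (hb k)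
          (by rw [hnorm]; exact h) (heig k)
    have hlt : ∀ k, lam k < 1 := fun k => by
      by_contra! h
      nlinarith [hgap k]
    refine ENNReal.ofReal_le_ofReal (sub_le_sub_right ((hprod hlt).trans ?_) 1)
    -- The exponent `a * (1 + D) / D` needs `D > 0`; for `D = 0` all eigenvalues vanish.
    rcases hD0.eq_or_lt with h | h
    · have hl : ∀ k, lam k = 0 := fun k => le_antisymm (by simpa [← h] using hgap k) (hlam0 k)
      simp [hl, ← h]
    · refine prod_le_rpow_sum (by linarith) (fun k => inv_nonneg.2 (by linarith [hlt k]))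
        (fun k => inv_one_sub_le_rpow_of_mul_le h (hlam0 k) (hgap k)) ?_
      have h1 := htrC hC
      -- The exponents add up to at most `C * (1 + D) / D = C + C / D`, and `C ≤ D`.
      rw [← Finset.sum_div, ← Finset.sum_mul, div_le_iff₀ h]
      nlinarith
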